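/- Let $\mathcal A$ and $\mathcal B$ be abelian categories, with $\mathcal A$ having enough projectives, and let $F\colon\mathcal A\to\mathcal B$ be a functor (not necessarily additive) with $F(0)=0$. For objects $X_1,\dots,X_n$ of $\mathcal A$, let $e_i$ be the idempotent endomorphism of $X_1\oplus\cdots\oplus X_n$ with image $X_i$, and let the $n$-th cross effect $F_n(X_1,\dots,X_n)$ be the image of the endomorphism $\sum_{S\subset\{1,\dots,n\}}(-1)^{n-|S|}F\big(\sum_{i\in S}e_i\big)$ of $F(X_1\oplus\cdots\oplus X_n)$. Let $d\geq 1$ be an integer and assume that $F$ is of degree $\leq d$, that is, $F_{d+1}$ vanishes. Let $K_{\geq 0}(\mathcal A)$ be the homotopy category of chain complexes in $\mathcal A$ concentrated in non-negative degrees. The total derived functor (of Dold and Puppe) $LF\colon K_{\geq 0}(\mathcal A)\to K_{\geq 0}(\mathcal B)$ sends a complex $X$ to the (alternating face map) chain complex $C(F(P))$ of the simplicial object $F(P)$, where $P$ is a simplicial object of $\mathcal A$ with projective terms, together with a quasi-isomorphism $C(P)\to X$; such a $P$ exists, and is unique up to simplicial homotopy equivalence. Let $\mathcal A_0\subset\mathcal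 A$ and $\mathcal B_0\subset\mathcal B$ be weak Serre subcategories, that is, non-empty full subcategories such that for every exact sequence $X_0\to X_1\to X_2\to X_3\to X_4$ in the ambient abelian category with $X_0,X_1,X_3,X_4$ in the subcategory, $X_2$ is in the subcategory as well. Let $K^{\mathcal A_0}_{\geq 0}(\mathcal A)$ be the full subcategory of $K_{\geq 0}(\mathcal A)$ of the complexes $X$ with $H_i(X)\in\mathcal A_0$ for all $i$ and $H_i(X)=0$ for all sufficiently large $i$, and for such $X$ let $\chi(X)=\sum_i(-1)^i[H_i(X)]$ in the Grothendieck group $K_0(\mathcal A_0)$; similarly for $\mathcal B_0\subset\mathcal B$. Assume that $LF$ maps $K^{\mathcal A_0}_{\geq 0}(\mathcal A)$ to $K^{\mathcal B_0}_{\geq 0}(\mathcal B)$. Then there is a unique map $f\colon K_0(\mathcal A_0)\to K_0(\mathcal B_0)$ such that $\chi(LF(X))=f(\chi(X))$ for all $X$ in $K^{\mathcal A_0}_{\geq 0}(\mathcal A)$. Moreover, $f$ is of degree $\leq d$, where a map between abelian groups is of degree $\leq 1$ if it is additive, and, for $d\geq 2$, a map $f$ is of degree $\leq d$ if the function $g(x,y)=f(x+y)-f(x)-f(y)$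 is of degree $\leq d-1$ in each of the two arguments. -/

import Mathlib

open CategoryTheory CategoryTheory.Limits Opposite

universe v u v' u'

noncomputable section

namespace DoldPuppe

attribute [local instance] Abelian.hasFiniteBiproducts

/-! ### Functors of finite degree -/

section CrossEffects

variable {A : Type u} [Category.{v} A] [Abelian A] {B : Type u'} [Category.{v'} B] [Abelian B]

/-- For `S ⊆ {1, …, n}`, the idempotent `e_S = ∑_{i ∈ S} e_i` of `X₁ ⊕ ⋯ ⊕ Xₙ` with image
`⊕_{i ∈ S} X_i`. -/
def partialId {n : ℕ} (X : Fin n → A) (S : Finset (Fin n)) : (⨁ X) ⟶ (⨁ X) :=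
  ∑ i ∈ S, biproduct.π X i ≫ biproduct.ι X i

/-- The endomorphism `∑_S (-1)^(n - |S|) F(e_S)` of `F(X₁ ⊕ ⋯ ⊕ Xₙ)`. -/
def crossMap (F : A ⥤ B) {n : ℕ} (X : Fin n → A) : F.obj (⨁ X) ⟶ F.obj (⨁ X) :=
  ∑ S : Finset (Fin n), (-1 : ℤ) ^ (n - S.card) • F.map (partialId X S)

/-- The `n`-th cross effect `F_n(X₁, …, Xₙ)` of `F`. -/
def crossEffect (F : A ⥤ B) {n : ℕ} (X : Fin n → A) : B :=
  image (crossMap F X)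

/-- A functor `F` (with `F(0) = 0`) is of degree `≤ d` if its `(d+1)`-st cross effect vanishes. -/
def FunctorDegreeLE (F : A ⥤ B) (d : ℕ) : Prop :=
  ∀ X : Fin (d + 1) → A, IsZero (crossEffect F X)

end CrossEffects

/-- A map `f` between abelian groups is of degree `≤ 1` if it is additive, and of degree `≤ d`
if `f(x + y) - f(x) - f(y)` is of degree `≤ d - 1` in each of the two arguments.
(For `d = 0`, not used in the theorem, we ask for the zero map.) -/
def MapDegreeLE {G H : Type*} [AddCommGroup G] [AddCommGroup H] : ℕ → (G → H) → Prop
  | 0, f => ∀ x, f x = 0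
  | 1, f => ∀ x y, f (x + y) = f x + f y
  | d + 2, f =>
    (∀ y, MapDegreeLE (d + 1) (fun x => f (x + y) - f x - f y)) ∧
      (∀ x, MapDegreeLE (d + 1) (fun y => f (x + y) - f x - f y))

/-! ### Weak Serre subcategories and their Grothendieck groups -/

section

variable {A : Type u} [Category.{v} A] [Abelian A]

/-- A weak Serre subcategory of an abelian category: a nonempty full subcategory such that in
every exact sequence `X₀ ⟶ X₁ ⟶ X₂ ⟶ X₃ ⟶ X₄` with `X₀, X₁, X₃, X₄` in it, also `X₂` is in it. -/
structure IsWeakSerre (P : ObjectProperty A) : Prop where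
  nonempty : ∃ X, P X
  prop_of_exact (S : ComposableArrows A 4) (hS : S.Exact)
    (h₀ : P (S.obj 0)) (h₁ : P (S.obj 1)) (h₃ : P (S.obj 3)) (h₄ : P (S.obj 4)) : P (S.obj 2)

/-- The relations `[X₂] - [X₁] - [X₃]`, for the short exact sequences
`0 ⟶ X₁ ⟶ X₂ ⟶ X₃ ⟶ 0` with all terms satisfying `P`. -/
def k0Relations (P : ObjectProperty A) : Set (FreeAbelianGroup P.FullSubcategory) :=
  {x | ∃ (S : ShortComplex A) (_ : S.ShortExact) (h₁ : P S.X₁) (h₂ : P S.X₂) (h₃ : P S.X₃),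
    x = FreeAbelianGroup.of ⟨S.X₂, h₂⟩ - FreeAbelianGroup.of ⟨S.X₁, h₁⟩ -
      FreeAbelianGroup.of ⟨S.X₃, h₃⟩}

/-- The Grothendieck group `K₀` of the full subcategory given by `P`. -/
abbrev K0 (P : ObjectProperty A) : Type u :=
  FreeAbelianGroup P.FullSubcategory ⧸ AddSubgroup.closure (k0Relations P)

/-- The class `[X]` in `K₀`. -/
def K0.of (P : ObjectProperty A) (X : A) (hX : P X) : K0 P :=
  QuotientAddGroup.mk (FreeAbelianGroup.of ⟨X, hX⟩)

lemma K0.of_eq_zero (P : ObjectProperty A) (X : A) (hX : P X) (h : IsZero X) :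
    K0.of P X hX = 0 := by
  have hS : (ShortComplex.mk (0 : X ⟶ X) (0 : X ⟶ X) zero_comp).ShortExact :=
    { exact := ShortComplex.exact_of_isZero_X₂ _ h
      mono_f := ⟨fun _ _ _ => h.eq_of_tgt _ _⟩
      epi_g := ⟨fun _ _ _ => h.eq_of_src _ _⟩ }
  have hmem : FreeAbelianGroup.of (⟨X, hX⟩ : P.FullSubcategory) - FreeAbelianGroup.of ⟨X, hX⟩ -
      FreeAbelianGroup.of ⟨X, hX⟩ ∈ AddSubgroup.closure (k0Relations P) :=
    AddSubgroup.subset_closure ⟨_, hS, hX, hX, hX, rfl⟩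
  rw [sub_self, zero_sub] at hmem
  exact (QuotientAddGroup.eq_zero_iff _).2 (neg_mem_iff.1 hmem)

/-! ### Complexes with bounded homology in a subcategory -/

/-- `K_{≥0}(A)`: the homotopy category of chain complexes concentrated in non-negative degrees. -/
abbrev KNonneg (A : Type u) [Category.{v} A] [Abelian A] : Type (max u v) :=
  HomotopyCategory A (ComplexShape.down ℕ)

/-- The homology object `H_i(X)` of an object of `K_{≥0}(A)`. -/
abbrev homologyObj (X : KNonneg A) (i : ℕ) : A :=
  (HomotopyCategory.homologyFunctor A (ComplexShape.down ℕ) i).obj X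

/-- The objects of `K_{≥0}(A)` whose homology satisfies `P` and vanishes in large degrees. -/
def BoundedHomologyIn (P : ObjectProperty A) : ObjectProperty (KNonneg A) := fun X =>
  (∃ N : ℕ, ∀ i, N ≤ i → IsZero (homologyObj X i)) ∧ ∀ i, P (homologyObj X i)

/-- The Euler characteristic `χ(X) = ∑ᵢ (-1)ⁱ [H_i(X)]` in `K₀`; the sum has finite support. -/
def eulerChar (P : ObjectProperty A) (X : KNonneg A) (hX : BoundedHomologyIn P X) : K0 P :=
  ∑ᶠ i : ℕ, (-1 : ℤ) ^ i • K0.of P (homologyObj X i) (hX.2 i)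

lemma eulerChar_support_finite (P : ObjectProperty A) (X : KNonneg A)
    (hX : BoundedHomologyIn P X) :
    (Function.support fun i : ℕ =>
      (-1 : ℤ) ^ i • K0.of P (homologyObj X i) (hX.2 i)).Finite := by
  obtain ⟨N, hN⟩ := hX.1
  refine (Set.finite_lt_nat N).subset fun i hi => ?_
  by_contra h
  refine hi ?_
  dsimp only
  rw [K0.of_eq_zero _ _ _ (hN i (not_lt.1 h)), smul_zero]

end

section DerivedFunctor

variable {A : Type u} [Category.{v} A] [Abelian A]

/-! ### Projective resolutions of complexes -/

/-- A stage of the inductive construction of a projective resolution `f : P ⟶ X`: the term in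
degree `n`, with its cycles `Z`. -/
structure ResStage (X : ChainComplex A ℕ) (n : ℕ) where
  P : A
  proj : Projective P
  Z : A
  k : Z ⟶ P
  f : P ⟶ X.X n

namespace ResStage

variable [EnoughProjectives A] {X : ChainComplex A ℕ} {n : ℕ} (S : ResStage X n)

lemma exists_next : ∃ (T : ResStage X (n + 1)) (e : T.P ⟶ S.Z),
    T.k ≫ e ≫ S.k = 0 ∧
    e ≫ S.k ≫ S.f = T.f ≫ X.d (n + 1) n ∧
    (∀ ⦃Y : A⦄ (x : Y ⟶ T.P), x ≫ e ≫ S.k = 0 → ∃ x', x' ≫ T.k = x) ∧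
    (∀ ⦃Y : A⦄ (x : Y ⟶ S.Z) (y : Y ⟶ X.X (n + 1)), x ≫ S.k ≫ S.f = y ≫ X.d (n + 1) n →
      ∃ (Y' : A) (t : Y' ⟶ Y) (_ : Epi t) (z : Y' ⟶ T.P), z ≫ e = t ≫ x ∧ z ≫ T.f = t ≫ y) := by
  let W := pullback (S.k ≫ S.f) (X.d (n + 1) n)
  let p : Projective.over W ⟶ W := Projective.π W
  refine ⟨⟨Projective.over W, inferInstance, kernel (p ≫ pullback.fst _ _ ≫ S.k), kernel.ι _,
    p ≫ pullback.snd _ _⟩, p ≫ pullback.fst _ _, ?_, ?_, ?_, ?_⟩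
  · simp
  · simp [W, pullback.condition]
  · intro Y x hx
    exact ⟨kernel.lift _ x (by simpa using hx), kernel.lift_ι _ _ _⟩
  · intro Y x y h
    obtain ⟨Y', t, ht, z, hz⟩ := surjective_up_to_refinements_of_epi p (pullback.lift x y h)
    refine ⟨Y', t, ht, z, ?_, ?_⟩
    · rw [← Category.assoc, ← hz, Category.assoc, pullback.lift_fst]
    · dsimp
      rw [← Category.assoc, ← hz, Category.assoc, pullback.lift_snd]

/-- A next stage of the construction. -/
def next : ResStage X (n + 1) := S.exists_next.choose

/-- The map from the next term to the cycles. -/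
def e : S.next.P ⟶ S.Z := S.exists_next.choose_spec.choose

/-- The differential. -/
def d : S.next.P ⟶ S.P := S.e ≫ S.k

lemma k_d : S.next.k ≫ S.d = 0 := S.exists_next.choose_spec.choose_spec.1

lemma d_f : S.d ≫ S.f = S.next.f ≫ X.d (n + 1) n :=
  (Category.assoc _ _ _).trans S.exists_next.choose_spec.choose_spec.2.1

lemma exists_of_d {Y : A} (x : Y ⟶ S.next.P) (hx : x ≫ S.d = 0) : ∃ x', x' ≫ S.next.k = x :=
  S.exists_next.choose_spec.choose_spec.2.2.1 x hx

lemma exists_lift {Y : A} (x : Y ⟶ S.Z) (y : Y ⟶ X.X (n + 1))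
    (h : x ≫ S.k ≫ S.f = y ≫ X.d (n + 1) n) :
    ∃ (Y' : A) (t : Y' ⟶ Y) (_ : Epi t) (z : Y' ⟶ S.next.P),
      z ≫ S.e = t ≫ x ∧ z ≫ S.next.f = t ≫ y :=
  S.exists_next.choose_spec.choose_spec.2.2.2 x y h

lemma d_d : S.next.d ≫ S.d = 0 := by
  rw [d, Category.assoc, k_d, comp_zero]

end ResStage

section
variable [EnoughProjectives A] (X : ChainComplex A ℕ)

/-- All stages of the construction. -/
def resStage : (n : ℕ) → ResStage X n
  | 0 => ⟨Projective.over (X.X 0), inferInstance, Projective.over (X.X 0), 𝟙 _, Projective.π _⟩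
  | n + 1 => (resStage n).next

lemma exists_projective_resolution :
    ∃ (P : ChainComplex A ℕ) (f : P ⟶ X), (∀ n, Projective (P.X n)) ∧ QuasiIso f := by
  let P : ChainComplex A ℕ := ChainComplex.of (fun n => (resStage X n).P)
    (fun n => (resStage X n).d) (fun n => (resStage X n).d_d)
  have hd (n : ℕ) : P.d (n + 1) n = (resStage X n).d := ChainComplex.of_d
    (fun n => (resStage X n).P) (fun n => (resStage X n).d) n
  let f : P ⟶ X :=
    { f := fun n => (resStage X n).f
      comm' := by
        rintro i j (rfl : j + 1 = i)
        rw [hd]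
        exact (resStage X j).d_f.symm }
  have hf (n : ℕ) : f.f n = (resStage X n).f := rfl
  refine ⟨P, f, fun n => (resStage X n).proj, ⟨fun n => ?_⟩⟩
  rw [quasiIsoAt_iff_isIso_homologyMap]
  have hprev (n : ℕ) : (ComplexShape.down ℕ).prev n = n + 1 := by simp
  have hcyc (n : ℕ) {Y : A} (x : Y ⟶ P.X n) (hx : x ≫ P.d n ((ComplexShape.down ℕ).next n) = 0) :
      ∃ x' : Y ⟶ (resStage X n).Z, x' ≫ (resStage X n).k = x := by
    cases n with
    | zero => exact ⟨x, Category.comp_id _⟩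
    | succ n =>
      have : (ComplexShape.down ℕ).next (n + 1) = n := by simp
      rw [this, hd] at hx
      exact (resStage X n).exists_of_d x hx
  have h1 : Mono (HomologicalComplex.homologyMap f n) := by
    rw [HomologicalComplex.mono_homologyMap_iff_up_to_refinements f (n + 1) n _ (hprev n) rfl]
    intro Y x hx y hy
    obtain ⟨x, rfl⟩ := hcyc n x hx
    obtain ⟨Y', t, ht, z, hz, -⟩ := (resStage X n).exists_lift x y (by simpa [hf] using hy)
    have key : t ≫ x ≫ (resStage X n).k = z ≫ (resStage X n).d := by
      rw [ResStage.d, reassoc_of% hz]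
    exact ⟨Y', t, ht, z, key.trans (congrArg (z ≫ ·) (hd n).symm)⟩
  have h2 : Epi (HomologicalComplex.homologyMap f n) := by
    rw [HomologicalComplex.epi_homologyMap_iff_up_to_refinements f (n + 1) n _ (hprev n) rfl]
    intro Y y hy
    cases n with
    | zero =>
      obtain ⟨Y', t, ht, z, hz⟩ := surjective_up_to_refinements_of_epi (Projective.π (X.X 0)) y
      refine ⟨Y', t, ht, z, ?_, 0, ?_⟩
      · rw [P.shape _ _ (by simp)]
        exact comp_zero
      · rw [hz, zero_comp, add_zero]
        rfl
    | succ n =>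
      have : (ComplexShape.down ℕ).next (n + 1) = n := by simp
      rw [this] at hy ⊢
      obtain ⟨Y', t, ht, z, hz, hz'⟩ := (resStage X n).exists_lift 0 y (by simp [hy])
      refine ⟨Y', t, ht, z, ?_, 0, ?_⟩
      · have key : z ≫ (resStage X n).d = 0 := by
          rw [ResStage.d, reassoc_of% hz, zero_comp, comp_zero]
        exact (congrArg (z ≫ ·) (hd n)).trans key
      · rw [zero_comp, add_zero]
        exact hz'.symm
  exact isIso_of_mono_of_epi _

end

/-! ### Cylinders of simplicial objects -/

open scoped Simplicial

/-- Simplices of the simplicial interval: maps `[n] ⟶ [1]`. -/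
abbrev CylIndex (Δ : SimplexCategoryᵒᵖ) : Type := Δ.unop ⟶ (⦋1⦌ : SimplexCategory)

instance (Δ : SimplexCategoryᵒᵖ) : Finite (CylIndex Δ) :=
  Finite.of_injective (fun s : CylIndex Δ => (s.toOrderHom : Fin (Δ.unop.len + 1) → Fin 2))
    (fun s t h => by
      apply SimplexCategory.Hom.ext
      exact OrderHom.ext _ _ h)

section
variable (P : SimplicialObject A)

/-- The cylinder `P ⊗ Δ[1]`, with `∐_{[n] ⟶ [1]} P_n` in degree `n`. -/
def cyl : SimplicialObject A where
  obj Δ := ∐ fun _ : CylIndex Δ => P.obj Δ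
  map {Δ Δ'} θ := Sigma.desc fun s => P.map θ ≫
    Sigma.ι (fun _ : CylIndex Δ' => P.obj Δ') (θ.unop ≫ s)
  map_id Δ := by ext; simp
  map_comp θ θ' := by ext; simp

/-- Inclusions of the summands of the cylinder. -/
def cylι {Δ : SimplexCategoryᵒᵖ} (s : CylIndex Δ) : P.obj Δ ⟶ (cyl P).obj Δ :=
  Sigma.ι (fun _ : CylIndex Δ => P.obj Δ) s

lemma cylι_map {Δ Δ' : SimplexCategoryᵒᵖ} (s : CylIndex Δ) (θ : Δ ⟶ Δ') :
    cylι P s ≫ (cyl P).map θ = P.map θ ≫ cylι P (θ.unop ≫ s) := by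
  simp [cyl, cylι]

/-- Maps out of a term of the cylinder. -/
def cylDesc {Δ : SimplexCategoryᵒᵖ} {T : A} (f : CylIndex Δ → (P.obj Δ ⟶ T)) :
    (cyl P).obj Δ ⟶ T := Sigma.desc f

lemma cylι_desc {Δ : SimplexCategoryᵒᵖ} {T : A} (f : CylIndex Δ → (P.obj Δ ⟶ T))
    (s : CylIndex Δ) : cylι P s ≫ cylDesc P f = f s :=
  Sigma.ι_desc _ _

lemma cyl_hom_ext {Δ : SimplexCategoryᵒᵖ} {T : A} (f g : (cyl P).obj Δ ⟶ T)
    (h : ∀ s, cylι P s ≫ f = cylι P s ≫ g) : f = g :=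
  Sigma.hom_ext _ _ h

/-- The constant map with value `a`. -/
def cst (Δ : SimplexCategoryᵒᵖ) (a : Fin 2) : CylIndex Δ :=
  SimplexCategory.Hom.mk ⟨fun _ => a, fun _ _ _ => le_rfl⟩

lemma comp_cst {Δ Δ' : SimplexCategoryᵒᵖ} (θ : Δ ⟶ Δ') (a : Fin 2) :
    θ.unop ≫ cst Δ a = cst Δ' a := rfl

lemma cst_ne (Δ : SimplexCategoryᵒᵖ) : cst Δ 0 ≠ cst Δ 1 := by
  intro h
  have := congrArg (fun s : CylIndex Δ => s.toOrderHom 0) h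
  exact Fin.zero_ne_one this

/-- The two ends of the cylinder. -/
def cylIncl (a : Fin 2) : P ⟶ cyl P where
  app Δ := cylι P (cst Δ a)
  naturality Δ Δ' θ := by rw [cylι_map, comp_cst]

/-- The projection of the cylinder. -/
def cylProj : cyl P ⟶ P where
  app Δ := cylDesc P fun _ => 𝟙 _
  naturality Δ Δ' θ := cyl_hom_ext _ _ _ fun s => by
    rw [← Category.assoc, ← Category.assoc, cylι_map, cylι_desc, Category.assoc, cylι_desc]
    simp

lemma cylIncl_proj (a : Fin 2) : cylIncl P a ≫ cylProj P = 𝟙 P := by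
  ext Δ
  exact cylι_desc _ _ _

open Classical in
/-- Degreewise retractions onto the two ends. -/
def cylRetr (a : Fin 2) (Δ : SimplexCategoryᵒᵖ) : (cyl P).obj Δ ⟶ P.obj Δ :=
  cylDesc P fun s => if s = cst Δ a then 𝟙 _ else 0

lemma cylIncl_retr_self (a : Fin 2) (Δ : SimplexCategoryᵒᵖ) :
    (cylIncl P a).app Δ ≫ cylRetr P a Δ = 𝟙 _ := by
  classical
  exact (cylι_desc _ _ _).trans (if_pos rfl)

lemma cylIncl_retr_ne (Δ : SimplexCategoryᵒᵖ) :
    (cylIncl P 0).app Δ ≫ cylRetr P 1 Δ = 0 := by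
  classical
  exact (cylι_desc _ _ _).trans (if_neg (cst_ne Δ))

/-- The map `[n+1] ⟶ [1]` with value `0` on `k ≤ j` and `1` beyond. -/
def stp {n : ℕ} (j : Fin (n + 1)) : CylIndex (op ⦋n + 1⦌) :=
  SimplexCategory.Hom.mk ⟨fun k : Fin (n + 2) => if k ≤ j.castSucc then (0 : Fin 2) else 1,
    fun k l (h : (k : Fin (n + 2)) ≤ l) => by
      by_cases h1 : (k : Fin (n + 2)) ≤ j.castSucc
      · simp only [h1, if_true]
        exact Fin.zero_le _
      · have h2 : ¬ (l : Fin (n + 2)) ≤ j.castSucc := fun h2 => h1 (h.trans h2)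
        simp only [h1, h2, if_false, le_refl]⟩

lemma idx_ext {n : ℕ} {s t : CylIndex (op ⦋n⦌)}
    (h : ∀ k : Fin (n + 1), s.toOrderHom k = t.toOrderHom k) : s = t := by
  apply SimplexCategory.Hom.ext
  exact OrderHom.ext _ _ (funext h)

lemma idx_δ_stp {n : ℕ} (i : Fin (n + 3)) (j : Fin (n + 2)) (j' : Fin (n + 1))
    (h : ∀ k : Fin (n + 2), i.succAbove k ≤ j.castSucc ↔ k ≤ j'.castSucc) :
    SimplexCategory.δ i ≫ stp j = stp j' := by
  apply idx_ext
  intro k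
  change (if i.succAbove k ≤ j.castSucc then (0 : Fin 2) else 1) =
    if k ≤ j'.castSucc then (0 : Fin 2) else 1
  simp only [h]

lemma idx_σ_stp {n : ℕ} (i : Fin (n + 2)) (j : Fin (n + 1)) (j' : Fin (n + 2))
    (h : ∀ k : Fin (n + 3), i.predAbove k ≤ j.castSucc ↔ k ≤ j'.castSucc) :
    SimplexCategory.σ i ≫ stp j = stp j' := by
  apply idx_ext
  intro k
  change (if i.predAbove k ≤ j.castSucc then (0 : Fin 2) else 1) =
    if k ≤ j'.castSucc then (0 : Fin 2) else 1
  simp only [h]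

lemma cylι_δ {n : ℕ} (s : CylIndex (op ⦋n + 1⦌)) (i : Fin (n + 2)) :
    cylι P s ≫ (cyl P).δ i = P.δ i ≫ cylι P (Δ := op ⦋n⦌) (SimplexCategory.δ i ≫ s) :=
  cylι_map _ _ _

lemma cylι_σ {n : ℕ} (s : CylIndex (op ⦋n⦌)) (i : Fin (n + 1)) :
    cylι P s ≫ (cyl P).σ i = P.σ i ≫ cylι P (Δ := op ⦋n + 1⦌) (SimplexCategory.σ i ≫ s) :=
  cylι_map _ _ _

/-- The tautological homotopy between the two ends of the cylinder. -/
def cylHomotopy : SimplicialObject.Homotopy (cylIncl P 0) (cylIncl P 1) where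
  h {n} i := P.σ i ≫ cylι P (stp i)
  h_zero_comp_δ_zero n := by
    have h := (SimplicialObject.Homotopy.refl (𝟙 P)).h_zero_comp_δ_zero n
    simp only [SimplicialObject.Homotopy.refl_h, NatTrans.id_app, Category.comp_id] at h
    rw [Category.assoc, cylι_δ, ← Category.assoc, h, Category.id_comp]
    refine congrArg (cylι P) (idx_ext fun k => ?_)
    have hk : ¬ (0 : Fin (n + 2)).succAbove k ≤ (0 : Fin (n + 1)).castSucc := by
      simp [Fin.succAbove]
    exact if_neg (t := (0 : Fin 2)) hk
  h_last_comp_δ_last n := by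
    have h := (SimplicialObject.Homotopy.refl (𝟙 P)).h_last_comp_δ_last n
    simp only [SimplicialObject.Homotopy.refl_h, NatTrans.id_app, Category.comp_id] at h
    rw [Category.assoc, cylι_δ, ← Category.assoc, h, Category.id_comp]
    refine congrArg (cylι P) (idx_ext fun k => ?_)
    have hk : (Fin.last (n + 1)).succAbove k ≤ (Fin.last n).castSucc := by
      simp [Fin.le_last]
    exact if_pos hk
  h_succ_comp_δ_castSucc_of_lt {n} i j hij := by
    have h := (SimplicialObject.Homotopy.refl (𝟙 P)).h_succ_comp_δ_castSucc_of_lt i j hij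
    simp only [SimplicialObject.Homotopy.refl_h, NatTrans.id_app, Category.comp_id] at h
    rw [Category.assoc, cylι_δ, ← Category.assoc, h, Category.assoc,
      idx_δ_stp i.castSucc j.succ j (fun k => by
        simp only [Fin.succAbove, Fin.le_def, Fin.lt_def, Fin.val_castSucc, Fin.val_succ] at hij ⊢
        split_ifs <;> simp <;> omega)]
  h_succ_comp_δ_castSucc_succ {n} j := by
    have h := (SimplicialObject.Homotopy.refl (𝟙 P)).h_succ_comp_δ_castSucc_succ j
    simp only [SimplicialObject.Homotopy.refl_h, NatTrans.id_app, Category.comp_id] at h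
    rw [Category.assoc, cylι_δ, ← Category.assoc, h, Category.assoc, Category.assoc, cylι_δ]
    refine congrArg (fun t => P.σ j.castSucc ≫ P.δ j.castSucc.succ ≫ cylι P t)
      (idx_ext fun k => ?_)
    change (if j.castSucc.succ.succAbove k ≤ j.succ.castSucc then (0 : Fin 2) else 1) =
      if j.castSucc.succ.succAbove k ≤ j.castSucc.castSucc then (0 : Fin 2) else 1
    congr 1
    simp only [Fin.succAbove, Fin.le_def, Fin.lt_def, Fin.val_castSucc, Fin.val_succ]
    split_ifs <;> simp <;> omega
  h_castSucc_comp_δ_succ_of_lt {n} i j hji := by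
    have h := (SimplicialObject.Homotopy.refl (𝟙 P)).h_castSucc_comp_δ_succ_of_lt i j hji
    simp only [SimplicialObject.Homotopy.refl_h, NatTrans.id_app, Category.comp_id] at h
    rw [Category.assoc, cylι_δ, ← Category.assoc, h, Category.assoc,
      idx_δ_stp i.succ j.castSucc j (fun k => by
        simp only [Fin.succAbove, Fin.le_def, Fin.lt_def, Fin.val_castSucc, Fin.val_succ] at hji ⊢
        split_ifs <;> simp <;> omega)]
  h_comp_σ_castSucc_of_le {n} i j hij := by
    have h := (SimplicialObject.Homotopy.refl (𝟙 P)).h_comp_σ_castSucc_of_le i j hij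
    simp only [SimplicialObject.Homotopy.refl_h, NatTrans.id_app, Category.comp_id] at h
    rw [Category.assoc, cylι_σ, ← Category.assoc, h, Category.assoc,
      idx_σ_stp i.castSucc j j.succ (fun k => by
        simp only [Fin.predAbove, Fin.le_def, Fin.lt_def, Fin.val_castSucc, Fin.val_succ] at hij ⊢
        split_ifs <;> simp at * <;> omega)]
  h_comp_σ_succ_of_lt {n} i j hji := by
    have h := (SimplicialObject.Homotopy.refl (𝟙 P)).h_comp_σ_succ_of_lt i j hji
    simp only [SimplicialObject.Homotopy.refl_h, NatTrans.id_app, Category.comp_id] at h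
    rw [Category.assoc, cylι_σ, ← Category.assoc, h, Category.assoc,
      idx_σ_stp i.succ j j.castSucc (fun k => by
        simp only [Fin.predAbove, Fin.le_def, Fin.lt_def, Fin.val_castSucc, Fin.val_succ] at hji ⊢
        split_ifs <;> simp at * <;> omega)]
end

/-! ### The homotopy category of simplicial objects -/

lemma homotopy_extension {K M L : ChainComplex A ℕ} (j₀ j₁ : K ⟶ M) (r : ∀ n, M.X n ⟶ K.X n)
    (h₀ : ∀ n, j₀.f n ≫ r n = 0) (h₁ : ∀ n, j₁.f n ≫ r n = 𝟙 _) {f g : K ⟶ L} (H : Homotopy g f)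
    (φ : M ⟶ L) (hφ₀ : j₀ ≫ φ = f) (hφ₁ : j₁ ≫ φ = f) :
    ∃ ψ : M ⟶ L, j₀ ≫ ψ = f ∧ j₁ ≫ ψ = g := by
  refine ⟨φ + Homotopy.nullHomotopicMap (fun i j => r i ≫ H.hom i j), ?_, ?_⟩
  · rw [Preadditive.comp_add, Homotopy.comp_nullHomotopicMap, hφ₀]
    have : (fun i j => j₀.f i ≫ r i ≫ H.hom i j) = 0 := by
      ext i j
      rw [← Category.assoc, h₀, zero_comp]
      rfl
    rw [this]
    ext n
    simp [Homotopy.nullHomotopicMap]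
  · rw [Preadditive.comp_add, Homotopy.comp_nullHomotopicMap, hφ₁]
    have : (fun i j => j₁.f i ≫ r i ≫ H.hom i j) = H.hom := by
      ext i j
      rw [← Category.assoc, h₁, Category.id_comp]
    rw [this]
    ext n
    have := H.comm n
    simp only [HomologicalComplex.add_f_apply, Homotopy.nullHomotopicMap, this]
    rw [add_comm]

/-- The functor `C` taking a simplicial object to its (unnormalized) chain complex. -/
abbrev alt (A : Type u) [Category.{v} A] [Abelian A] : SimplicialObject A ⥤ ChainComplex A ℕ :=
  AlgebraicTopology.alternatingFaceMapComplex A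

/-- The normalized chain complex. -/
abbrev nrm (A : Type u) [Category.{v} A] [Abelian A] : SimplicialObject A ⥤ ChainComplex A ℕ :=
  AlgebraicTopology.normalizedMooreComplex A

instance : (nrm A).IsEquivalence :=
  inferInstanceAs (Abelian.DoldKan.equivalence (A := A)).functor.IsEquivalence

/-- The inclusion of the normalized complex. -/
def inc (P : SimplicialObject A) : (nrm A).obj P ⟶ (alt A).obj P :=
  (AlgebraicTopology.inclusionOfMooreComplex A).app P

/-- The homotopy inverse of the inclusion of the normalized complex. -/
def ret (P : SimplicialObject A) : (alt A).obj P ⟶ (nrm A).obj P :=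
  AlgebraicTopology.DoldKan.PInftyToNormalizedMooreComplex P

lemma inc_nat {P Q : SimplicialObject A} (f : P ⟶ Q) :
    (nrm A).map f ≫ inc Q = inc P ≫ (alt A).map f :=
  (AlgebraicTopology.inclusionOfMooreComplex A).naturality f

lemma inc_ret (P : SimplicialObject A) : inc P ≫ ret P = 𝟙 _ :=
  (AlgebraicTopology.DoldKan.splitMonoInclusionOfMooreComplexMap P).id

/-- The homotopy showing that `inc` is a homotopy equivalence. -/
def retIncHomotopy (P : SimplicialObject A) : Homotopy (ret P ≫ inc P) (𝟙 _) :=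
  (AlgebraicTopology.DoldKan.homotopyEquivNormalizedMooreComplexAlternatingFaceMapComplex
    (Y := P)).homotopyInvHomId

lemma exists_simplicial_homotopy {P Q : SimplicialObject A} (f g : P ⟶ Q)
    (H : Homotopy ((alt A).map g) ((alt A).map f)) :
    Nonempty (SimplicialObject.Homotopy f g) := by
  have hnrm (u : P ⟶ Q) : inc P ≫ (alt A).map u ≫ ret Q = (nrm A).map u := by
    rw [← Category.assoc, ← inc_nat, Category.assoc, inc_ret, Category.comp_id]
  let H' : Homotopy ((nrm A).map g) ((nrm A).map f) :=
    (Homotopy.ofEq (hnrm g).symm).trans (((H.compRight (ret Q)).compLeft (inc P)).trans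
      (Homotopy.ofEq (hnrm f)))
  have hincl (a : Fin 2) (n : ℕ) : ((nrm A).map (cylIncl P a)).f n ≫ (inc (cyl P)).f n =
      (inc P).f n ≫ (cylIncl P a).app (op ⦋n⦌) := by
    have := congrArg (fun k => k.f n) (inc_nat (cylIncl P a))
    exact this
  have hir (n : ℕ) : (inc P).f n ≫ (ret P).f n = 𝟙 _ := by
    have := congrArg (fun k => k.f n) (inc_ret P)
    exact this
  obtain ⟨ψ, h₀, h₁⟩ := homotopy_extension ((nrm A).map (cylIncl P 0)) ((nrm A).map (cylIncl P 1))
    (fun n => (inc (cyl P)).f n ≫ cylRetr P 1 (op ⦋n⦌) ≫ (ret P).f n)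
    (fun n => by
      rw [← Category.assoc, hincl, Category.assoc]
      rw [← Category.assoc ((cylIncl P 0).app _), cylIncl_retr_ne, zero_comp]
      exact comp_zero)
    (fun n => by
      rw [← Category.assoc, hincl, Category.assoc]
      rw [← Category.assoc ((cylIncl P 1).app _), cylIncl_retr_self, Category.id_comp]
      exact hir n)
    H' ((nrm A).map (cylProj P ≫ f))
    (by rw [← Functor.map_comp, ← Category.assoc, cylIncl_proj, Category.id_comp])
    (by rw [← Functor.map_comp, ← Category.assoc, cylIncl_proj, Category.id_comp])
  obtain ⟨Ψ, rfl⟩ := (nrm A).map_surjective ψ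
  rw [← Functor.map_comp] at h₀ h₁
  have h₀ := (nrm A).map_injective h₀
  have h₁ := (nrm A).map_injective h₁
  rw [← h₀, ← h₁]
  exact ⟨(cylHomotopy P).postcomp Ψ⟩

/-- Two maps of simplicial objects are related if there is a simplicial homotopy between them. -/
def simplicialHomotopic (C : Type u) [Category.{v} C] : HomRel (SimplicialObject C) :=
  fun _ _ f g => Nonempty (SimplicialObject.Homotopy f g)

/-- The homotopy category of simplicial objects: its morphisms are the classes for the
equivalence relation generated by simplicial homotopy. -/
abbrev HoSimp (C : Type u) [Category.{v} C] := CategoryTheory.Quotient (simplicialHomotopic C)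

/-- The functor `C : HoSimp(A) ⥤ K_{≥0}(A)`. -/
def HoSimp.chain (A : Type u) [Category.{v} A] [Abelian A] : HoSimp A ⥤ KNonneg A :=
  CategoryTheory.Quotient.lift _ (alt A ⋙ HomotopyCategory.quotient A _)
    (fun _ _ _ _ ⟨H⟩ => HomotopyCategory.eq_of_homotopy _ _ H.toChainHomotopy)

/-- The functor induced on homotopy categories by an arbitrary functor `F`. -/
def HoSimp.map {C : Type u} [Category.{v} C] {D : Type u'} [Category.{v'} D] (F : C ⥤ D) :
    HoSimp C ⥤ HoSimp D :=
  CategoryTheory.Quotient.lift _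
    ((SimplicialObject.whiskering C D).obj F ⋙ CategoryTheory.Quotient.functor _)
    (fun _ _ _ _ ⟨H⟩ => CategoryTheory.Quotient.sound _ ⟨H.whiskerRight F⟩)

instance : (HoSimp.chain A).Faithful where
  map_injective {P Q} f g h := by
    obtain ⟨f, rfl⟩ := (CategoryTheory.Quotient.functor _).map_surjective f
    obtain ⟨g, rfl⟩ := (CategoryTheory.Quotient.functor _).map_surjective g
    exact CategoryTheory.Quotient.sound _
      (exists_simplicial_homotopy f g (HomotopyCategory.homotopyOfEq _ _ h.symm))

instance : (HoSimp.chain A).Full where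
  map_surjective {P Q} u := by
    obtain ⟨u, rfl⟩ := (HomotopyCategory.quotient _ _).map_surjective u
    obtain ⟨g, hg⟩ := (nrm A).map_surjective (inc P.as ≫ u ≫ ret Q.as)
    refine ⟨(CategoryTheory.Quotient.functor _).map g, ?_⟩
    refine HomotopyCategory.eq_of_homotopy _ _ ?_
    have e : (ret P.as ≫ inc P.as) ≫ u ≫ ret Q.as ≫ inc Q.as =
        (ret P.as ≫ inc P.as) ≫ (alt A).map g := by
      rw [Category.assoc (ret P.as) (inc P.as) ((alt A).map g), ← inc_nat, hg]
      simp only [Category.assoc]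
    have h1 : Homotopy ((ret P.as ≫ inc P.as) ≫ (alt A).map g) ((alt A).map g) :=
      ((retIncHomotopy P.as).compRight _).trans (Homotopy.ofEq (Category.id_comp _))
    have h2 : Homotopy ((ret P.as ≫ inc P.as) ≫ u ≫ ret Q.as ≫ inc Q.as) u :=
      ((retIncHomotopy P.as).comp ((retIncHomotopy Q.as).compLeft u)).trans
        (Homotopy.ofEq (by simp))
    exact h1.symm.trans ((Homotopy.ofEq e.symm).trans h2)

attribute [local instance] HasDerivedCategory.standard in
open HomologicalComplex DerivedCategory in
lemma lift_bijective {P X Y : ChainComplex A ℕ} (hP : ∀ n, Projective (P.X n)) (s : X ⟶ Y)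
    [QuasiIso s] : Function.Bijective
      (fun u : (HomotopyCategory.quotient A (ComplexShape.down ℕ)).obj P ⟶
        (HomotopyCategory.quotient A _).obj X => u ≫ (HomotopyCategory.quotient A _).map s) := by
  let e := ComplexShape.embeddingDownNat
  let E := e.extendHomotopyFunctor A
  let q := HomotopyCategory.quotient A (ComplexShape.down ℕ)
  let G (T : ChainComplex A ℕ) (u : q.obj P ⟶ q.obj T) := Qh.map (E.map u)
  have hG (T : ChainComplex A ℕ) : Function.Bijective (G T) :=
    (CochainComplex.IsKProjective.Qh_map_bijective (P.extend e) (E.obj (q.obj T))).comp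
      ⟨E.map_injective, E.map_surjective⟩
  have hs : IsIso (Qh.map (E.map (q.map s))) := by
    have : IsIso (Q.map (extendMap s e)) := inferInstance
    exact this
  have hG' : Function.Bijective (fun u : q.obj P ⟶ q.obj X => G Y (u ≫ q.map s)) := by
    have : (fun u : q.obj P ⟶ q.obj X => G Y (u ≫ q.map s)) =
        (fun w => w ≫ Qh.map (E.map (q.map s))) ∘ G X := by
      funext u
      simp [G]
    rw [this]
    exact Function.Bijective.comp ⟨fun a b h => (cancel_mono _).1 h,
      fun w => ⟨w ≫ inv (Qh.map (E.map (q.map s))), by simp⟩⟩ (hG X)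
  exact (Function.Bijective.of_comp_iff' (hG Y) _).1 hG'

/-! ### The total derived functor -/

lemma projective_coproduct {C : Type*} [Category* C] {ι : Type*} (X : ι → C) [HasCoproduct X] (h : ∀ i, Projective (X i)) :
    Projective (∐ X) where
  factors f e _ := by
    have := h
    exact ⟨Limits.Sigma.desc fun i => Projective.factorThru (Limits.Sigma.ι X i ≫ f) e,
      Limits.Sigma.hom_ext _ _ fun i => by simp⟩

/-- A simplicial projective resolution of a chain complex `X`: a simplicial object `P` with
projective terms, and a quasi-isomorphism `α : C(P) ⟶ X`. -/
structure SimplicialResolution (X : ChainComplex A ℕ) where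
  P : SimplicialObject A
  projective (n : ℕ) : Projective (P.obj (op ⦋n⦌))
  α : (alt A).obj P ⟶ X
  quasiIso : QuasiIso α

variable [EnoughProjectives A]

lemma exists_simplicialResolution (X : ChainComplex A ℕ) : Nonempty (SimplicialResolution X) := by
  obtain ⟨K, f, hK, hf⟩ := exists_projective_resolution X
  let e := Abelian.DoldKan.equivalence (A := A)
  let P : SimplicialObject A := e.inverse.obj K
  have hP (n : ℕ) : Projective (P.obj (op ⦋n⦌)) :=
    projective_coproduct _ fun _ => hK _
  let c : (nrm A).obj P ⟶ K := e.counit.app K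
  have hc : IsIso c := inferInstanceAs (IsIso (e.counit.app K))
  have hr : QuasiIso (ret P) :=
    (AlgebraicTopology.DoldKan.homotopyEquivNormalizedMooreComplexAlternatingFaceMapComplex
      (Y := P)).symm.quasiIso_hom
  exact ⟨⟨P, hP, ret P ≫ c ≫ f, inferInstance⟩⟩

/-- A chosen simplicial projective resolution. -/
def simplicialResolution (X : ChainComplex A ℕ) : SimplicialResolution X :=
  (exists_simplicialResolution X).some

/-- The chosen resolution of `X`, as an object of the homotopy category. -/
def resObj (X : KNonneg A) : HoSimp A :=
  (CategoryTheory.Quotient.functor _).obj (simplicialResolution X.as).P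

/-- The augmentation `C(P) ⟶ X` of the chosen resolution. -/
def resAug (X : KNonneg A) : (HoSimp.chain A).obj (resObj X) ⟶ X :=
  (HomotopyCategory.quotient A _).map (simplicialResolution X.as).α

lemma existsUnique_lift {X Y : KNonneg A} (φ : X ⟶ Y) :
    ∃! g : resObj X ⟶ resObj Y, (HoSimp.chain A).map g ≫ resAug Y = resAug X ≫ φ := by
  have := (simplicialResolution Y.as).quasiIso
  have hb := lift_bijective (P := (alt A).obj (simplicialResolution X.as).P)
    (simplicialResolution X.as).projective (simplicialResolution Y.as).α
  obtain ⟨u, hu⟩ := hb.2 (resAug X ≫ φ)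
  obtain ⟨g, rfl⟩ := (HoSimp.chain A).map_surjective (X := resObj X) (Y := resObj Y) u
  exact ⟨g, hu, fun g' hg' => (HoSimp.chain A).map_injective (hb.1 (hg'.trans hu.symm))⟩

/-- The simplicial projective resolution functor `ρ : K_{≥0}(A) ⥤ HoSimp(A)`, with values in
simplicial objects with projective terms. On morphisms it is characterized by its compatibility
with the augmentations. -/
def resolutionFunctor (A : Type u) [Category.{v} A] [Abelian A] [EnoughProjectives A] :
    KNonneg A ⥤ HoSimp A where
  obj := resObj
  map φ := (existsUnique_lift φ).choose
  map_id X := ((existsUnique_lift (𝟙 X)).choose_spec.2 _ (by simp)).symm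
  map_comp {X Y Z} φ ψ := by
    refine ((existsUnique_lift (φ ≫ ψ)).choose_spec.2 _ ?_).symm
    have h₁ := (existsUnique_lift φ).choose_spec.1
    have h₂ := (existsUnique_lift ψ).choose_spec.1
    dsimp only at h₁ h₂ ⊢
    rw [Functor.map_comp, Category.assoc, h₂, ← Category.assoc, h₁, Category.assoc]

/-- The total derived functor `LF = C ∘ F ∘ ρ : K_{≥0}(A) ⥤ K_{≥0}(B)` of Dold and Puppe. -/
def totalDerived {B : Type u'} [Category.{v'} B] [Abelian B] (F : A ⥤ B) :
    KNonneg A ⥤ KNonneg B :=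
  resolutionFunctor A ⋙ HoSimp.map F ⋙ HoSimp.chain B

end DerivedFunctor

end DoldPuppe

end

/-! Write Φ(X) = χ(LF(X)). This is not additive on short exact sequences, but it takes the same
value on an extension and on the direct sum of its ends (`derivedEuler_shortExact`). The rest is
formal.

To see this, resolve the extension by a short exact sequence 0 → P → Q → R → 0 of simplicial objects
with projective terms; it splits in each simplicial degree, though not simplicially. A map f : P → Q
has a bar construction with terms Q ⊕ Pⁿ. Where f is a split monomorphism, the bar construction
augmented to the cokernel has an extra degeneracy, which survives any functor; hence F(bar f)
resolves F(coker f). Only the face d₀ depends on f, and the terms of the normalized complex are cut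
out by the other faces, so the terms of the normalized complex of F(bar f) do not depend on f.
Because F has degree ≤ d, they vanish above degree d (`isZero_normalized_mapBar`). The Euler
characteristic of F(coker f) is then a finite alternating sum determined by P and Q alone
(`val_map_cokernel_congr`). Two embeddings P → P ⊕ Q, with cokernels Q and P ⊕ R, give the claim
(`val_map_shortExact`).

Next, call two complexes stably equivalent if Φ does not separate them after adding any third
complex. Stable classes form a commutative monoid in which extensions become sums. An acyclic
complex a → a shows that a in degree n and a in degree n + 1 are inverse to each other, so K₀(A₀)
maps to the units of the monoid. Truncation shows that the class of X is the image of χ(X). Thus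
Φ(X) depends only on χ(X) (`eq_of_euler_eq`), and since χ is surjective, f exists and is unique.

For the degree of f, vanishing of the cross effect bounds the degree of F on morphism groups. The
function f(x + y) - f(x) - f(y), for fixed y, is induced by a second cross effect of the functor,
whose degree is one less; in degree 1 the functor is additive, and so is f
(`mapDegreeLE_of_functor`). -/

noncomputable section

open ZeroObject Simplicial AlgebraicTopology

namespace DoldPuppe

attribute [local instance] Abelian.hasFiniteBiproducts

/-! ### Maps of finite degree and their deviations. -/

section MapDegree

variable {G H G' H' : Type*} [AddCommGroup G] [AddCommGroup H] [AddCommGroup G'] [AddCommGroup H']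

lemma MapDegreeLE.comp_addMonoidHom {d : ℕ} {f : G → H} (hf : MapDegreeLE d f) (u : G' →+ G) :
    MapDegreeLE d (fun x => f (u x)) := by
  induction d using Nat.twoStepInduction generalizing f with
  | zero => exact fun x => hf (u x)
  | one => exact fun x y => by simpa using hf (u x) (u y)
  | more d _ ih =>
    refine ⟨fun y => ?_, fun x => ?_⟩
    · simpa using ih (hf.1 (u y))
    · simpa using ih (hf.2 (u x))

lemma MapDegreeLE.addMonoidHom_comp {d : ℕ} {f : G → H} (hf : MapDegreeLE d f) (u : H →+ H') :
    MapDegreeLE d (fun x => u (f x)) := by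
  induction d using Nat.twoStepInduction generalizing f with
  | zero => exact fun x => by simp [hf x]
  | one => exact fun x y => by rw [← map_add]; exact congrArg u (hf _ _)
  | more d _ ih =>
    refine ⟨fun y => ?_, fun x => ?_⟩
    · simpa using ih (hf.1 y)
    · simpa using ih (hf.2 x)

lemma MapDegreeLE.of_injective {d : ℕ} {f : G → H} (u : H →+ H') (hu : Function.Injective u)
    (hf : MapDegreeLE d (fun x => u (f x))) : MapDegreeLE d f := by
  induction d using Nat.twoStepInduction generalizing f with
  | zero => exact fun x => hu (by simpa using hf x)
  | one => exact fun x y => hu (by simpa using hf x y)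
  | more d _ ih =>
    exact ⟨fun y => ih (by simpa using hf.1 y), fun x => ih (by simpa using hf.2 x)⟩

/-- The `n`-th deviation of `f` at `a₁, …, aₙ`. -/
def deviation (f : G → H) {n : ℕ} (a : Fin n → G) : H :=
  ∑ S : Finset (Fin n), (-1 : ℤ) ^ (n - S.card) • f (∑ i ∈ S, a i)

lemma sum_finset_fin_succ {n : ℕ} (g : Finset (Fin (n + 1)) → H) :
    ∑ S, g S = ∑ S : Finset (Fin n), g (S.map (Fin.succEmb n)) +
      ∑ S : Finset (Fin n), g (insert 0 (S.map (Fin.succEmb n))) := by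
  classical
  have h0 : (0 : Fin (n + 1)) ∉ Finset.univ.map (Fin.succEmb n) := by simp
  have hu : (Finset.univ : Finset (Fin (n + 1))) = insert 0 (Finset.univ.map (Fin.succEmb n)) := by
    ext x; refine Fin.cases ?_ (fun i => ?_) x <;> simp
  have hp (g : Finset (Fin (n + 1)) → H) :
      ∑ S ∈ (Finset.univ.map (Fin.succEmb n)).powerset, g S =
        ∑ S : Finset (Fin n), g (S.map (Fin.succEmb n)) := by
    symm
    refine Finset.sum_bij (fun S _ => S.map (Fin.succEmb n)) (fun S _ => ?_) (fun S _ T _ h => ?_)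
      (fun T hT => ?_) (fun _ _ => rfl)
    · simp [Finset.map_subset_map]
    · exact Finset.map_injective _ h
    · obtain ⟨S, -, rfl⟩ := Finset.subset_map_iff.1 (Finset.mem_powerset.1 hT)
      exact ⟨S, by simp, rfl⟩
  rw [← Finset.powerset_univ, hu, Finset.sum_powerset_insert h0, hp, hp]

lemma sum_neg_one_pow_card (n : ℕ) :
    ∑ S : Finset (Fin (n + 1)), (-1 : ℤ) ^ (n + 1 - S.card) = 0 := by
  rw [sum_finset_fin_succ, ← Finset.sum_add_distrib]
  refine Finset.sum_eq_zero fun S _ => ?_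
  have hS : S.card ≤ n := by simpa using S.card_le_univ
  rw [Finset.card_insert_of_notMem (by simp), Finset.card_map,
    show n + 1 - S.card = (n + 1 - (S.card + 1)) + 1 by omega, pow_succ]
  ring

/-- Split the subsets on the right according to whether they contain 0: these give the terms with
and without `y`. The extra terms `f y` on the left cancel because signed subsets of a nonempty set
sum to zero; this is why `a` has `n + 1` entries. -/
lemma deviation_crossDiff (f : G → H) {n : ℕ} (y : G) (a : Fin (n + 1) → G) :
    deviation (fun x => f (x + y) - f x - f y) a =
      deviation f (Fin.cons y a : Fin (n + 1 + 1) → G) := by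
  have h : ∑ S : Finset (Fin (n + 1)), (-1 : ℤ) ^ (n + 1 - S.card) • f y = 0 := by
    rw [← Finset.sum_smul, sum_neg_one_pow_card, zero_smul]
  simp only [deviation, smul_sub, Finset.sum_sub_distrib]
  rw [h, sub_zero, sum_finset_fin_succ (n := n + 1), sub_eq_add_neg, ← Finset.sum_neg_distrib,
    add_comm]
  congr 1
  · refine Finset.sum_congr rfl fun S _ => ?_
    have hS : S.card ≤ n + 1 := by simpa using S.card_le_univ
    rw [Finset.card_map, Finset.sum_map, Nat.succ_sub hS, pow_succ]
    simp
  · refine Finset.sum_congr rfl fun S _ => ?_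
    rw [Finset.card_insert_of_notMem (by simp), Finset.sum_insert (by simp), Finset.card_map,
      Finset.sum_map, Nat.add_sub_add_right]
    simp [add_comm]

/-- Passing to f(x + y) - f(x) - f(y) uses up one argument of the deviation. The hypothesis `f 0 =
0` removes the term of the empty subset, which distinguishes a vanishing second deviation from
additivity. -/
lemma mapDegreeLE_of_deviation {d : ℕ} {f : G → H} (h0 : f 0 = 0)
    (hf : ∀ a : Fin (d + 2) → G, deviation f a = 0) : MapDegreeLE (d + 1) f := by
  induction d generalizing f with
  | zero =>
    intro x y
    have h := hf (Fin.cons y fun _ => x)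
    rw [← deviation_crossDiff] at h
    simp only [deviation, sum_finset_fin_succ, Finset.univ_unique,
      show (default : Finset (Fin 0)) = ∅ from Subsingleton.elim _ _] at h
    simpa [h0, sub_eq_zero, sub_sub] using h
  | succ d ih =>
    refine ⟨fun y => ih (by simp [h0]) fun a => ?_, fun x => ih (by simp [h0]) fun a => ?_⟩
    · rw [deviation_crossDiff, hf]
    · have : (fun y => f (x + y) - f x - f y) = fun y => f (y + x) - f y - f x := by
        funext y; rw [add_comm x, sub_right_comm]
      rw [this, deviation_crossDiff, hf]

end MapDegree

/-! ### Functors of finite degree, on morphism groups. -/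

section FunctorDegree

variable {A : Type u} [Category.{v} A] [Abelian A] {B : Type u'} [Category.{v'} B] [Abelian B]

/-- The sum of the `a i` over `S` is the diagonal of `Y`, followed by the idempotent of `S`,
followed by the map with components `a i`. Composing the zero map `crossMap` with F of the two outer
maps therefore gives the deviation. -/
lemma FunctorDegreeLE.deviation_map {F : A ⥤ B} {d : ℕ} (hF : FunctorDegreeLE F d) {Y Z : A}
    (a : Fin (d + 1) → (Y ⟶ Z)) : deviation (F.map : (Y ⟶ Z) → _) a = 0 := by
  have h : crossMap F (fun _ : Fin (d + 1) => Y) = 0 := by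
    rw [← image.fac (crossMap F _), IsZero.eq_of_tgt (hF _) (factorThruImage _) 0]
    exact zero_comp
  have h' := congrArg (fun u => F.map (biproduct.lift fun _ => 𝟙 Y) ≫ u ≫
    F.map (biproduct.desc a)) h
  simp only [crossMap, zero_comp, comp_zero, Preadditive.sum_comp, Preadditive.comp_sum,
    Preadditive.zsmul_comp, Preadditive.comp_zsmul, ← F.map_comp] at h'
  rw [← h', deviation]
  refine Finset.sum_congr rfl fun S _ => ?_
  congr 2
  simp [partialId, Preadditive.sum_comp, Preadditive.comp_sum]

lemma map_zero_of_isZero {F : A ⥤ B} (hF : ∀ Z : A, IsZero Z → IsZero (F.obj Z)) (X Y : A) :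
    F.map (0 : X ⟶ Y) = 0 := by
  have h : (0 : X ⟶ Y) = (0 : X ⟶ ⨁ fun i : Fin 0 => nomatch i) ≫ 0 := by simp
  have hZ : IsZero (⨁ fun i : Fin 0 => (nomatch i : A)) :=
    (IsZero.iff_id_eq_zero _).2 (biproduct.hom_ext _ _ fun i => nomatch i)
  rw [h, F.map_comp, (hF _ hZ).eq_of_tgt (F.map _) 0, zero_comp]

end FunctorDegree

/-! ### Closure properties of weak Serre subcategories, and classes in K₀. -/

section WeakSerre

variable {A : Type u} [Category.{v} A] [Abelian A] {P : ObjectProperty A}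

namespace IsWeakSerre

variable (hP : IsWeakSerre P)
include hP

lemma prop_of_five {X₀ X₁ X₂ X₃ X₄ : A} (f : X₀ ⟶ X₁) (g : X₁ ⟶ X₂) (h : X₂ ⟶ X₃) (i : X₃ ⟶ X₄)
    (fg : f ≫ g = 0) (gh : g ≫ h = 0) (hi : h ≫ i = 0)
    (e₁ : (ShortComplex.mk f g fg).Exact) (e₂ : (ShortComplex.mk g h gh).Exact)
    (e₃ : (ShortComplex.mk h i hi).Exact) (h₀ : P X₀) (h₁ : P X₁) (h₃ : P X₃) (h₄ : P X₄) :
    P X₂ :=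
  hP.prop_of_exact (ComposableArrows.mk₄ f g h i)
    (ComposableArrows.exact_of_δ₀ e₁.exact_toComposableArrows
      (ComposableArrows.exact_of_δ₀ e₂.exact_toComposableArrows e₃.exact_toComposableArrows))
    h₀ h₁ h₃ h₄

lemma of_isZero {Z : A} (hZ : IsZero Z) : P Z := by
  obtain ⟨X, hX⟩ := hP.nonempty
  refine hP.prop_of_five (𝟙 X) (0 : X ⟶ Z) (0 : Z ⟶ X) (𝟙 X) comp_zero comp_zero zero_comp
    ?_ ?_ ?_ hX hX hX hX
  · exact (ShortComplex.exact_iff_epi _ rfl).2 (inferInstanceAs (Epi (𝟙 X)))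
  · exact ShortComplex.exact_of_isZero_X₂ _ hZ
  · exact (ShortComplex.exact_iff_mono _ rfl).2 (inferInstanceAs (Mono (𝟙 X)))

lemma kernel {X Y : A} (f : X ⟶ Y) (hX : P X) (hY : P Y) : P (kernel f) := by
  have hz := isZero_zero A
  refine hP.prop_of_five (0 : (0 : A) ⟶ (0 : A)) 0 (kernel.ι f) f comp_zero zero_comp
    (kernel.condition f) ?_ ?_ ?_ (hP.of_isZero hz) (hP.of_isZero hz) hX hY
  · exact ShortComplex.exact_of_isZero_X₂ _ hz
  · exact (ShortComplex.exact_iff_mono _ rfl).2 (inferInstanceAs (Mono (kernel.ι f)))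
  · exact ShortComplex.exact_kernel f

lemma cokernel {X Y : A} (f : X ⟶ Y) (hX : P X) (hY : P Y) : P (cokernel f) := by
  have hz := isZero_zero A
  refine hP.prop_of_five f (cokernel.π f) (0 : _ ⟶ (0 : A)) (0 : _ ⟶ (0 : A))
    (cokernel.condition f) comp_zero comp_zero ?_ ?_ ?_ hX hY (hP.of_isZero hz) (hP.of_isZero hz)
  · exact ShortComplex.exact_cokernel f
  · exact (ShortComplex.exact_iff_epi _ rfl).2 (inferInstanceAs (Epi (cokernel.π f)))
  · exact ShortComplex.exact_of_isZero_X₂ _ hz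

lemma of_iso {X Y : A} (e : X ≅ Y) (hX : P X) : P Y := by
  have hz := isZero_zero A
  refine hP.prop_of_five (0 : (0 : A) ⟶ X) e.hom (0 : _ ⟶ (0 : A)) (0 : _ ⟶ (0 : A))
    zero_comp comp_zero comp_zero ?_ ?_ ?_ (hP.of_isZero hz) hX (hP.of_isZero hz)
    (hP.of_isZero hz)
  · exact (ShortComplex.exact_iff_mono _ rfl).2 (inferInstanceAs (Mono e.hom))
  · exact (ShortComplex.exact_iff_epi _ rfl).2 (inferInstanceAs (Epi e.hom))
  · exact ShortComplex.exact_of_isZero_X₂ _ hz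

lemma image {X Y : A} (f : X ⟶ Y) (hX : P X) (hY : P Y) : P (image f) :=
  hP.of_iso (Abelian.imageIsoImage f) (hP.kernel _ hY (hP.cokernel f hX hY))

end IsWeakSerre

variable (P) in
open Classical in
/-- The class of an object in `K₀`, with value `0` outside of the subcategory. -/
def cls (X : A) : K0 P := if h : P X then K0.of P X h else 0

lemma cls_eq {X : A} (h : P X) : cls P X = K0.of P X h := dif_pos h

lemma cls_of_isZero {X : A} (h : IsZero X) : cls P X = 0 := by
  by_cases hX : P X
  · rw [cls_eq hX, K0.of_eq_zero P X hX h]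
  · exact dif_neg hX

lemma cls_shortExact {S : ShortComplex A} (hS : S.ShortExact) (h₁ : P S.X₁) (h₂ : P S.X₂)
    (h₃ : P S.X₃) : cls P S.X₂ = cls P S.X₁ + cls P S.X₃ := by
  rw [cls_eq h₁, cls_eq h₂, cls_eq h₃, ← sub_eq_iff_eq_add', ← sub_eq_zero]
  exact (QuotientAddGroup.eq_zero_iff _).2
    (AddSubgroup.subset_closure ⟨S, hS, h₁, h₂, h₃, rfl⟩)

variable (hP : IsWeakSerre P)
include hP

lemma cls_iso {X Y : A} (e : X ≅ Y) : cls P X = cls P Y := by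
  by_cases hX : P X
  · have hY := hP.of_iso e hX
    have hz := isZero_zero A
    have hS : (ShortComplex.mk e.hom (0 : Y ⟶ (0 : A)) comp_zero).ShortExact :=
      { exact := (ShortComplex.exact_iff_epi _ rfl).2 (inferInstanceAs (Epi e.hom))
        mono_f := inferInstanceAs (Mono e.hom)
        epi_g := ⟨fun _ _ _ => hz.eq_of_src _ _⟩ }
    have := cls_shortExact hS hX hY (hP.of_isZero hz)
    rw [cls_of_isZero hz, add_zero] at this
    exact this.symm
  · have hY : ¬ P Y := fun hY => hX (hP.of_iso e.symm hY)
    rw [cls, cls, dif_neg hX, dif_neg hY]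

lemma cls_kernel_image {X Y : A} (f : X ⟶ Y) (hX : P X) (hY : P Y) :
    cls P X = cls P (kernel f) + cls P (image f) := by
  have w : kernel.ι f ≫ factorThruImage f = 0 := by
    rw [← cancel_mono (image.ι f)]; simp
  have hS : (ShortComplex.mk (kernel.ι f) (factorThruImage f) w).ShortExact :=
    { exact := by
        refine ShortComplex.exact_of_f_is_kernel _ (KernelFork.IsLimit.ofι _ _
          (fun g hg => kernel.lift f g ?_) (fun g hg => kernel.lift_ι _ _ _)
          (fun g hg m hm => ?_))
        · dsimp at hg
          rw [← image.fac f, reassoc_of% hg, zero_comp]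
        · rw [← cancel_mono (kernel.ι f), kernel.lift_ι]; exact hm
      mono_f := inferInstanceAs (Mono (kernel.ι f))
      epi_g := inferInstanceAs (Epi (factorThruImage f)) }
  exact cls_shortExact hS (hP.kernel f hX hY) hX (hP.image f hX hY)

lemma cls_kernel_of_exact {X Y Z : A} (f : X ⟶ Y) (g : Y ⟶ Z) (w : f ≫ g = 0)
    (h : (ShortComplex.mk f g w).Exact) : cls P (kernel g) = cls P (image f) := by
  have he : Epi (kernel.lift g f w) := h.epi_kernelLift
  have e : MonoFactorisation f := ⟨_, kernel.ι g, kernel.lift g f w, kernel.lift_ι _ _ _⟩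
  let e' : StrongEpiMonoFactorisation f :=
    { I := kernel g, m := kernel.ι g, e := kernel.lift g f w, fac := kernel.lift_ι _ _ _,
      e_strong_epi := strongEpi_of_epi _ }
  exact cls_iso hP (IsImage.isoExt e'.toMonoIsImage (Image.isImage f))

end WeakSerre

/-! ### Additivity of the Euler characteristic of complexes. -/

section EulerCharacteristic

variable {A : Type u} [Category.{v} A] [Abelian A] (P : ObjectProperty A)

/-- Chain complexes whose homology satisfies `P` and vanishes in large degrees. -/
def BddHomology (K : ChainComplex A ℕ) : Prop :=
  (∃ N : ℕ, ∀ i, N ≤ i → IsZero (K.homology i)) ∧ ∀ i, P (K.homology i)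

/-- The Euler characteristic of a chain complex. -/
def euler (K : ChainComplex A ℕ) : K0 P := ∑ᶠ i : ℕ, (-1 : ℤ) ^ i • cls P (K.homology i)

variable {P}

/-- Homology in the homotopy category is the homology of the underlying complex. -/
def homologyObjIso (X : KNonneg A) (i : ℕ) : homologyObj X i ≅ X.as.homology i :=
  (HomotopyCategory.homologyFunctorFactors A (ComplexShape.down ℕ) i).app X.as

lemma boundedHomologyIn_iff (hP : IsWeakSerre P) (X : KNonneg A) :
    BoundedHomologyIn P X ↔ BddHomology P X.as :=
  and_congr (exists_congr fun _ => forall_congr' fun i => imp_congr_right fun _ =>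
      (homologyObjIso X i).isZero_iff)
    (forall_congr' fun i => ⟨hP.of_iso (homologyObjIso X i), hP.of_iso (homologyObjIso X i).symm⟩)

lemma eulerChar_eq (hP : IsWeakSerre P) (X : KNonneg A) (hX : BoundedHomologyIn P X) :
    eulerChar P X hX = euler P X.as :=
  finsum_congr fun i => by rw [← cls_eq (hX.2 i), cls_iso hP (homologyObjIso X i)]

lemma euler_eq_sum (K : ChainComplex A ℕ) (N : ℕ) (hN : ∀ i, N ≤ i → IsZero (K.homology i)) :
    euler P K = ∑ i ∈ Finset.range N, (-1 : ℤ) ^ i • cls P (K.homology i) := by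
  refine finsum_eq_sum_of_support_subset _ fun i hi => ?_
  by_contra h
  refine hi ?_
  dsimp only
  rw [cls_of_isZero (hN i (by simpa using h)), smul_zero]

variable {S : ShortComplex (ChainComplex A ℕ)} (hS : S.ShortExact)
include hS

/-- Every chain of degree 0 is a cycle, so surjectivity on chains passes to cycles and to H₀. This
is the right end of the long exact sequence, which the general statements about consecutive degrees
do not cover. -/
lemma epi_homologyMap_zero : Epi (HomologicalComplex.homologyMap S.g 0) := by
  have := hS.epi_g
  have : Epi (HomologicalComplex.cyclesMap S.g 0) := by
    have hd : S.X₂.d 0 ((ComplexShape.down ℕ).next 0) = 0 := S.X₂.shape _ _ (by simp)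
    have hd' : S.X₃.d 0 ((ComplexShape.down ℕ).next 0) = 0 := S.X₃.shape _ _ (by simp)
    have h2 : IsIso (S.X₂.iCycles 0) := S.X₂.isIso_iCycles 0 _ rfl hd
    have h3 : IsIso (S.X₃.iCycles 0) := S.X₃.isIso_iCycles 0 _ rfl hd'
    have e : HomologicalComplex.cyclesMap S.g 0 =
        S.X₂.iCycles 0 ≫ S.g.f 0 ≫ inv (S.X₃.iCycles 0) := by
      rw [← cancel_mono (S.X₃.iCycles 0)]; simp
    rw [e]
    infer_instance
  have h : Epi (HomologicalComplex.cyclesMap S.g 0 ≫ S.X₃.homologyπ 0) := inferInstance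
  rw [← HomologicalComplex.homologyπ_naturality] at h
  exact epi_of_epi (S.X₂.homologyπ 0) _

lemma isZero_homology_X₂ (i : ℕ) (h₁ : IsZero (S.X₁.homology i)) (h₃ : IsZero (S.X₃.homology i)) :
    IsZero (S.X₂.homology i) :=
  (hS.homology_exact₂ i).isZero_of_both_zeros (h₁.eq_of_src _ _) (h₃.eq_of_tgt _ _)

lemma isZero_homology_X₁ (i : ℕ) (h₂ : IsZero (S.X₂.homology i))
    (h₃ : IsZero (S.X₃.homology (i + 1))) : IsZero (S.X₁.homology i) :=
  (hS.homology_exact₁ (i + 1) i rfl).isZero_of_both_zeros (h₃.eq_of_src _ _) (h₂.eq_of_tgt _ _)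

lemma isZero_homology_X₃_succ (i : ℕ) (h₁ : IsZero (S.X₁.homology i))
    (h₂ : IsZero (S.X₂.homology (i + 1))) : IsZero (S.X₃.homology (i + 1)) :=
  (hS.homology_exact₃ (i + 1) i rfl).isZero_of_both_zeros (h₂.eq_of_src _ _) (h₁.eq_of_tgt _ _)

variable (hP : IsWeakSerre P)
include hP

/-- For this and the next two lemmas: each homology object is the middle of five consecutive terms
of the long exact sequence, so the weak Serre condition applies directly. Where the sequence ends in
degree 0, it is prolonged by zero objects. -/
lemma BddHomology.of_shortExact₁ (h₂ : BddHomology P S.X₂) (h₃ : BddHomology P S.X₃) :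
    BddHomology P S.X₁ := by
  obtain ⟨⟨N, hN⟩, h₂⟩ := h₂
  obtain ⟨⟨N', hN'⟩, h₃⟩ := h₃
  exact ⟨⟨N + N', fun i hi => isZero_homology_X₁ hS i (hN _ (by omega)) (hN' _ (by omega))⟩,
    fun i => hP.prop_of_five _ _ _ _ _ _ _ (hS.homology_exact₃ (i + 1) i rfl)
      (hS.homology_exact₁ (i + 1) i rfl) (hS.homology_exact₂ i) (h₂ _) (h₃ _) (h₂ _) (h₃ _)⟩

lemma BddHomology.of_shortExact₂ (h₁ : BddHomology P S.X₁) (h₃ : BddHomology P S.X₃) :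
    BddHomology P S.X₂ := by
  obtain ⟨⟨N, hN⟩, h₁⟩ := h₁
  obtain ⟨⟨N', hN'⟩, h₃⟩ := h₃
  refine ⟨⟨N + N', fun i hi => isZero_homology_X₂ hS i (hN _ (by omega)) (hN' _ (by omega))⟩,
    fun i => ?_⟩
  cases i with
  | zero =>
    have := epi_homologyMap_zero hS
    exact hP.prop_of_five _ _ _ _ _ _ comp_zero (hS.homology_exact₁ 1 0 rfl)
      (hS.homology_exact₂ 0) ((ShortComplex.exact_iff_epi _ rfl).2 this)
      (h₃ _) (h₁ _) (h₃ _) (hP.of_isZero (isZero_zero A))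
  | succ i =>
    exact hP.prop_of_five _ _ _ _ _ _ _ (hS.homology_exact₁ (i + 2) (i + 1) rfl)
      (hS.homology_exact₂ (i + 1)) (hS.homology_exact₃ (i + 1) i rfl) (h₃ _) (h₁ _) (h₃ _) (h₁ _)

lemma BddHomology.of_shortExact₃ (h₁ : BddHomology P S.X₁) (h₂ : BddHomology P S.X₂) :
    BddHomology P S.X₃ := by
  obtain ⟨⟨N, hN⟩, h₁⟩ := h₁
  obtain ⟨⟨N', hN'⟩, h₂⟩ := h₂
  refine ⟨⟨N + N' + 1, fun i hi => ?_⟩, fun i => ?_⟩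
  · obtain ⟨i, rfl⟩ : ∃ j, i = j + 1 := ⟨i - 1, by omega⟩
    exact isZero_homology_X₃_succ hS i (hN _ (by omega)) (hN' _ (by omega))
  cases i with
  | zero =>
    have := epi_homologyMap_zero hS
    have hz := isZero_zero A
    exact hP.prop_of_five _ _ _ (0 : (0 : A) ⟶ (0 : A)) _ comp_zero comp_zero
      (hS.homology_exact₂ 0) ((ShortComplex.exact_iff_epi _ rfl).2 this)
      (ShortComplex.exact_of_isZero_X₂ _ hz) (h₁ _) (h₂ _) (hP.of_isZero hz) (hP.of_isZero hz)
  | succ i =>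
    exact hP.prop_of_five _ _ _ _ _ _ _ (hS.homology_exact₂ (i + 1))
      (hS.homology_exact₃ (i + 1) i rfl) (hS.homology_exact₁ (i + 1) i rfl)
      (h₁ _) (h₂ _) (h₁ _) (h₂ _)

lemma euler_shortExact (h₁ : BddHomology P S.X₁) (h₂ : BddHomology P S.X₂)
    (h₃ : BddHomology P S.X₃) : euler P S.X₂ = euler P S.X₁ + euler P S.X₃ := by
  obtain ⟨⟨N₁, hN₁⟩, h₁⟩ := h₁
  obtain ⟨⟨N₂, hN₂⟩, h₂⟩ := h₂
  obtain ⟨⟨N₃, hN₃⟩, h₃⟩ := h₃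
  let N := N₁ + N₂ + N₃
  rw [euler_eq_sum _ N fun i hi => hN₁ i (by omega), euler_eq_sum _ N fun i hi => hN₂ i (by omega),
    euler_eq_sum _ N fun i hi => hN₃ i (by omega), ← Finset.sum_add_distrib, ← sub_eq_zero,
    ← Finset.sum_sub_distrib]
  -- `r i` is the class of the image of the connecting map leaving H_i(X₃), and there is none for i
  -- = 0. Splitting all classes into kernel and image leaves - r i - r (i + 1) in degree i, so the
  -- alternating sum telescopes to its last term, which vanishes as H_N(X₃) = 0.
  let r : ℕ → K0 P := fun i =>
    match i with
    | 0 => 0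
    | i + 1 => cls P (image (hS.δ (i + 1) i rfl))
  have ha (i : ℕ) : cls P (S.X₁.homology i) = r (i + 1) +
      cls P (image (HomologicalComplex.homologyMap S.f i)) := by
    rw [cls_kernel_image hP (HomologicalComplex.homologyMap S.f i) (h₁ i) (h₂ i),
      cls_kernel_of_exact hP _ _ _ (hS.homology_exact₁ (i + 1) i rfl)]
  have hb (i : ℕ) : cls P (S.X₂.homology i) =
      cls P (image (HomologicalComplex.homologyMap S.f i)) +
      cls P (image (HomologicalComplex.homologyMap S.g i)) := by
    rw [cls_kernel_image hP (HomologicalComplex.homologyMap S.g i) (h₂ i) (h₃ i),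
      cls_kernel_of_exact hP _ _ _ (hS.homology_exact₂ i)]
  have hc (i : ℕ) : cls P (S.X₃.homology i) =
      cls P (image (HomologicalComplex.homologyMap S.g i)) + r i := by
    cases i with
    | zero =>
      have := epi_homologyMap_zero hS
      rw [← cls_kernel_of_exact hP (HomologicalComplex.homologyMap S.g 0) (0 : _ ⟶ (0 : A)) comp_zero
          ((ShortComplex.exact_iff_epi _ rfl).2 this)]
      exact (cls_iso hP (kernelZeroIsoSource).symm).trans (add_zero _).symm
    | succ i =>
      rw [cls_kernel_image hP (hS.δ (i + 1) i rfl) (h₃ _) (h₁ i),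
        cls_kernel_of_exact hP _ _ _ (hS.homology_exact₃ (i + 1) i rfl)]
  have hr : r N = 0 := by
    cases hN : N with
    | zero => rfl
    | succ n =>
      refine cls_of_isZero ?_
      have hz : IsZero (S.X₃.homology (n + 1)) := hN₃ _ (by omega)
      exact IsZero.of_epi (factorThruImage (hS.δ (n + 1) n rfl)) hz
  have key (n : ℕ) : ∑ i ∈ Finset.range n, ((-1 : ℤ) ^ i • cls P (S.X₂.homology i) -
      ((-1 : ℤ) ^ i • cls P (S.X₁.homology i) + (-1 : ℤ) ^ i • cls P (S.X₃.homology i))) =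
      (-1 : ℤ) ^ n • r n := by
    induction n with
    | zero => simp [r]
    | succ n ih =>
      rw [Finset.sum_range_succ, ih, ha, hb, hc, pow_succ]
      simp only [smul_add, mul_neg, mul_one, neg_smul]
      abel
  rw [key, hr, smul_zero]

end EulerCharacteristic

/-! ### The bar construction of a morphism, and its extra degeneracy. -/

section Bar

variable {C : Type*} [Category* C] [Abelian C]

/-- The simplices of the interval which are not constant. -/
abbrev BarIndex (Δ : SimplexCategoryᵒᵖ) : Type :=
  {s : CylIndex Δ // s ≠ cst Δ 0 ∧ s ≠ cst Δ 1}

/-- The terms `Q ⊕ Pⁿ` of the bar construction. -/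
abbrev barObj (P Q : C) (Δ : SimplexCategoryᵒᵖ) : C := Q ⊞ (⨁ fun _ : BarIndex Δ => P)

variable {P Q : C} (f : P ⟶ Q)

open Classical in
/-- The map `P ⟶ Q ⊕ Pⁿ` attached to a simplex `s` of the interval: the inclusion of a summand if
`s` is not constant, zero if `s` is constant with value `0` and `f` if `s` is constant with
value `1`. -/
def barIncl {Δ : SimplexCategoryᵒᵖ} (s : CylIndex Δ) : P ⟶ barObj P Q Δ :=
  if h₀ : s = cst Δ 0 then 0
  else if h₁ : s = cst Δ 1 then f ≫ biprod.inl
  else biproduct.ι (fun _ : BarIndex Δ => P) ⟨s, h₀, h₁⟩ ≫ biprod.inr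

lemma barIncl_zero (Δ : SimplexCategoryᵒᵖ) : barIncl f (cst Δ 0) = 0 := dif_pos rfl

lemma barIncl_one (Δ : SimplexCategoryᵒᵖ) : barIncl f (cst Δ 1) = f ≫ biprod.inl :=
  (dif_neg (cst_ne Δ).symm).trans (dif_pos rfl)

lemma barIncl_of_ne {Δ : SimplexCategoryᵒᵖ} (s : BarIndex Δ) :
    barIncl f s.1 = biproduct.ι (fun _ : BarIndex Δ => P) s ≫ biprod.inr :=
  (dif_neg s.2.1).trans (dif_neg s.2.2)

variable {D : Type*} [Category* D] [Preadditive D] (E : C ⥤ D) [E.Additive]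

/-- Morphisms out of (the image under an additive functor of) a term of the bar construction. -/
def barDesc {Δ : SimplexCategoryᵒᵖ} {T : D} (q : E.obj Q ⟶ T)
    (p : CylIndex Δ → (E.obj P ⟶ T)) : E.obj (barObj P Q Δ) ⟶ T :=
  E.map biprod.fst ≫ q +
    ∑ᶠ s : BarIndex Δ, E.map (biprod.snd ≫ biproduct.π (fun _ : BarIndex Δ => P) s) ≫ p s.1

lemma inl_barDesc {Δ : SimplexCategoryᵒᵖ} {T : D} (q : E.obj Q ⟶ T)
    (p : CylIndex Δ → (E.obj P ⟶ T)) : E.map biprod.inl ≫ barDesc E q p = q := by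
  classical
  have := Fintype.ofFinite (BarIndex Δ)
  simp only [barDesc, finsum_eq_sum_of_fintype, Preadditive.comp_add, Preadditive.comp_sum,
    ← E.map_comp_assoc, biprod.inl_fst, biprod.inl_snd_assoc, zero_comp, E.map_zero, E.map_id,
    Category.id_comp, Finset.sum_const_zero, add_zero]

/-- The values of `p` on the two constant simplices are forced, since `barIncl` is 0 and `f ≫
biprod.inl` there. The functor `E` is allowed for the sake of evaluation at a simplicial degree: the
sequences considered later split only after applying it. -/
lemma barIncl_barDesc {Δ : SimplexCategoryᵒᵖ} {T : D} (q : E.obj Q ⟶ T)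
    (p : CylIndex Δ → (E.obj P ⟶ T)) (h₀ : p (cst Δ 0) = 0) (h₁ : p (cst Δ 1) = E.map f ≫ q)
    (s : CylIndex Δ) : E.map (barIncl f s) ≫ barDesc E q p = p s := by
  by_cases hs₀ : s = cst Δ 0
  · rw [hs₀, barIncl_zero, E.map_zero, zero_comp, h₀]
  by_cases hs₁ : s = cst Δ 1
  · rw [hs₁, barIncl_one, h₁, E.map_comp, Category.assoc, inl_barDesc]
  classical
  have := Fintype.ofFinite (BarIndex Δ)
  rw [barIncl_of_ne f ⟨s, hs₀, hs₁⟩]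
  simp only [barDesc, finsum_eq_sum_of_fintype, Preadditive.comp_add, Preadditive.comp_sum,
    ← E.map_comp_assoc, Category.assoc, biprod.inr_fst, biprod.inr_snd_assoc, comp_zero,
    E.map_zero, zero_comp, zero_add]
  rw [Finset.sum_eq_single ⟨s, hs₀, hs₁⟩]
  · simp
  · intro t _ ht
    rw [biproduct.ι_π_ne _ (Ne.symm ht), E.map_zero, zero_comp]
  · simp

lemma bar_total (Δ : SimplexCategoryᵒᵖ) [Fintype (BarIndex Δ)] :
    𝟙 (barObj P Q Δ) = biprod.fst ≫ biprod.inl +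
      ∑ s : BarIndex Δ, biprod.snd ≫ biproduct.π (fun _ : BarIndex Δ => P) s ≫
        barIncl f s.1 := by
  classical
  rw [← biprod.total]
  congr 1
  have := congrArg (fun u => (biprod.snd : barObj P Q Δ ⟶ _) ≫ u ≫
    (biprod.inr : _ ⟶ barObj P Q Δ)) (biproduct.total (f := fun _ : BarIndex Δ => P))
  simp only [Preadditive.comp_sum, Preadditive.sum_comp, Category.id_comp,
    Category.assoc] at this
  rw [← this]
  exact Finset.sum_congr rfl fun s _ => by rw [barIncl_of_ne]

/-- Testing on all simplices, including the constant ones, lets simplicial operators act by mere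
precomposition as in `barIncl_barMap`, so that identities between them need no case distinction. -/
lemma bar_hom_ext {Δ : SimplexCategoryᵒᵖ} {T : D} {a b : E.obj (barObj P Q Δ) ⟶ T}
    (hq : E.map biprod.inl ≫ a = E.map biprod.inl ≫ b)
    (hp : ∀ s, E.map (barIncl f s) ≫ a = E.map (barIncl f s) ≫ b) : a = b := by
  have := Fintype.ofFinite (BarIndex Δ)
  rw [← Category.id_comp a, ← Category.id_comp b, ← E.map_id, bar_total f]
  simp only [E.map_add, E.map_sum, Preadditive.add_comp, Preadditive.sum_comp, E.map_comp,
    Category.assoc, hq, hp]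

/-- The transition maps of the bar construction. -/
def barMap {Δ Δ' : SimplexCategoryᵒᵖ} (θ : Δ ⟶ Δ') : barObj P Q Δ ⟶ barObj P Q Δ' :=
  barDesc (𝟭 C) (biprod.inl : Q ⟶ barObj P Q Δ') fun s => barIncl f (θ.unop ≫ s)

lemma inl_barMap {Δ Δ' : SimplexCategoryᵒᵖ} (θ : Δ ⟶ Δ') :
    biprod.inl ≫ barMap f θ = biprod.inl :=
  inl_barDesc (𝟭 C) _ _

lemma barIncl_barMap {Δ Δ' : SimplexCategoryᵒᵖ} (θ : Δ ⟶ Δ') (s : CylIndex Δ) :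
    barIncl f s ≫ barMap f θ = barIncl f (θ.unop ≫ s) :=
  barIncl_barDesc f (𝟭 C) _ _ (by rw [comp_cst, barIncl_zero])
    (by rw [comp_cst, barIncl_one]; rfl) s

/-- The bar construction of a morphism `f : P ⟶ Q`, with terms `Q ⊕ Pⁿ`. If `f` is a
monomorphism, this is isomorphic to the Čech nerve of the projection to the cokernel of `f`. -/
def bar : SimplicialObject C where
  obj Δ := barObj P Q Δ
  map θ := barMap f θ
  map_id Δ := bar_hom_ext f (𝟭 C)
    (by simp [inl_barMap]) (fun s => by simp [barIncl_barMap])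
  map_comp θ θ' := bar_hom_ext f (𝟭 C)
    (by simp [inl_barMap, reassoc_of% (inl_barMap f θ)])
    (fun s => by simp [barIncl_barMap, reassoc_of% (barIncl_barMap f θ)])

/-- Prolongation of a simplex of the interval by a first vertex with value `0`. -/
def CylIndex.cons {n : ℕ} (s : CylIndex (op ⦋n⦌)) : CylIndex (op ⦋n + 1⦌) :=
  SimplexCategory.Hom.mk ⟨fun k : Fin (n + 2) => Fin.cases (0 : Fin 2) (fun i => s.toOrderHom i) k,
    fun k l h => by
      change Fin (n + 2) at k l
      induction k using Fin.cases with
      | zero => exact Fin.zero_le _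
      | succ k =>
        induction l using Fin.cases with
        | zero => exact absurd h (by simp)
        | succ l => exact s.toOrderHom.monotone (Fin.succ_le_succ_iff.1 h)⟩

lemma CylIndex.cons_cst_zero (n : ℕ) : (cst (op ⦋n⦌) 0).cons = cst (op ⦋n + 1⦌) 0 :=
  idx_ext fun k => by
    induction k using Fin.cases <;> rfl

lemma CylIndex.δ_zero_cons {n : ℕ} (s : CylIndex (op ⦋n⦌)) : SimplexCategory.δ 0 ≫ s.cons = s :=
  idx_ext fun _ => rfl

lemma CylIndex.δ_succ_cons {n : ℕ} (s : CylIndex (op ⦋n + 1⦌)) (i : Fin (n + 2)) :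
    SimplexCategory.δ i.succ ≫ s.cons = CylIndex.cons (SimplexCategory.δ i ≫ s) :=
  idx_ext fun k => by
    induction k using Fin.cases with
    | zero => rfl
    | succ k =>
      change (Fin.cases (0 : Fin 2) (fun i => s.toOrderHom i) (i.succ.succAbove k.succ) : Fin 2) = _
      rw [Fin.succ_succAbove_succ]
      rfl

lemma CylIndex.σ_succ_cons {n : ℕ} (s : CylIndex (op ⦋n⦌)) (i : Fin (n + 1)) :
    SimplexCategory.σ i.succ ≫ s.cons = CylIndex.cons (SimplexCategory.σ i ≫ s) :=
  idx_ext fun k => by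
    induction k using Fin.cases with
    | zero => rfl
    | succ k =>
      change (Fin.cases (0 : Fin 2) (fun i => s.toOrderHom i) (i.succ.predAbove k.succ) : Fin 2) = _
      rw [Fin.succ_predAbove_succ]
      rfl

lemma CylIndex.δ_one_cons (s : CylIndex (op ⦋0⦌)) :
    SimplexCategory.δ 1 ≫ s.cons = cst (op ⦋0⦌) 0 :=
  idx_ext fun k => by
    obtain rfl : k = 0 := Subsingleton.elim (α := Fin 1) _ _
    rfl

variable {R : C} (g : Q ⟶ R) (w : f ≫ g = 0)

variable (P) in
/-- The components of the augmentation of the bar construction. -/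
def barAugApp (Δ : SimplexCategoryᵒᵖ) : barObj P Q Δ ⟶ R :=
  barDesc (𝟭 C) g fun _ : CylIndex Δ => 0

lemma inl_barAugApp (Δ : SimplexCategoryᵒᵖ) : biprod.inl ≫ barAugApp P g Δ = g :=
  inl_barDesc (𝟭 C) g fun _ : CylIndex Δ => 0

include w in
lemma barIncl_barAugApp (Δ : SimplexCategoryᵒᵖ) (s : CylIndex Δ) :
    barIncl f s ≫ barAugApp P g Δ = 0 :=
  barIncl_barDesc f (𝟭 C) g (fun _ => 0) rfl w.symm s

include w in
lemma barMap_barAugApp {Δ Δ' : SimplexCategoryᵒᵖ} (θ : Δ ⟶ Δ') :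
    barMap f θ ≫ barAugApp P g Δ' = barAugApp P g Δ :=
  bar_hom_ext f (𝟭 C)
    (by simp [reassoc_of% (inl_barMap f θ), inl_barAugApp])
    (fun s => by simp [reassoc_of% (barIncl_barMap f θ), barIncl_barAugApp f g w])

/-- The bar construction of `f : P ⟶ Q`, augmented by a morphism `g : Q ⟶ R` with `f ≫ g = 0`. -/
def barAug : SimplicialObject.Augmented C where
  left := bar f
  right := R
  hom :=
    { app Δ := barAugApp P g Δ
      naturality _ _ θ := (barMap_barAugApp f g w θ).trans (Category.comp_id _).symm }

variable {f g} in
/-- If `P ⟶ Q ⟶ R` is split, the augmented bar construction has an extra degeneracy. -/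
def barExtraDegeneracy (r : E.obj Q ⟶ E.obj P) (t : E.obj R ⟶ E.obj Q) (ht : t ≫ E.map g = 𝟙 _)
    (hfr : E.map f ≫ r = 𝟙 _) (hrt : r ≫ E.map f + E.map g ≫ t = 𝟙 _) :
    (((SimplicialObject.Augmented.whiskering C D).obj E).obj
      (barAug f g w)).ExtraDegeneracy := by
  -- A summand `P` indexed by a simplex moves to the simplex with an additional first vertex of
  -- value 0. On `Q`, the splitting separates `R` from `P`: the part `R` is kept, and the part `P`,
  -- which plays the role of the constant simplex 1, moves to the simplex 0, 1, …, 1.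
  let s (n : ℕ) : E.obj (barObj P Q (op ⦋n⦌)) ⟶ E.obj (barObj P Q (op ⦋n + 1⦌)) :=
    barDesc E (E.map g ≫ t ≫ E.map biprod.inl + r ≫ E.map (barIncl f (cst (op ⦋n⦌) 1).cons))
      fun s => E.map (barIncl f s.cons)
  have hs (n : ℕ) (c : CylIndex (op ⦋n⦌)) : E.map (barIncl f c) ≫ s n =
      E.map (barIncl f c.cons) :=
    barIncl_barDesc f E _ _ (by rw [CylIndex.cons_cst_zero, barIncl_zero, E.map_zero])
      (by rw [Preadditive.comp_add, ← E.map_comp_assoc, w, E.map_zero, zero_comp, zero_add,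
        reassoc_of% hfr]) c
  have hs' (n : ℕ) : E.map biprod.inl ≫ s n = E.map g ≫ t ≫ E.map biprod.inl +
      r ≫ E.map (barIncl f (cst (op ⦋n⦌) 1).cons) := inl_barDesc E _ _
  have hi {Δ Δ' : SimplexCategoryᵒᵖ} (θ : Δ ⟶ Δ') :
      E.map biprod.inl ≫ E.map (barMap f θ) = E.map biprod.inl := by
    rw [← E.map_comp, inl_barMap]
  have hm {Δ Δ' : SimplexCategoryᵒᵖ} (θ : Δ ⟶ Δ') (c : CylIndex Δ) :
      E.map (barIncl f c) ≫ E.map (barMap f θ) = E.map (barIncl f (θ.unop ≫ c)) := by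
    rw [← E.map_comp, barIncl_barMap]
  have hgi (n : ℕ) : E.map (biprod.inl : Q ⟶ barObj P Q (op ⦋n⦌)) ≫
      E.map (barAugApp P g (op ⦋n⦌)) = E.map g := by
    rw [← E.map_comp, inl_barAugApp]
  have hgm (n : ℕ) (c : CylIndex (op ⦋n⦌)) : E.map (barIncl f c) ≫
      E.map (barAugApp P g (op ⦋n⦌)) = 0 := by
    rw [← E.map_comp, barIncl_barAugApp f g w, E.map_zero]
  have hδ₁ : s 0 ≫ E.map (barMap f (SimplexCategory.δ (n := 0) 1).op) =
      E.map (barAugApp P g (op ⦋0⦌)) ≫ t ≫ E.map biprod.inl := by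
    refine bar_hom_ext f E ?_ fun c => ?_
    · rw [reassoc_of% hs', Preadditive.add_comp, Category.assoc, Category.assoc, Category.assoc,
        hi, hm, Quiver.Hom.unop_op, CylIndex.δ_one_cons, barIncl_zero, E.map_zero, comp_zero,
        add_zero, reassoc_of% (hgi 0)]
    · rw [reassoc_of% hs, hm, Quiver.Hom.unop_op, CylIndex.δ_one_cons, barIncl_zero, E.map_zero,
        reassoc_of% (hgm 0), zero_comp]
  have hδ₀ (n : ℕ) : s n ≫ E.map (barMap f (SimplexCategory.δ (n := n) 0).op) = 𝟙 _ := by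
    refine bar_hom_ext f E ?_ fun c => ?_
    · rw [reassoc_of% hs', Preadditive.add_comp, Category.assoc, Category.assoc, Category.assoc,
        hi, hm, Quiver.Hom.unop_op, CylIndex.δ_zero_cons, barIncl_one, E.map_comp,
        ← Category.assoc r, ← Category.assoc (E.map g), ← Preadditive.add_comp, add_comm, hrt,
        Category.id_comp, Category.comp_id]
    · rw [reassoc_of% hs, hm, Quiver.Hom.unop_op, CylIndex.δ_zero_cons, Category.comp_id]
  have hδ (n : ℕ) (i : Fin (n + 2)) :
      s (n + 1) ≫ E.map (barMap f (SimplexCategory.δ i.succ).op) =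
        E.map (barMap f (SimplexCategory.δ i).op) ≫ s n := by
    refine bar_hom_ext f E ?_ fun c => ?_
    · rw [reassoc_of% hs', Preadditive.add_comp, Category.assoc, Category.assoc, Category.assoc,
        hi, hm, Quiver.Hom.unop_op, CylIndex.δ_succ_cons, reassoc_of% hi, hs']
      rfl
    · rw [reassoc_of% hs, hm, Quiver.Hom.unop_op, CylIndex.δ_succ_cons, reassoc_of% hm, hs]
      rfl
  have hσ (n : ℕ) (i : Fin (n + 1)) :
      s n ≫ E.map (barMap f (SimplexCategory.σ i.succ).op) =
        E.map (barMap f (SimplexCategory.σ i).op) ≫ s (n + 1) := by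
    refine bar_hom_ext f E ?_ fun c => ?_
    · rw [reassoc_of% hs', Preadditive.add_comp, Category.assoc, Category.assoc, Category.assoc,
        hi, hm, Quiver.Hom.unop_op, CylIndex.σ_succ_cons, reassoc_of% hi, hs']
      rfl
    · rw [reassoc_of% hs, hm, Quiver.Hom.unop_op, CylIndex.σ_succ_cons, reassoc_of% hm, hs]
      rfl
  have hε : (t ≫ E.map (biprod.inl : Q ⟶ barObj P Q (op ⦋0⦌))) ≫
      E.map (barAugApp P g (op ⦋0⦌)) = 𝟙 _ := by
    rw [Category.assoc, hgi, ht]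
  exact
  { s' := t ≫ E.map biprod.inl
    s := s
    s'_comp_ε := (congrArg _ (Category.comp_id _)).trans hε
    s₀_comp_δ₁ := hδ₁.trans (congrArg (· ≫ _) (Category.comp_id _).symm)
    s_comp_δ₀ := hδ₀
    s_comp_δ := hδ
    s_comp_σ := hσ }

end Bar

/-! ### Combinatorics of simplices of the interval. -/

section IntervalSimplices

/-- The values of a simplex of the interval on the vertices. -/
def CylIndex.val {n : ℕ} (s : CylIndex (op ⦋n⦌)) (k : Fin (n + 1)) : Fin 2 := s.toOrderHom k

lemma CylIndex.val_mono {n : ℕ} (s : CylIndex (op ⦋n⦌)) : Monotone s.val :=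
  fun _ _ h => s.toOrderHom.monotone h

lemma CylIndex.val_cst (n : ℕ) (a : Fin 2) (k : Fin (n + 1)) : (cst (op ⦋n⦌) a).val k = a := rfl

lemma CylIndex.val_stp {n : ℕ} (j : Fin (n + 1)) (k : Fin (n + 2)) :
    (stp j).val k = if k ≤ j.castSucc then 0 else 1 := rfl

lemma CylIndex.val_δ {n : ℕ} (i : Fin (n + 2)) (s : CylIndex (op ⦋n + 1⦌)) (k : Fin (n + 1)) :
    CylIndex.val (SimplexCategory.δ i ≫ s) k = s.val (i.succAbove k) := rfl

lemma CylIndex.val_zero {n : ℕ} (s : CylIndex (op ⦋n⦌)) (hs : s ≠ cst _ 1) : s.val 0 = 0 := by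
  by_contra h
  refine hs (idx_ext fun k => ?_)
  have h1 := s.val_mono (Fin.zero_le k)
  change s.val k = 1
  omega

lemma stp_ne_zero {n : ℕ} (j : Fin (n + 1)) : stp j ≠ cst _ 0 := fun h => by
  have := congrArg (fun s => CylIndex.val s (Fin.last (n + 1))) h
  rw [CylIndex.val_stp, if_neg (not_le.2 j.castSucc_lt_last), CylIndex.val_cst] at this
  exact absurd this (by decide)

lemma stp_ne_one {n : ℕ} (j : Fin (n + 1)) : stp j ≠ cst _ 1 := fun h => by
  have := congrArg (fun s => CylIndex.val s 0) h
  rw [CylIndex.val_stp, if_pos (Fin.zero_le _), CylIndex.val_cst] at this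
  exact absurd this (by decide)

lemma stp_injective {n : ℕ} : Function.Injective (stp (n := n)) := fun i j h => by
  have h' (k : Fin (n + 2)) : k ≤ i.castSucc ↔ k ≤ j.castSucc := by
    have := congrArg (fun s => CylIndex.val s k) h
    rw [CylIndex.val_stp, CylIndex.val_stp] at this
    by_cases h1 : k ≤ i.castSucc <;> by_cases h2 : k ≤ j.castSucc
    · exact iff_of_true h1 h2
    · simp [h1, h2] at this
    · simp [h1, h2] at this
    · exact iff_of_false h1 h2
  exact Fin.castSucc_injective _ (le_antisymm ((h' _).1 le_rfl) ((h' _).2 le_rfl))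

/-- The nonconstant simplex of the interval which jumps after the vertex `j`. -/
def barIndexStp {n : ℕ} (j : Fin (n + 1)) : BarIndex (op ⦋n + 1⦌) :=
  ⟨stp j, stp_ne_zero j, stp_ne_one j⟩

lemma barIndexStp_injective {n : ℕ} : Function.Injective (barIndexStp (n := n)) :=
  fun _ _ h => stp_injective (congrArg Subtype.val h)

/-- A monotone map to {0, 1} other than `stp i` does not jump between the vertices `i` and `i + 1`.
Deleting vertex `i + 1` and repeating vertex `i` then changes nothing. -/
lemma σ_δ_comp_of_ne_stp {n : ℕ} (i : Fin (n + 1)) (s : CylIndex (op ⦋n + 1⦌))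
    (hs : s ≠ stp i) : SimplexCategory.σ i ≫ SimplexCategory.δ i.succ ≫ s = s := by
  have h : s.val i.succ = s.val i.castSucc := by
    by_contra h
    have hle := s.val_mono i.castSucc_lt_succ.le
    refine hs (idx_ext fun k => ?_)
    change s.val k = (stp i).val k
    rw [CylIndex.val_stp]
    split_ifs with hk
    · have := s.val_mono hk
      omega
    · have := s.val_mono (Fin.castSucc_lt_iff_succ_le.1 (not_le.1 hk))
      omega
  refine idx_ext fun k => ?_
  change s.val (i.succ.succAbove (i.predAbove k)) = s.val k
  change Fin (n + 2) at k
  by_cases hk : k = i.succ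
  · subst hk
    rw [Fin.predAbove_succ_self, Fin.succAbove_succ_self, h]
  · congr 1
    ext
    have hk' : (k : ℕ) ≠ i + 1 := fun e => hk (Fin.ext e)
    simp only [Fin.succAbove, Fin.predAbove, Fin.lt_def, Fin.val_castSucc, Fin.val_succ]
    split_ifs with h1 h2 h3 <;> simp at * <;> omega

end IntervalSimplices

/-! ### A functor of finite degree applied to the bar construction. -/

section Bar

variable {C : Type*} [Category* C] [Abelian C] {P Q : C}

lemma barIncl_congr (f f' : P ⟶ Q) {Δ : SimplexCategoryᵒᵖ} {s : CylIndex Δ} (hs : s ≠ cst Δ 1) :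
    barIncl f s = barIncl f' s := by
  simp only [barIncl, dif_neg hs]

/-- The map `f` enters only when a nonconstant simplex becomes constant with value 1. Such a simplex
has value 0 at its first vertex, and every face except d₀ keeps this vertex. -/
lemma barMap_δ_succ_congr (f f' : P ⟶ Q) {n : ℕ} (k : Fin (n + 1)) :
    barMap f (SimplexCategory.δ k.succ).op = barMap f' (SimplexCategory.δ k.succ).op := by
  refine biprod.hom_ext' _ _ ?_ (biproduct.hom_ext' _ _ fun s => ?_)
  · rw [inl_barMap, inl_barMap]
  · rw [← Category.assoc, ← Category.assoc, ← barIncl_of_ne f, barIncl_barMap,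
      barIncl_of_ne f, ← barIncl_of_ne f', barIncl_barMap]
    refine barIncl_congr f f' fun h => ?_
    have h1 := congrArg (fun s => CylIndex.val s 0) h
    dsimp only at h1
    rw [Quiver.Hom.unop_op, CylIndex.val_δ, Fin.succ_succAbove_zero, s.1.val_zero s.2.2,
      CylIndex.val_cst] at h1
    exact absurd h1 (by decide)

/-- By `σ_δ_comp_of_ne_stp`, a face followed by a degeneracy is the identity on every summand except
that of `stp i`. A map avoiding this summand thus factors through the degeneracy σ_i. -/
lemma comp_barMap_eq_self (f : P ⟶ Q) {n : ℕ} (i : Fin (n + 1)) {T : C}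
    (c : T ⟶ barObj P Q (op ⦋n + 1⦌))
    (hc : c ≫ biprod.snd ≫ biproduct.π (fun _ : BarIndex (op ⦋n + 1⦌) => P) (barIndexStp i) = 0) :
    c ≫ barMap f (SimplexCategory.δ i.succ).op ≫ barMap f (SimplexCategory.σ i).op = c := by
  have := Fintype.ofFinite (BarIndex (op ⦋n + 1⦌))
  have h : c = c ≫ 𝟙 _ := (Category.comp_id c).symm
  rw [bar_total f] at h
  conv_rhs => rw [h]
  conv_lhs => rw [h]
  simp only [Preadditive.comp_add, Preadditive.add_comp, Preadditive.comp_sum,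
    Preadditive.sum_comp, Category.assoc, reassoc_of% (inl_barMap f), inl_barMap,
    reassoc_of% (barIncl_barMap f), barIncl_barMap, Quiver.Hom.unop_op]
  congr 1
  refine Finset.sum_congr rfl fun s _ => ?_
  by_cases hs : s.1 = stp i
  · obtain rfl : s = barIndexStp i := Subtype.ext hs
    simp only [← Category.assoc] at hc ⊢
    rw [hc, zero_comp, zero_comp]
  · rw [σ_δ_comp_of_ne_stp i s.1 hs]

variable {D : Type*} [Category* D] [Abelian D] (Φ : C ⥤ D)

/-- A functor applied to the bar construction. -/
abbrev mapBar (f : P ⟶ Q) : SimplicialObject D :=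
  ((SimplicialObject.whiskering C D).obj Φ).obj (bar f)

open AlgebraicTopology AlgebraicTopology.DoldKan

/-- The normalized term is the intersection of the kernels of all faces but d₀, and those faces do
not involve `f`. Only the differential, induced by d₀, does. -/
lemma objX_mapBar_congr (f f' : P ⟶ Q) (n : ℕ) :
    (NormalizedMooreComplex.objX (mapBar Φ f) n : Subobject (Φ.obj (barObj P Q (op ⦋n⦌)))) =
      NormalizedMooreComplex.objX (mapBar Φ f') n := by
  cases n with
  | zero => rfl
  | succ n => exact Finset.inf_congr rfl fun k _ =>
      congrArg (fun u => kernelSubobject (Φ.map u)) (barMap_δ_succ_congr f f' k)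

/-- The terms of the normalized complex of `Φ` applied to the bar construction of `f : P ⟶ Q`
do not depend on `f`. -/
def normalizedMapBarIso (f f' : P ⟶ Q) (n : ℕ) :
    ((normalizedMooreComplex D).obj (mapBar Φ f)).X n ≅
      ((normalizedMooreComplex D).obj (mapBar Φ f')).X n :=
  Subobject.isoOfEq _ _ (objX_mapBar_congr Φ f f' n)

variable {d : ℕ} (hΦ : ∀ {X Y : C} (a : Fin (d + 1) → (X ⟶ Y)),
  deviation (Φ.map : (X ⟶ Y) → _) a = 0)

include hΦ

/-- In degree `n + 1 ≥ d + 1` there are `d + 1` distinct summands `P`, one for each of `d + 1`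
jumps. The identity is decomposed into `d + 1` maps, each missing all of these summands but one. In
the deviation formula, every proper partial sum misses some jump, so it factors through a degeneracy
and is killed by `PInfty`; the term left over is the identity. -/
lemma PInfty_mapBar_eq_zero (f : P ⟶ Q) {n : ℕ} (hn : d ≤ n) :
    (PInfty (X := mapBar Φ f)).f (n + 1) = 0 := by
  classical
  obtain ⟨q, hq⟩ : ∃ q : Φ.obj (barObj P Q (op ⦋n + 1⦌)) ⟶ Φ.obj (barObj P Q (op ⦋n + 1⦌)),
    q = (PInfty (X := mapBar Φ f)).f (n + 1) := ⟨_, rfl⟩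
  have hσ (i : Fin (n + 1)) : Φ.map (barMap f (SimplexCategory.σ i).op) ≫ q = 0 := by
    rw [hq]
    exact σ_comp_PInfty (mapBar Φ f) i
  let b (j : Fin (d + 1)) : BarIndex (op ⦋n + 1⦌) := barIndexStp (j.castLE (by omega))
  have hb : Function.Injective b := fun i j h =>
    Fin.castLE_injective _ (barIndexStp_injective h)
  let π (j : Fin (d + 1)) : barObj P Q (op ⦋n + 1⦌) ⟶ P := biprod.snd ≫ biproduct.π _ (b j)
  let p (j : Fin (d + 1)) : barObj P Q (op ⦋n + 1⦌) ⟶ barObj P Q (op ⦋n + 1⦌) :=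
    π j ≫ biproduct.ι (fun _ : BarIndex (op ⦋n + 1⦌) => P) (b j) ≫ biprod.inr
  have hp (k j : Fin (d + 1)) : p k ≫ π j = if k = j then π j else 0 := by
    dsimp only [p, π]
    simp only [Category.assoc, biprod.inr_snd_assoc]
    split_ifs with h
    · subst h; simp
    · rw [biproduct.ι_π_ne _ fun e => h (hb e)]; simp
  -- The complement of the chosen summands has to go somewhere for the total to be the identity. It
  -- is added to the map with index 0, which is harmless since it is killed by every `π j`.
  let a (j : Fin (d + 1)) : barObj P Q (op ⦋n + 1⦌) ⟶ barObj P Q (op ⦋n + 1⦌) :=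
    p j + if j = 0 then 𝟙 _ - ∑ k, p k else 0
  have ha : ∑ j, a j = 𝟙 _ := by simp [a, Finset.sum_add_distrib]
  have haπ (k j : Fin (d + 1)) (h : k ≠ j) : a k ≫ π j = 0 := by
    dsimp only [a]
    rw [Preadditive.add_comp, hp, if_neg h, zero_add]
    split_ifs
    · simp [Preadditive.sub_comp, Preadditive.sum_comp, hp]
    · exact zero_comp
  have hS (S : Finset (Fin (d + 1))) (hS : S ≠ Finset.univ) :
      Φ.map (∑ j ∈ S, a j) ≫ q = 0 := by
    obtain ⟨j, hj⟩ : ∃ j, j ∉ S := by simpa [Finset.eq_univ_iff_forall] using hS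
    rw [← comp_barMap_eq_self f (j.castLE (by omega)) (∑ j ∈ S, a j), Φ.map_comp, Φ.map_comp,
      Category.assoc, Category.assoc, hσ, comp_zero, comp_zero]
    change (∑ j ∈ S, a j) ≫ π j = 0
    rw [Preadditive.sum_comp]
    exact Finset.sum_eq_zero fun k hk => haπ k j fun h => hj (h ▸ hk)
  have h := congrArg (· ≫ q) (hΦ a)
  simp only [deviation, Preadditive.sum_comp, Preadditive.zsmul_comp, zero_comp] at h
  rw [Finset.sum_eq_single Finset.univ (fun S _ h => by rw [hS S h, smul_zero])
    (fun h => absurd (Finset.mem_univ _) h), ha, Φ.map_id, Category.id_comp,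
    Finset.card_univ, Fintype.card_fin, Nat.sub_self, pow_zero, one_smul] at h
  rw [← hq, h]
  rfl

lemma isZero_normalized_mapBar (f : P ⟶ Q) {n : ℕ} (hn : d ≤ n) :
    IsZero (((normalizedMooreComplex D).obj (mapBar Φ f)).X (n + 1)) := by
  have h := congrArg (fun u => u.f (n + 1))
    (inclusionOfMooreComplexMap_comp_PInfty (mapBar Φ f))
  have h2 : (inclusionOfMooreComplexMap (mapBar Φ f)).f (n + 1) = 0 := by
    rw [← h, HomologicalComplex.comp_f, PInfty_mapBar_eq_zero Φ hΦ f hn]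
    exact comp_zero
  have h3 : Mono ((inclusionOfMooreComplexMap (mapBar Φ f)).f (n + 1)) := by
    rw [inclusionOfMooreComplexMap_f]
    exact inferInstanceAs (Mono (Subobject.arrow _))
  exact IsZero.of_mono_eq_zero _ h2

end Bar

/-! ### Exactness in functor categories, and resolutions by cokernels. -/

section Evaluation

variable {J : Type*} [Category* J] {D : Type*} [Category* D] [Abelian D]

lemma exact_of_evaluation (T : ShortComplex (J ⥤ D))
    (h : ∀ j, (T.map ((evaluation J D).obj j)).Exact) : T.Exact := by
  rw [ShortComplex.exact_iff_isZero_homology, Functor.isZero_iff]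
  exact fun j => (ShortComplex.exact_iff_isZero_homology _).1 (h j) |>.of_iso
    (T.mapHomologyIso ((evaluation J D).obj j)).symm

end Evaluation

section OpcyclesResolution

variable {D : Type*} [Category* D] [Abelian D]

/-- The short complex `O_{n+1} ⟶ N_n ⟶ O_n`, where `O_n` is the cokernel of `N_{n+1} ⟶ N_n`. -/
def opcyclesShortComplex (N : ChainComplex D ℕ) (n : ℕ) : ShortComplex D :=
  ShortComplex.mk (N.fromOpcycles (n + 1) n) (N.pOpcycles n) (by
    rw [← cancel_epi (N.pOpcycles (n + 1)), HomologicalComplex.p_fromOpcycles_assoc, comp_zero]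
    exact N.d_pOpcycles (n + 1) n)

/-- The kernel of `O_{n+1} ⟶ N_n` is the homology of `N` in degree `n + 1`, so injectivity is
exactly what the hypothesis supplies. -/
lemma opcyclesShortComplex_shortExact (N : ChainComplex D ℕ) (n : ℕ)
    (h : IsZero (N.homology (n + 1))) : (opcyclesShortComplex N n).ShortExact where
  exact := by
    refine ShortComplex.exact_of_g_is_cokernel _ (CokernelCofork.IsColimit.ofπ _ _
      (fun k hk => N.descOpcycles k (n + 1) (by simp) ?_) (fun k hk => ?_) (fun k hk m hm => ?_))
    · exact (N.p_fromOpcycles_assoc (n + 1) n k).symm.trans ((congrArg _ hk).trans comp_zero)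
    · exact N.p_descOpcycles k (n + 1) (by simp) _
    · exact (cancel_epi (N.pOpcycles n)).1 (hm.trans (N.p_descOpcycles _ _ _ _).symm)
  mono_f := Preadditive.mono_of_isZero_kernel' _ (N.homologyIsKernel (n + 1) n (by simp)) h
  epi_g := inferInstanceAs (Epi (N.pOpcycles n))

end OpcyclesResolution

/-! ### Augmented simplicial objects with pointwise extra degeneracies. -/

section AugmentedExactness

variable {D : Type*} [Category* D] [Abelian D] {J : Type*} [Category* J]

/-- Homology in a functor category is computed pointwise, and the extra degeneracy at each `j`
contracts the complex there. No naturality in `j` of these degeneracies is needed, which matters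
because splittings are only chosen degree by degree. -/
lemma isZero_homology_alt_of_extraDegeneracy (X : SimplicialObject.Augmented (J ⥤ D))
    (s : ∀ j, (((SimplicialObject.Augmented.whiskering _ _).obj
      ((evaluation J D).obj j)).obj X).ExtraDegeneracy) (n : ℕ) :
    IsZero (((alternatingFaceMapComplex (J ⥤ D)).obj X.left).homology (n + 1)) := by
  rw [Functor.isZero_iff]
  intro j
  let K := (alternatingFaceMapComplex (J ⥤ D)).obj X.left
  let Xj := ((SimplicialObject.Augmented.whiskering _ _).obj
      ((evaluation J D).obj j)).obj X
  have e : (((evaluation J D).obj j).mapHomologicalComplex _).obj K =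
      (alternatingFaceMapComplex D).obj Xj.left :=
    Functor.congr_obj (map_alternatingFaceMapComplex ((evaluation J D).obj j)) X.left
  have h : IsZero (((alternatingFaceMapComplex D).obj Xj.left).homology (n + 1)) :=
    (HomologicalComplex.isZero_single_obj_homology _ _ _ _ (Nat.succ_ne_zero n)).of_iso
      ((s j).homotopyEquiv.toHomologyIso (n + 1))
  rw [← e] at h
  exact h.of_iso ((K.sc (n + 1)).mapHomologyIso ((evaluation J D).obj j)).symm

lemma augmentation_condition (X : SimplicialObject.Augmented D) :
    ((alternatingFaceMapComplex D).obj X.left).d 1 0 ≫ X.hom.app (op ⦋0⦌) = 0 := by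
  have h := ((AlternatingFaceMapComplex.ε (C := D)).app X).comm 1 0
  rw [AlternatingFaceMapComplex.ε_app_f_zero, AlternatingFaceMapComplex.ε_app_f_succ,
    zero_comp] at h
  exact h.symm

lemma alternatingFaceMapComplex_d_one_zero (X : SimplicialObject D) :
    ((alternatingFaceMapComplex D).obj X).d 1 0 = X.δ 0 - X.δ 1 := by
  rw [alternatingFaceMapComplex_obj_d]
  simp [AlternatingFaceMapComplex.objD, Fin.sum_univ_two, sub_eq_add_neg]

/-- The short complex given by the beginning of an augmented simplicial object. -/
def augmentationShortComplex (X : SimplicialObject.Augmented D) : ShortComplex D :=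
  ShortComplex.mk _ _ (augmentation_condition X)

lemma eq_comp_sub_of_section {Y X₀ X₁ R : D} {x : Y ⟶ X₀} {s : X₀ ⟶ X₁} {a b : X₁ ⟶ X₀}
    {e : X₀ ⟶ R} {t : R ⟶ X₀} (ha : s ≫ a = 𝟙 _) (hb : s ≫ b = e ≫ t) (hx : x ≫ e = 0) :
    x = (x ≫ s) ≫ (a - b) := by
  rw [Category.assoc, Preadditive.comp_sub, ha, hb, Preadditive.comp_sub, reassoc_of% hx,
    zero_comp, Category.comp_id, sub_zero]

lemma augmentationShortComplex_exact (X : SimplicialObject.Augmented (J ⥤ D))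
    (s : ∀ j, (((SimplicialObject.Augmented.whiskering _ _).obj
      ((evaluation J D).obj j)).obj X).ExtraDegeneracy) :
    (augmentationShortComplex X).Exact := by
  refine exact_of_evaluation _ fun j => ?_
  rw [ShortComplex.exact_iff_exact_up_to_refinements]
  intro Y x hx
  -- With s the extra degeneracy, d₀ after s is the identity, while d₁ after s factors through the
  -- augmentation and so vanishes on `x`. Hence s(x) has boundary `x`.
  refine ⟨Y, 𝟙 Y, inferInstance, x ≫ (s j).s 0, ?_⟩
  have hd : ((alternatingFaceMapComplex (J ⥤ D)).obj X.left).d 1 0 = X.left.δ 0 - X.left.δ 1 :=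
    alternatingFaceMapComplex_d_one_zero _
  have h₀ : (s j).s 0 ≫ (X.left.δ 0).app j = 𝟙 _ := (s j).s_comp_δ₀ 0
  have h₁ : (s j).s 0 ≫ (X.left.δ 1).app j = (X.hom.app (op ⦋0⦌)).app j ≫ (s j).s' :=
    (s j).s₀_comp_δ₁.trans (congrArg (· ≫ (s j).s') (Category.comp_id _))
  have hx' : x ≫ (X.hom.app (op ⦋0⦌)).app j = 0 := hx
  change 𝟙 Y ≫ x = (x ≫ (s j).s 0) ≫
    (((alternatingFaceMapComplex (J ⥤ D)).obj X.left).d 1 0).app j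
  rw [hd, NatTrans.app_sub]
  exact (Category.id_comp x).trans (eq_comp_sub_of_section h₀ h₁ hx')

lemma epi_augmentation (X : SimplicialObject.Augmented (J ⥤ D))
    (s : ∀ j, (((SimplicialObject.Augmented.whiskering _ _).obj
      ((evaluation J D).obj j)).obj X).ExtraDegeneracy) :
    Epi (augmentationShortComplex X).g := by
  have (j : J) : Epi ((augmentationShortComplex X).g.app j) := by
    have h : (s j).s' ≫ (X.hom.app (op ⦋0⦌)).app j = 𝟙 _ :=
      (congrArg _ (Category.comp_id _).symm).trans (s j).s'_comp_ε
    exact (SplitEpi.mk _ h).epi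
  exact NatTrans.epi_of_epi_app _

/-- The zeroth homology of the alternating face map complex is the augmentation, when there are
extra degeneracies. -/
def homologyZeroIsoOfExtraDegeneracy (X : SimplicialObject.Augmented (J ⥤ D))
    (s : ∀ j, (((SimplicialObject.Augmented.whiskering _ _).obj
      ((evaluation J D).obj j)).obj X).ExtraDegeneracy) :
    ((alternatingFaceMapComplex (J ⥤ D)).obj X.left).homology 0 ≅ X.right :=
  have := epi_augmentation X s
  (ChainComplex.isoHomologyι₀ _).trans
    (IsColimit.coconePointUniqueUpToIso
      (((alternatingFaceMapComplex (J ⥤ D)).obj X.left).opcyclesIsCokernel 1 0 (by simp))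
      (augmentationShortComplex_exact X s).gIsCokernel)

/-- The homotopy equivalence between the normalized and the alternating face map complexes, on
homology. -/
def normalizedHomologyIso (X : SimplicialObject D) (n : ℕ) :
    ((normalizedMooreComplex D).obj X).homology n ≅
      ((alternatingFaceMapComplex D).obj X).homology n :=
  (DoldKan.homotopyEquivNormalizedMooreComplexAlternatingFaceMapComplex
    (Y := X)).toHomologyIso n

end AugmentedExactness

/-! ### Additive invariants and bounded resolutions with equal terms. -/

section Comparison

variable {D : Type*} [Category* D] [Abelian D] {K : Type*} [AddCommGroup K]

/-- A class of objects closed under isomorphisms, containing the third object of a short exact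
sequence when it contains the first two, and an additive invariant for it. -/
structure AdditiveInvariant (D : Type*) [Category* D] [Abelian D] (K : Type*) [AddCommGroup K] where
  /-- the class of objects -/
  prop : D → Prop
  /-- the invariant -/
  val : D → K
  prop_iso {X Y : D} (e : X ≅ Y) : prop X → prop Y
  val_iso {X Y : D} (e : X ≅ Y) : val X = val Y
  prop_of_isZero {X : D} : IsZero X → prop X
  prop_retract {X Y : D} (i : X ⟶ Y) (r : Y ⟶ X) : i ≫ r = 𝟙 X → prop Y → prop X
  prop₁ {S : ShortComplex D} : S.ShortExact → prop S.X₂ → prop S.X₃ → prop S.X₁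
  prop₂ {S : ShortComplex D} : S.ShortExact → prop S.X₁ → prop S.X₃ → prop S.X₂
  prop₃ {S : ShortComplex D} : S.ShortExact → prop S.X₁ → prop S.X₂ → prop S.X₃
  val_add {S : ShortComplex D} : S.ShortExact → prop S.X₁ → prop S.X₂ → prop S.X₃ →
    val S.X₂ = val S.X₁ + val S.X₃

namespace AdditiveInvariant

variable (c : AdditiveInvariant D K)

lemma val_of_isZero {X : D} (hX : IsZero X) : c.val X = 0 := by
  have hS : (ShortComplex.mk (0 : X ⟶ X) (0 : X ⟶ X) zero_comp).ShortExact :=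
    { exact := ShortComplex.exact_of_isZero_X₂ _ hX
      mono_f := ⟨fun _ _ _ => hX.eq_of_tgt _ _⟩
      epi_g := ⟨fun _ _ _ => hX.eq_of_src _ _⟩ }
  have h := c.prop_of_isZero hX
  simpa using c.val_add hS h h h

lemma biprod_shortExact (X Y : D) :
    (ShortComplex.mk (biprod.inl : X ⟶ X ⊞ Y) biprod.snd biprod.inl_snd).ShortExact :=
  (ShortComplex.Splitting.ofHasBinaryBiproduct X Y).shortExact

lemma prop_biprod {X Y : D} (hX : c.prop X) (hY : c.prop Y) : c.prop (X ⊞ Y) :=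
  c.prop₂ (biprod_shortExact X Y) hX hY

lemma val_biprod {X Y : D} (hX : c.prop X) (hY : c.prop Y) :
    c.val (X ⊞ Y) = c.val X + c.val Y :=
  c.val_add (biprod_shortExact X Y) hX (c.prop_biprod hX hY) hY

/-- The invariant of the cokernel of `N₁ ⟶ N₀` for a bounded complex `N` which is exact in positive
degrees is determined by the terms of `N`. -/
lemma opcycles_congr {N N' : ChainComplex D ℕ} (e : ∀ n, N.X n ≅ N'.X n) {d : ℕ}
    (hd : ∀ n, d ≤ n → IsZero (N.X (n + 1))) (hN : ∀ n, IsZero (N.homology (n + 1)))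
    (hN' : ∀ n, IsZero (N'.homology (n + 1))) (h : ∀ n, c.prop (N.X n)) :
    c.val (N.opcycles 0) = c.val (N'.opcycles 0) := by
  -- Descending induction on `n`, with `k` counting the steps down from degree `d + 1`, where both
  -- complexes vanish. Each step subtracts the invariant of the next cokernel from that of the
  -- common term.
  have key (k : ℕ) : ∀ n, d + 1 ≤ n + k → c.prop (N.opcycles n) ∧ c.prop (N'.opcycles n) ∧
      c.val (N.opcycles n) = c.val (N'.opcycles n) := by
    induction k with
    | zero =>
      intro n hn
      obtain ⟨n, rfl⟩ : ∃ m, n = m + 1 := ⟨n - 1, by omega⟩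
      have h1 : IsZero (N.opcycles (n + 1)) :=
        IsZero.of_epi (N.pOpcycles _) (hd n (by omega))
      have h2 : IsZero (N'.opcycles (n + 1)) :=
        IsZero.of_epi (N'.pOpcycles _) ((hd n (by omega)).of_iso (e _).symm)
      exact ⟨c.prop_of_isZero h1, c.prop_of_isZero h2,
        by rw [c.val_of_isZero h1, c.val_of_isZero h2]⟩
    | succ k ih =>
      intro n hn
      obtain ⟨h1, h2, h3⟩ := ih (n + 1) (by omega)
      have s1 := opcyclesShortComplex_shortExact N n (hN n)
      have s2 := opcyclesShortComplex_shortExact N' n (hN' n)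
      have p1 : c.prop (N.opcycles n) := c.prop₃ s1 h1 (h n)
      have p2 : c.prop (N'.opcycles n) := c.prop₃ s2 h2 (c.prop_iso (e n) (h n))
      refine ⟨p1, p2, ?_⟩
      have a1 : c.val (N.X n) = c.val (N.opcycles (n + 1)) + c.val (N.opcycles n) :=
        c.val_add s1 h1 (h n) p1
      have a2 : c.val (N'.X n) = c.val (N'.opcycles (n + 1)) + c.val (N'.opcycles n) :=
        c.val_add s2 h2 (c.prop_iso (e n) (h n)) p2
      rw [c.val_iso (e n), a2, h3] at a1
      exact (add_left_cancel a1).symm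
  exact (key (d + 1) 0 (by omega)).2.2

end AdditiveInvariant

end Comparison

/-! ### The Euler characteristic as an additive invariant. -/

section SimplicialInvariant

variable {B : Type u'} [Category.{v'} B] [Abelian B] {B₀ : ObjectProperty B}

lemma alt_shortExact {S : ShortComplex (SimplicialObject B)} (hS : S.ShortExact) :
    (S.map (alt B)).ShortExact :=
  HomologicalComplex.shortExact_of_degreewise_shortExact _ fun n =>
    hS.map_of_exact ((evaluation SimplexCategoryᵒᵖ B).obj (op ⦋n⦌))

lemma BddHomology.of_iso (hB : IsWeakSerre B₀) {K L : ChainComplex B ℕ}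
    (e : ∀ i, K.homology i ≅ L.homology i) (h : BddHomology B₀ K) : BddHomology B₀ L :=
  ⟨h.1.imp fun _ hN i hi => (hN i hi).of_iso (e i).symm, fun i => hB.of_iso (e i) (h.2 i)⟩

lemma euler_congr (hB : IsWeakSerre B₀) {K L : ChainComplex B ℕ}
    (e : ∀ i, K.homology i ≅ L.homology i) : euler B₀ K = euler B₀ L :=
  finsum_congr fun i => by rw [cls_iso hB (e i)]

lemma BddHomology.of_acyclic (hB : IsWeakSerre B₀) {K : ChainComplex B ℕ}
    (h : ∀ i, IsZero (K.homology i)) : BddHomology B₀ K :=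
  ⟨⟨0, fun i _ => h i⟩, fun i => hB.of_isZero (h i)⟩

/-- A retract is the kernel of the complementary idempotent. Retracts occur because the normalized
complex is a direct summand of the unnormalized one. -/
lemma IsWeakSerre.of_retract (hB : IsWeakSerre B₀) {X Y : B} (i : X ⟶ Y) (r : Y ⟶ X)
    (h : i ≫ r = 𝟙 X) (hY : B₀ Y) : B₀ X := by
  refine hB.of_iso (X := Limits.kernel (𝟙 Y - r ≫ i)) ?_ (hB.kernel _ hY hY)
  have hk : kernel.ι (𝟙 Y - r ≫ i) ≫ r ≫ i = kernel.ι (𝟙 Y - r ≫ i) := by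
    have := kernel.condition (𝟙 Y - r ≫ i)
    rwa [Preadditive.comp_sub, Category.comp_id, sub_eq_zero, eq_comm] at this
  exact
    { hom := kernel.ι _ ≫ r
      inv := kernel.lift _ i (by simp [reassoc_of% h])
      hom_inv_id := by rw [← cancel_mono (kernel.ι _)]; simp [hk]
      inv_hom_id := by simp [h] }

lemma BddHomology.of_retract (hB : IsWeakSerre B₀) {K L : ChainComplex B ℕ} (i : K ⟶ L)
    (r : L ⟶ K) (h : i ≫ r = 𝟙 K) (hL : BddHomology B₀ L) : BddHomology B₀ K := by
  have h' (n : ℕ) : HomologicalComplex.homologyMap i n ≫ HomologicalComplex.homologyMap r n =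
      𝟙 _ := by
    rw [← HomologicalComplex.homologyMap_comp, h, HomologicalComplex.homologyMap_id]
  refine ⟨hL.1.imp fun N hN n hn => ?_, fun n => hB.of_retract _ _ (h' n) (hL.2 n)⟩
  rw [IsZero.iff_id_eq_zero, ← h', (hN n hn).eq_of_src (HomologicalComplex.homologyMap r n) 0,
    comp_zero]

/-- The Euler characteristic of chain complexes. -/
def eulerInvariant (hB : IsWeakSerre B₀) : AdditiveInvariant (ChainComplex B ℕ) (K0 B₀) where
  prop := BddHomology B₀
  val := euler B₀
  prop_iso e := BddHomology.of_iso hB fun i =>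
    (HomologicalComplex.homologyFunctor B _ i).mapIso e
  val_iso e := euler_congr hB fun i =>
    (HomologicalComplex.homologyFunctor B _ i).mapIso e
  prop_of_isZero h := BddHomology.of_acyclic hB fun i =>
    (HomologicalComplex.homologyFunctor B _ i).map_isZero h
  prop_retract i r h := BddHomology.of_retract hB i r h
  prop₁ hS := BddHomology.of_shortExact₁ hS hB
  prop₂ hS := BddHomology.of_shortExact₂ hS hB
  prop₃ hS := BddHomology.of_shortExact₃ hS hB
  val_add hS := euler_shortExact hS hB

/-- The Euler characteristic of simplicial objects. -/
def simplicialEuler (hB : IsWeakSerre B₀) :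
    AdditiveInvariant (SimplicialObject B) (K0 B₀) where
  prop M := BddHomology B₀ ((alt B).obj M)
  val M := euler B₀ ((alt B).obj M)
  prop_iso e := (eulerInvariant hB).prop_iso ((alt B).mapIso e)
  val_iso e := (eulerInvariant hB).val_iso ((alt B).mapIso e)
  prop_of_isZero h := BddHomology.of_acyclic hB fun i =>
    (alt B ⋙ HomologicalComplex.homologyFunctor B _ i).map_isZero h
  prop_retract i r h := (eulerInvariant hB).prop_retract ((alt B).map i) ((alt B).map r)
    (by rw [← (alt B).map_comp, h]; exact (alt B).map_id _)
  prop₁ hS := (eulerInvariant hB).prop₁ (alt_shortExact hS)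
  prop₂ hS := (eulerInvariant hB).prop₂ (alt_shortExact hS)
  prop₃ hS := (eulerInvariant hB).prop₃ (alt_shortExact hS)
  val_add hS := (eulerInvariant hB).val_add (alt_shortExact hS)

end SimplicialInvariant

/-! ### Finite biproducts, and extensions enlarged by a summand. -/

section BiproductInduction

variable {C : Type*} [Category* C] [Abelian C]

/-- A finite biproduct, with one summand split off. -/
def biproductOptionIso {ι : Type} [Finite ι] (X : Option ι → C) :
    (⨁ X) ≅ X none ⊞ ⨁ fun i => X (some i) where
  hom := biprod.lift (biproduct.π X none) (biproduct.lift fun i => biproduct.π X (some i))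
  inv := biprod.desc (biproduct.ι X none) (biproduct.desc fun i => biproduct.ι X (some i))
  hom_inv_id := by
    classical
    have := Fintype.ofFinite ι
    rw [biprod.lift_desc, biproduct.lift_desc, ← biproduct.total, Fintype.sum_option]
  inv_hom_id := by
    classical
    apply biprod.hom_ext <;> apply biprod.hom_ext'
    · simp
    · simp only [Category.assoc, biprod.lift_fst, biprod.inr_desc_assoc, Category.id_comp,
        biprod.inr_fst]
      ext i
      simp
    · simp only [Category.assoc, biprod.lift_snd, biprod.inl_desc_assoc, Category.id_comp,
        biprod.inl_snd]
      ext i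
      simp
    · simp only [Category.assoc, biprod.lift_snd, biprod.inr_desc_assoc, Category.id_comp,
        biprod.inr_snd]
      ext i j
      by_cases h : i = j
      · subst h; simp
      · simp [biproduct.ι_π]

lemma prop_biproduct (W : C → Prop) (h₀ : ∀ X, IsZero X → W X)
    (hiso : ∀ X Y, Nonempty (X ≅ Y) → W X → W Y) (hW : ∀ X Y, W X → W Y → W (X ⊞ Y))
    (ι : Type) [Finite ι] (X : ι → C) (hX : ∀ i, W (X i)) : W (⨁ X) := by
  refine Finite.induction_empty_option
    (P := fun ι => ∀ [Finite ι] (X : ι → C), (∀ i, W (X i)) → W (⨁ X)) ?_ ?_ ?_ ι X hX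
  · intro α β e ih _ X hX
    have := Finite.of_equiv _ e.symm
    exact hiso _ _ ⟨biproduct.whiskerEquiv e fun _ => Iso.refl _⟩
      (ih (fun i => X (e i)) fun i => hX _)
  · exact fun X _ => h₀ _
      ((IsZero.iff_id_eq_zero _).2 (biproduct.hom_ext _ _ fun i => nomatch i))
  · intro α _ ih _ X hX
    exact hiso _ _ ⟨(biproductOptionIso X).symm⟩ (hW _ _ (hX _) (ih _ fun i => hX _))

/-- Taking `W = S.X₁` gives an embedding of `X₁` into `X₁ ⊞ X₂` with cokernel `X₁ ⊞ X₃`, to be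
compared with the split embedding, whose cokernel is `X₂`. An arbitrary `W` is needed for stable
classes. -/
lemma map_inr_shortExact {S : ShortComplex C} (hS : S.ShortExact) (W : C) :
    (ShortComplex.mk (S.f ≫ (biprod.inr : _ ⟶ W ⊞ S.X₂)) (biprod.map (𝟙 W) S.g)
      (by simp)).ShortExact := by
  have := hS.mono_f
  have := hS.epi_g
  refine { exact := ?_, mono_f := ?_, epi_g := ?_ }
  · rw [ShortComplex.exact_iff_exact_up_to_refinements]
    intro Y x hx
    have h1 : x ≫ biprod.fst = 0 := by
      have := congrArg (· ≫ biprod.fst) hx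
      simpa using this
    have h2 : (x ≫ biprod.snd) ≫ S.g = 0 := by
      have := congrArg (· ≫ biprod.snd) hx
      simpa using this
    obtain ⟨Y', π, hπ, y, hy⟩ :=
      (ShortComplex.exact_iff_exact_up_to_refinements _).1 hS.exact _ h2
    refine ⟨Y', π, hπ, y, ?_⟩
    apply biprod.hom_ext
    · simp only [Category.assoc, biprod.inr_fst, comp_zero]
      rw [h1, comp_zero]
    · simp only [Category.assoc, biprod.inr_snd, Category.comp_id]
      exact hy
  · exact inferInstanceAs (Mono (S.f ≫ biprod.inr))
  · exact inferInstanceAs (Epi (biprod.map (𝟙 W) S.g))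

end BiproductInduction

/-! ### Comparison of F on an extension and on the split extension. -/

section Core

variable {A : Type u} [Category.{v} A] [Abelian A] {B : Type u'} [Category.{v'} B] [Abelian B]

lemma deviation_whiskering {F : A ⥤ B} {d : ℕ} (hF : FunctorDegreeLE F d)
    {X Y : SimplicialObject A} (a : Fin (d + 1) → (X ⟶ Y)) :
    deviation ((((SimplicialObject.whiskering A B).obj F).map : (X ⟶ Y) → _)) a = 0 := by
  ext Δ
  have h := hF.deviation_map fun i => (a i).app Δ
  simp only [deviation, NatTrans.app_sum, NatTrans.app_zsmul] at h ⊢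
  refine Eq.trans ?_ h
  refine Finset.sum_congr rfl fun S _ => congrArg _ ?_
  exact congrArg F.map (NatTrans.app_sum _ _ _)

/-- The bar construction resolves the cokernel. -/
lemma exists_extraDegeneracy {B : Type*} [Category* B] (F : A ⥤ B)
    (S : ShortComplex (SimplicialObject A))
    (hS : ∀ Δ, Nonempty (S.map ((evaluation SimplexCategoryᵒᵖ A).obj Δ)).Splitting)
    (Δ : SimplexCategoryᵒᵖ) :
    Nonempty (((SimplicialObject.Augmented.whiskering _ _).obj
      ((evaluation SimplexCategoryᵒᵖ B).obj Δ)).obj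
        (((SimplicialObject.Augmented.whiskering _ _).obj
          ((SimplicialObject.whiskering A B).obj F)).obj
            (barAug S.f S.g S.zero))).ExtraDegeneracy := by
  obtain ⟨σ⟩ := hS Δ
  have e := (barExtraDegeneracy ((evaluation SimplexCategoryᵒᵖ A).obj Δ) S.zero σ.r σ.s
    σ.s_g σ.f_r σ.id).map F
  -- Evaluating after applying F and applying F after evaluating differ by identity factors in the
  -- augmentation, so only the two identities involving the augmentation have to be transported.
  have h {X Y : B} (u v : X ⟶ Y) (huv : u = v) : u ≫ 𝟙 Y = (v ≫ 𝟙 Y) ≫ 𝟙 Y := by simp [huv]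
  have hε := h (F.map (((barAug S.f S.g S.zero).hom.app (op ⦋0⦌)).app Δ ≫ 𝟙 _))
    (F.map (((barAug S.f S.g S.zero).hom.app (op ⦋0⦌)).app Δ))
    (congrArg F.map (Category.comp_id _))
  exact ⟨{ s' := e.s', s := e.s
           s'_comp_ε := (congrArg (e.s' ≫ ·) hε.symm).trans e.s'_comp_ε
           s₀_comp_δ₁ := e.s₀_comp_δ₁.trans (congrArg (· ≫ e.s') hε)
           s_comp_δ₀ := e.s_comp_δ₀
           s_comp_δ := e.s_comp_δ, s_comp_σ := e.s_comp_σ }⟩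

/-- The value of an additive invariant at `F(R)`, for a degreewise split short exact sequence
`P ⟶ Q ⟶ R` of simplicial objects, depends only on `P` and `Q`. -/
lemma val_map_cokernel_congr {F : A ⥤ B} {d : ℕ} (hF : FunctorDegreeLE F d) {K : Type*}
    [AddCommGroup K] (c : AdditiveInvariant (SimplicialObject B) K)
    {P Q R R' : SimplicialObject A} {f f' : P ⟶ Q} {g : Q ⟶ R} {g' : Q ⟶ R'} (w : f ≫ g = 0)
    (w' : f' ≫ g' = 0)
    (h : ∀ Δ, Nonempty ((ShortComplex.mk f g w).map
      ((evaluation SimplexCategoryᵒᵖ A).obj Δ)).Splitting)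
    (h' : ∀ Δ, Nonempty ((ShortComplex.mk f' g' w').map
      ((evaluation SimplexCategoryᵒᵖ A).obj Δ)).Splitting)
    (hc : ∀ Δ, c.prop (((SimplicialObject.whiskering A B).obj F).obj (barObj P Q Δ))) :
    c.val (((SimplicialObject.whiskering A B).obj F).obj R) =
      c.val (((SimplicialObject.whiskering A B).obj F).obj R') := by
  let Φ := (SimplicialObject.whiskering A B).obj F
  let X := ((SimplicialObject.Augmented.whiskering _ _).obj Φ).obj (barAug f g w)
  let X' := ((SimplicialObject.Augmented.whiskering _ _).obj Φ).obj (barAug f' g' w')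
  have s := fun Δ => (exists_extraDegeneracy F (ShortComplex.mk f g w) h Δ).some
  have s' := fun Δ => (exists_extraDegeneracy F (ShortComplex.mk f' g' w') h' Δ).some
  -- F(R) is H₀ of F applied to the bar construction, that is, the cokernel of the first
  -- differential of the normalized complex. The bar construction is formed in simplicial objects,
  -- so this is an isomorphism of simplicial objects of `B`.
  have e : ((normalizedMooreComplex _).obj (mapBar Φ f)).opcycles 0 ≅ Φ.obj R :=
    (ChainComplex.isoHomologyι₀ _).symm ≪≫ normalizedHomologyIso (mapBar Φ f) 0 ≪≫
      homologyZeroIsoOfExtraDegeneracy X s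
  have e' : ((normalizedMooreComplex _).obj (mapBar Φ f')).opcycles 0 ≅ Φ.obj R' :=
    (ChainComplex.isoHomologyι₀ _).symm ≪≫ normalizedHomologyIso (mapBar Φ f') 0 ≪≫
      homologyZeroIsoOfExtraDegeneracy X' s'
  rw [← c.val_iso e, ← c.val_iso e']
  refine c.opcycles_congr (fun n => normalizedMapBarIso Φ f f' n) (d := d)
    (fun n hn => isZero_normalized_mapBar Φ (deviation_whiskering hF) f hn)
    (fun n => (isZero_homology_alt_of_extraDegeneracy X s n).of_iso (normalizedHomologyIso _ _))
    (fun n => (isZero_homology_alt_of_extraDegeneracy X' s' n).of_iso (normalizedHomologyIso _ _))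
    fun n => ?_
  have hr := congrArg (fun u => u.f n)
    (DoldKan.splitMonoInclusionOfMooreComplexMap (mapBar Φ f)).id
  -- The normalized term of degree `n` is a retract of F(Q ⊕ Pⁿ), to which the hypothesis applies.
  exact c.prop_retract _ _ hr (hc (op ⦋n⦌))

/-- Simplicial objects with projective terms, whose associated chain complex has bounded homology
in a given subcategory. -/
structure IsGood (A₀ : ObjectProperty A) (P : SimplicialObject A) : Prop where
  projective (Δ : SimplexCategoryᵒᵖ) : Projective (P.obj Δ)
  bdd : BddHomology A₀ ((alt A).obj P)

namespace IsGood

variable {A₀ : ObjectProperty A} (hA : IsWeakSerre A₀)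
include hA

lemma of_isZero {P : SimplicialObject A} (hP : IsZero P) : IsGood A₀ P where
  projective Δ := ⟨fun _ _ _ => ⟨0, ((Functor.isZero_iff _).1 hP Δ).eq_of_src _ _⟩⟩
  bdd := (simplicialEuler hA).prop_of_isZero hP

lemma of_iso {P Q : SimplicialObject A} (e : P ≅ Q) (hP : IsGood A₀ P) : IsGood A₀ Q where
  projective Δ := Projective.of_iso (e.app Δ) (hP.projective Δ)
  bdd := (simplicialEuler hA).prop_iso e hP.bdd

lemma biprod {P Q : SimplicialObject A} (hP : IsGood A₀ P) (hQ : IsGood A₀ Q) :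
    IsGood A₀ (P ⊞ Q) where
  projective Δ :=
    have := hP.projective Δ
    have := hQ.projective Δ
    have : PreservesBinaryBiproduct P Q ((evaluation SimplexCategoryᵒᵖ A).obj Δ) :=
      (preservesBinaryBiproducts_of_preservesBinaryProducts _).preserves
    Projective.of_iso (((evaluation SimplexCategoryᵒᵖ A).obj Δ).mapBiprod P Q).symm
      (inferInstanceAs (Projective (P.obj Δ ⊞ Q.obj Δ)))
  bdd := (simplicialEuler hA).prop_biprod hP.bdd hQ.bdd

lemma barObj {P Q : SimplicialObject A} (hP : IsGood A₀ P) (hQ : IsGood A₀ Q)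
    (Δ : SimplexCategoryᵒᵖ) : IsGood A₀ (barObj P Q Δ) :=
  hQ.biprod hA (prop_biproduct (IsGood A₀) (fun _ => of_isZero hA)
    (fun _ _ ⟨e⟩ => of_iso hA e) (fun _ _ h h' => h.biprod hA h') _ _ fun _ => hP)

end IsGood

/-- Additivity: if `0 ⟶ P ⟶ Q ⟶ R ⟶ 0` is exact, then `F(Q)` and `F(P ⊕ R)` have the same
invariant. -/
lemma val_map_shortExact {A₀ : ObjectProperty A} (hA : IsWeakSerre A₀) {F : A ⥤ B} {d : ℕ}
    (hF : FunctorDegreeLE F d) {K : Type*} [AddCommGroup K]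
    (c : AdditiveInvariant (SimplicialObject B) K)
    (hc : ∀ P, IsGood A₀ P → c.prop (((SimplicialObject.whiskering A B).obj F).obj P))
    {S : ShortComplex (SimplicialObject A)} (hS : S.ShortExact) (h₁ : IsGood A₀ S.X₁)
    (h₂ : IsGood A₀ S.X₂) (h₃ : IsGood A₀ S.X₃) :
    c.val (((SimplicialObject.whiskering A B).obj F).obj S.X₂) =
      c.val (((SimplicialObject.whiskering A B).obj F).obj (S.X₁ ⊞ S.X₃)) := by
  have h₁₂ := h₁.biprod hA h₂
  have h₁₃ := h₁.biprod hA h₃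
  have hsplit {T : ShortComplex (SimplicialObject A)} (hT : T.ShortExact) (hX : IsGood A₀ T.X₃)
      (Δ : SimplexCategoryᵒᵖ) :
      Nonempty (T.map ((evaluation SimplexCategoryᵒᵖ A).obj Δ)).Splitting := by
    have : Projective (T.map ((evaluation SimplexCategoryᵒᵖ A).obj Δ)).X₃ := hX.projective Δ
    exact ⟨(hT.map_of_exact ((evaluation SimplexCategoryᵒᵖ A).obj Δ)).splittingOfProjective⟩
  -- Both sequences start with `X₁ ⟶ X₁ ⊞ X₂`: the split embedding has cokernel `X₂`, the embedding
  -- through `S.f` into the second summand has cokernel `X₁ ⊞ X₃`.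
  exact val_map_cokernel_congr hF c _ _ (hsplit (AdditiveInvariant.biprod_shortExact S.X₁ S.X₂) h₂)
    (hsplit (map_inr_shortExact hS S.X₁) h₁₃) fun Δ => hc _ (h₁.barObj hA h₁₂ Δ)

end Core

/-! ### Quasi-isomorphisms and short exact sequences. -/

section QuasiIso

variable {A : Type u} [Category.{v} A] [Abelian A]

open HomologicalComplex HomologySequence Abelian in
lemma quasiIso_τ₁ {S₁ S₂ : ShortComplex (ChainComplex A ℕ)} (φ : S₁ ⟶ S₂) (hS₁ : S₁.ShortExact)
    (hS₂ : S₂.ShortExact) (h₂ : QuasiIso φ.τ₂) (h₃ : QuasiIso φ.τ₃) : QuasiIso φ.τ₁ := by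
  rw [quasiIso_iff]
  intro j
  rw [quasiIsoAt_iff_isIso_homologyMap]
  have hij : (ComplexShape.down ℕ).Rel (j + 1) j := rfl
  refine isIso_of_epi_of_isIso_of_isIso_of_mono
    (composableArrows₅_exact hS₁ (j + 1) j hij).δ₀ (composableArrows₅_exact hS₂ (j + 1) j hij).δ₀
    (ComposableArrows.δ₀Functor.map (mapComposableArrows₅ φ hS₁ hS₂ (j + 1) j hij)) ?_ ?_ ?_ ?_
  · exact inferInstanceAs (Epi (homologyMap φ.τ₂ (j + 1)))
  · exact inferInstanceAs (IsIso (homologyMap φ.τ₃ (j + 1)))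
  · exact inferInstanceAs (IsIso (homologyMap φ.τ₂ j))
  · exact inferInstanceAs (Mono (homologyMap φ.τ₃ j))

lemma quasiIso_of_shortExact {S : ShortComplex (ChainComplex A ℕ)} (hS : S.ShortExact)
    (h : S.X₁.Acyclic) : QuasiIso S.g := by
  have hT : (ShortComplex.mk (0 : 0 ⟶ S.X₂) (𝟙 S.X₂) zero_comp).ShortExact :=
    { exact := (ShortComplex.exact_iff_mono _ rfl).2 (inferInstanceAs (Mono (𝟙 S.X₂)))
      mono_f := ⟨fun _ _ _ => (isZero_zero _).eq_of_tgt _ _⟩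
      epi_g := inferInstanceAs (Epi (𝟙 S.X₂)) }
  let φ : ShortComplex.mk (0 : 0 ⟶ S.X₂) (𝟙 S.X₂) zero_comp ⟶ S :=
    { τ₁ := 0, τ₂ := 𝟙 _, τ₃ := S.g }
  refine HomologicalComplex.HomologySequence.quasiIso_τ₃ φ hT hS ?_
    (inferInstanceAs (QuasiIso (𝟙 S.X₂)))
  rw [quasiIso_iff]
  intro i
  rw [quasiIsoAt_iff_isIso_homologyMap]
  have h0 : IsZero (HomologicalComplex.homology (0 : ChainComplex A ℕ) i) :=
    (HomologicalComplex.homologyFunctor A _ i).map_isZero (isZero_zero _)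
  exact ⟨0, h0.eq_of_src _ _, (h i).isZero_homology.eq_of_src _ _⟩

lemma isIso_map_biprod_map {C D : Type*} [Category* C] [Category* D] [Preadditive C]
    [Preadditive D] [HasBinaryBiproducts C] (H : C ⥤ D) [H.Additive] {X X' Y Y' : C} (f : X ⟶ X')
    (g : Y ⟶ Y') [IsIso (H.map f)] [IsIso (H.map g)] : IsIso (H.map (biprod.map f g)) := by
  refine ⟨H.map biprod.fst ≫ inv (H.map f) ≫ H.map biprod.inl +
    H.map biprod.snd ≫ inv (H.map g) ≫ H.map biprod.inr, ?_, ?_⟩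
  · simp only [Preadditive.comp_add, ← Functor.map_comp_assoc, biprod.map_fst, biprod.map_snd]
    simp only [Functor.map_comp, Category.assoc, IsIso.hom_inv_id_assoc]
    simp only [← Functor.map_comp, ← Functor.map_add, biprod.total, CategoryTheory.Functor.map_id]
  · simp only [Preadditive.add_comp, Category.assoc, ← Functor.map_comp, biprod.inl_map,
      biprod.inr_map]
    simp only [Functor.map_comp, IsIso.inv_hom_id_assoc]
    simp only [← Functor.map_comp, ← Functor.map_add, biprod.total, CategoryTheory.Functor.map_id]

lemma quasiIso_biprod_map {X X' Y Y' : ChainComplex A ℕ} (f : X ⟶ X') (g : Y ⟶ Y') [QuasiIso f]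
    [QuasiIso g] : QuasiIso (biprod.map f g) := by
  rw [quasiIso_iff]
  intro i
  rw [quasiIsoAt_iff_isIso_homologyMap]
  let H := HomologicalComplex.homologyFunctor A (ComplexShape.down ℕ) i
  have : IsIso (H.map f) := inferInstanceAs (IsIso (HomologicalComplex.homologyMap f i))
  have : IsIso (H.map g) := inferInstanceAs (IsIso (HomologicalComplex.homologyMap g i))
  exact isIso_map_biprod_map H f g

lemma acyclic_kernel_of_quasiIso {X Y : ChainComplex A ℕ} (f : X ⟶ Y) [Epi f] (h : QuasiIso f) :
    (kernel f).Acyclic :=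
  (show (ShortComplex.mk (kernel.ι f) f (kernel.condition f)).ShortExact from
    { exact := ShortComplex.exact_kernel f }).acyclic_X₁ h

end QuasiIso

lemma projective_of_retract {C : Type*} [Category* C] {X Y : C} (i : X ⟶ Y) (r : Y ⟶ X)
    (h : i ≫ r = 𝟙 X)
    (hY : Projective Y) : Projective X where
  factors f e _ := ⟨i ≫ Projective.factorThru (r ≫ f) e, by
    rw [Category.assoc, Projective.factorThru_comp, reassoc_of% h]⟩

/-! ### Projective resolutions of short exact sequences of complexes. -/

section Resolutions

variable {A : Type u} [Category.{v} A] [Abelian A] [EnoughProjectives A]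

/-- In positive degree, lift `y` together with the zero element of the previous cycles; the lift has
zero differential, so it is itself a cycle. For `n = 0` the subtraction truncates and `X.d 0 0 = 0`,
so every element counts as a cycle, as it should. -/
lemma exists_cycle_lift (X : ChainComplex A ℕ) (n : ℕ) {Y : A} (y : Y ⟶ X.X n)
    (hy : y ≫ X.d n (n - 1) = 0) : ∃ (Y' : A) (t : Y' ⟶ Y) (_ : Epi t)
      (z : Y' ⟶ (resStage X n).Z), z ≫ (resStage X n).k ≫ (resStage X n).f = t ≫ y := by
  cases n with
  | zero =>
    obtain ⟨Y', t, ht, z, hz⟩ := surjective_up_to_refinements_of_epi (Projective.π (X.X 0)) y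
    exact ⟨Y', t, ht, z, ((congrArg (z ≫ ·) (Category.id_comp _)).trans hz.symm)⟩
  | succ n =>
    obtain ⟨Y', t, ht, z, hz, hz'⟩ := (resStage X n).exists_lift (0 : Y ⟶ _) y
      (by rw [zero_comp]; exact hy.symm)
    obtain ⟨x, hx⟩ := (resStage X n).exists_of_d z (by
      rw [ResStage.d, reassoc_of% hz, zero_comp, comp_zero])
    refine ⟨Y', t, ht, x, ?_⟩
    rw [← hz', ← hx, Category.assoc]
    rfl

/-- The boundary of an element of `X` is a cycle, and it lifts to a cycle of the resolution by
`exists_cycle_lift`. The next term covers the pairs formed by an element and such a lift. -/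
lemma epi_resStage_f (X : ChainComplex A ℕ) (n : ℕ) : Epi (resStage X n).f := by
  cases n with
  | zero => exact inferInstanceAs (Epi (Projective.π (X.X 0)))
  | succ n =>
    rw [epi_iff_surjective_up_to_refinements]
    intro Y y
    obtain ⟨Y', t, ht, x, hx⟩ := exists_cycle_lift X n (y ≫ X.d (n + 1) n) (by simp)
    obtain ⟨Y'', t', ht', z, -, hz⟩ := (resStage X n).exists_lift x (t ≫ y) (by
      rw [hx, Category.assoc])
    exact ⟨Y'', t' ≫ t, inferInstance, z, by rw [Category.assoc]; exact hz.symm⟩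

/-- Every complex has a projective resolution by a degreewise epimorphism. -/
lemma exists_epi_projective_resolution (X : ChainComplex A ℕ) :
    ∃ (P : ChainComplex A ℕ) (f : P ⟶ X), (∀ n, Projective (P.X n)) ∧ QuasiIso f ∧ Epi f := by
  let P : ChainComplex A ℕ := ChainComplex.of (fun n => (resStage X n).P)
    (fun n => (resStage X n).d) (fun n => (resStage X n).d_d)
  have hd (n : ℕ) : P.d (n + 1) n = (resStage X n).d := ChainComplex.of_d
    (fun n => (resStage X n).P) (fun n => (resStage X n).d) n
  let f : P ⟶ X :=
    { f := fun n => (resStage X n).f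
      comm' := by
        rintro i j (rfl : j + 1 = i)
        rw [hd]
        exact (resStage X j).d_f.symm }
  have hf (n : ℕ) : f.f n = (resStage X n).f := rfl
  refine ⟨P, f, fun n => (resStage X n).proj, ⟨fun n => ?_⟩,
    HomologicalComplex.epi_of_epi_f f (epi_resStage_f X)⟩
  rw [quasiIsoAt_iff_isIso_homologyMap]
  have hprev (n : ℕ) : (ComplexShape.down ℕ).prev n = n + 1 := by simp
  have hnext (n : ℕ) : (ComplexShape.down ℕ).next n = n - 1 := by
    cases n <;> simp
  have hcyc (n : ℕ) {Y : A} (x : Y ⟶ P.X n) (hx : x ≫ P.d n (n - 1) = 0) :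
      ∃ x' : Y ⟶ (resStage X n).Z, x' ≫ (resStage X n).k = x := by
    cases n with
    | zero => exact ⟨x, Category.comp_id _⟩
    | succ n =>
      rw [Nat.add_sub_cancel, hd] at hx
      exact (resStage X n).exists_of_d x hx
  have hk (n : ℕ) : (resStage X n).k ≫ P.d n (n - 1) = 0 := by
    cases n with
    | zero => rw [P.shape _ _ (by simp)]; exact comp_zero
    | succ n => exact (congrArg ((resStage X (n + 1)).k ≫ ·) (hd n)).trans (resStage X n).k_d
  have h1 : Mono (HomologicalComplex.homologyMap f n) := by
    rw [HomologicalComplex.mono_homologyMap_iff_up_to_refinements f (n + 1) n _ (hprev n) (hnext n)]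
    intro Y x hx y hy
    obtain ⟨x, rfl⟩ := hcyc n x hx
    obtain ⟨Y', t, ht, z, hz, -⟩ := (resStage X n).exists_lift x y (by simpa [hf] using hy)
    have key : t ≫ x ≫ (resStage X n).k = z ≫ (resStage X n).d := by
      rw [ResStage.d, reassoc_of% hz]
    exact ⟨Y', t, ht, z, key.trans (congrArg (z ≫ ·) (hd n).symm)⟩
  have h2 : Epi (HomologicalComplex.homologyMap f n) := by
    rw [HomologicalComplex.epi_homologyMap_iff_up_to_refinements f (n + 1) n _ (hprev n) (hnext n)]
    intro Y y hy
    obtain ⟨Y', t, ht, z, hz⟩ := exists_cycle_lift X n y hy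
    refine ⟨Y', t, ht, z ≫ (resStage X n).k, ?_, 0, ?_⟩
    · exact (Category.assoc _ _ _).trans ((congrArg (z ≫ ·) (hk n)).trans comp_zero)
    · rw [zero_comp, add_zero, ← hz]
      exact (Category.assoc _ _ _).symm
  exact isIso_of_mono_of_epi _

/-- A short exact sequence of complexes is resolved by one of complexes of projectives. -/
lemma exists_projective_resolution_shortExact {S : ShortComplex (ChainComplex A ℕ)}
    (hS : S.ShortExact) : ∃ (T : ShortComplex (ChainComplex A ℕ)) (φ : T ⟶ S), T.ShortExact ∧
      (∀ n, Projective (T.X₁.X n)) ∧ (∀ n, Projective (T.X₂.X n)) ∧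
      (∀ n, Projective (T.X₃.X n)) ∧ QuasiIso φ.τ₁ ∧ QuasiIso φ.τ₂ ∧ QuasiIso φ.τ₃ := by
  have := hS.epi_g
  have := hS.mono_f
  obtain ⟨R, f, hR, hf, hf'⟩ := exists_epi_projective_resolution S.X₃
  obtain ⟨Q, q, hQ, hq, hq'⟩ := exists_epi_projective_resolution (pullback S.g f)
  -- The epimorphism `f` and its base change have the same kernel, which is acyclic.
  have hfst : QuasiIso (pullback.fst S.g f) := by
    have hN := acyclic_kernel_of_quasiIso f hf
    let i : kernel f ⟶ pullback S.g f := pullback.lift 0 (kernel.ι f) (by simp)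
    have hi₁ : i ≫ pullback.fst S.g f = 0 := pullback.lift_fst _ _ _
    have hi₂ : i ≫ pullback.snd S.g f = kernel.ι f := pullback.lift_snd _ _ _
    refine quasiIso_of_shortExact (S := ShortComplex.mk i (pullback.fst S.g f) hi₁) ?_ hN
    have : Mono i := mono_of_mono_fac hi₂
    refine { exact := ?_, mono_f := this, epi_g := inferInstanceAs (Epi (pullback.fst S.g f)) }
    refine ShortComplex.exact_of_f_is_kernel _ (KernelFork.IsLimit.ofι' _ _ fun {Y} k hk => ?_)
    have hk' : k ≫ pullback.fst S.g f = 0 := hk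
    refine ⟨kernel.lift f (k ≫ pullback.snd S.g f) ?_, ?_⟩
    · rw [Category.assoc, ← pullback.condition, reassoc_of% hk', zero_comp]
    · apply pullback.hom_ext
      · rw [Category.assoc, hi₁, comp_zero, hk']
      · rw [Category.assoc, hi₂, kernel.lift_ι]
  let r : Q ⟶ R := q ≫ pullback.snd S.g f
  -- This is where `q` must be an epimorphism and not merely a quasi-isomorphism: the kernel of `r`
  -- can then serve as the resolution of `S.X₁`, by the five lemma.
  have hr : Epi r := epi_comp _ _
  have hT : (ShortComplex.mk (kernel.ι r) r (kernel.condition r)).ShortExact :=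
    { exact := ShortComplex.exact_kernel r }
  have w : r ≫ f = (q ≫ pullback.fst S.g f) ≫ S.g := by simp [r, pullback.condition]
  let φ : ShortComplex.mk (kernel.ι r) r (kernel.condition r) ⟶ S :=
    { τ₁ := hS.exact.lift (kernel.ι r ≫ q ≫ pullback.fst S.g f) (by
        have := congrArg (kernel.ι r ≫ ·) w
        simpa using this.symm)
      τ₂ := q ≫ pullback.fst S.g f
      τ₃ := f
      comm₁₂ := hS.exact.lift_f _ _
      comm₂₃ := w.symm }
  have h₂ : QuasiIso φ.τ₂ := inferInstanceAs (QuasiIso (q ≫ pullback.fst S.g f))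
  refine ⟨_, φ, hT, fun n => ?_, hQ, hR, quasiIso_τ₁ φ hT hS h₂ hf, h₂, hf⟩
  -- As the terms of `R` are projective, the sequence splits in each degree, and the kernel is a
  -- retract of a term of `Q`.
  have hTn := hT.map_of_exact (HomologicalComplex.eval A _ n)
  have : Projective ((ShortComplex.mk (kernel.ι r) r (kernel.condition r)).map
    (HomologicalComplex.eval A _ n)).X₃ := hR n
  exact projective_of_retract _ _ hTn.splittingOfProjective.f_r (hQ n)

end Resolutions

/-! ### The Euler characteristic of the derived functor. -/

section DerivedEuler

variable {A : Type u} [Category.{v} A] [Abelian A] [EnoughProjectives A]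
  {B : Type u'} [Category.{v'} B] [Abelian B]

/-- Each resolution lifts through the other, and the composites are identities by uniqueness of
lifts. It allows LF to be computed from any simplicial projective resolution in place of the chosen
one. -/
lemma nonempty_resObj_iso {X : ChainComplex A ℕ} {P : SimplicialObject A}
    (hP : ∀ n, Projective (P.obj (op ⦋n⦌))) (α : (alt A).obj P ⟶ X) [QuasiIso α] :
    Nonempty (resObj ((HomotopyCategory.quotient A _).obj X) ≅
      (CategoryTheory.Quotient.functor (simplicialHomotopic A)).obj P) := by
  let R := simplicialResolution X
  have := R.quasiIso
  let q := HomotopyCategory.quotient A (ComplexShape.down ℕ)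
  obtain ⟨a, ha⟩ := (lift_bijective (P := (alt A).obj P) hP R.α).2 (q.map α)
  obtain ⟨b, hb⟩ := (lift_bijective (P := (alt A).obj R.P) R.projective α).2 (q.map R.α)
  dsimp only at ha hb
  refine ⟨(HoSimp.chain A).preimageIso ⟨b, a, ?_, ?_⟩⟩
  · refine (lift_bijective (P := (alt A).obj R.P) R.projective R.α).1 ?_
    exact (Category.assoc _ _ _).trans ((congrArg (b ≫ ·) ha).trans
      (hb.trans (Category.id_comp _).symm))
  · refine (lift_bijective (P := (alt A).obj P) hP α).1 ?_
    exact (Category.assoc _ _ _).trans ((congrArg (a ≫ ·) hb).trans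
      (ha.trans (Category.id_comp _).symm))

/-- The simplicial object `F(P)`, for the chosen simplicial resolution `P` of a complex. -/
abbrev derivedObj (F : A ⥤ B) (X : ChainComplex A ℕ) : SimplicialObject B :=
  ((SimplicialObject.whiskering A B).obj F).obj (simplicialResolution X).P

lemma nonempty_homology_derivedObj_iso (F : A ⥤ B) {X : ChainComplex A ℕ} {P : SimplicialObject A}
    (hP : ∀ n, Projective (P.obj (op ⦋n⦌))) (α : (alt A).obj P ⟶ X) [QuasiIso α] (i : ℕ) :
    Nonempty (((alt B).obj (derivedObj F X)).homology i ≅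
      ((alt B).obj (((SimplicialObject.whiskering A B).obj F).obj P)).homology i) := by
  obtain ⟨e⟩ := nonempty_resObj_iso hP α
  let e' : homologyObj ((HomotopyCategory.quotient B _).obj ((alt B).obj (derivedObj F X))) i ≅
      homologyObj ((HomotopyCategory.quotient B _).obj
        ((alt B).obj (((SimplicialObject.whiskering A B).obj F).obj P))) i :=
    (HoSimp.map F ⋙ HoSimp.chain B ⋙ HomotopyCategory.homologyFunctor B _ i).mapIso e
  exact ⟨(homologyObjIso _ i).symm ≪≫ e' ≪≫ homologyObjIso _ i⟩

/-- The inverse of the Dold-Kan equivalence. -/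
abbrev doldKanInverse (A : Type u) [Category.{v} A] [Abelian A] :
    ChainComplex A ℕ ⥤ SimplicialObject A :=
  (Abelian.DoldKan.equivalence (A := A)).inverse

lemma exists_quasiIso_alt_doldKanInverse {A : Type u} [Category.{v} A] [Abelian A]
    (K : ChainComplex A ℕ) : ∃ α : (alt A).obj ((doldKanInverse A).obj K) ⟶ K, QuasiIso α := by
  let e := Abelian.DoldKan.equivalence (A := A)
  let P := (doldKanInverse A).obj K
  let c : (nrm A).obj P ⟶ K := e.counit.app K
  have hc : IsIso c := inferInstanceAs (IsIso (e.counit.app K))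
  have hr : QuasiIso (ret P) :=
    (AlgebraicTopology.DoldKan.homotopyEquivNormalizedMooreComplexAlternatingFaceMapComplex
      (Y := P)).symm.quasiIso_hom
  exact ⟨ret P ≫ c, inferInstance⟩

lemma projective_doldKanInverse {A : Type u} [Category.{v} A] [Abelian A] {K : ChainComplex A ℕ}
    (hK : ∀ n, Projective (K.X n)) (Δ : SimplexCategoryᵒᵖ) :
    Projective (((doldKanInverse A).obj K).obj Δ) :=
  projective_coproduct _ fun _ => hK _

lemma BddHomology.of_quasiIso {A : Type u} [Category.{v} A] [Abelian A] {A₀ : ObjectProperty A}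
    (hA : IsWeakSerre A₀) {X Y : ChainComplex A ℕ} (f : X ⟶ Y) [QuasiIso f]
    (hY : BddHomology A₀ Y) : BddHomology A₀ X :=
  of_iso hA (fun i => (asIso (HomologicalComplex.homologyMap f i)).symm) hY

variable {A₀ : ObjectProperty A} {B₀ : ObjectProperty B}

/-- The Euler characteristic of `LF(X)`. -/
def derivedEuler (F : A ⥤ B) (B₀ : ObjectProperty B) (X : ChainComplex A ℕ) : K0 B₀ :=
  euler B₀ ((alt B).obj (derivedObj F X))

lemma derivedEuler_eq (hB : IsWeakSerre B₀) (F : A ⥤ B) {X : ChainComplex A ℕ}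
    {P : SimplicialObject A} (hP : ∀ n, Projective (P.obj (op ⦋n⦌))) (α : (alt A).obj P ⟶ X)
    [QuasiIso α] : derivedEuler F B₀ X =
      (simplicialEuler hB).val (((SimplicialObject.whiskering A B).obj F).obj P) :=
  euler_congr hB fun i => (nonempty_homology_derivedObj_iso F hP α i).some

/-- The chosen resolution of `X`, followed by `f`, is also a resolution of `Y`. -/
lemma derivedEuler_of_quasiIso (hB : IsWeakSerre B₀) (F : A ⥤ B) {X Y : ChainComplex A ℕ}
    (f : X ⟶ Y) [QuasiIso f] : derivedEuler F B₀ X = derivedEuler F B₀ Y := by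
  have := (simplicialResolution X).quasiIso
  exact (derivedEuler_eq hB F (simplicialResolution X).projective
    ((simplicialResolution X).α ≫ f)).symm

/-- A simplicial object with projective terms resolves its own chain complex, so the finiteness
hypothesis on LF applies to that complex. -/
lemma IsGood.prop_whiskering (hA : IsWeakSerre A₀) (hB : IsWeakSerre B₀) {F : A ⥤ B}
    (hLF : ∀ X : KNonneg A, BoundedHomologyIn A₀ X →
      BoundedHomologyIn B₀ ((totalDerived F).obj X)) {P : SimplicialObject A}
    (hP : IsGood A₀ P) :
    (simplicialEuler hB).prop (((SimplicialObject.whiskering A B).obj F).obj P) := by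
  have h := (boundedHomologyIn_iff hB _).1 (hLF ((HomotopyCategory.quotient A _).obj
    ((alt A).obj P)) ((boundedHomologyIn_iff hA _).2 hP.bdd))
  exact BddHomology.of_iso hB (fun i => (nonempty_homology_derivedObj_iso F
    (fun n => hP.projective _) (𝟙 ((alt A).obj P)) i).some) h

lemma exists_quasiIso_alt_biprod {A : Type u} [Category.{v} A] [Abelian A]
    {P Q : SimplicialObject A} {X Y : ChainComplex A ℕ}
    (α : (alt A).obj P ⟶ X) (β : (alt A).obj Q ⟶ Y) [QuasiIso α] [QuasiIso β] :
    ∃ γ : (alt A).obj (P ⊞ Q) ⟶ X ⊞ Y, QuasiIso γ := by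
  have := quasiIso_biprod_map α β
  have : PreservesBinaryBiproduct P Q (alt A) :=
    (preservesBinaryBiproducts_of_preservesBiproducts _).preserves
  exact ⟨((alt A).mapBiprod P Q).hom ≫ biprod.map α β, inferInstance⟩

lemma exists_isGood_of_quasiIso {A : Type u} [Category.{v} A] [Abelian A]
    {A₀ : ObjectProperty A} (hA : IsWeakSerre A₀) {K X : ChainComplex A ℕ}
    (hK : ∀ n, Projective (K.X n)) (f : K ⟶ X) [QuasiIso f] (hX : BddHomology A₀ X) :
    IsGood A₀ ((doldKanInverse A).obj K) ∧
      ∃ α : (alt A).obj ((doldKanInverse A).obj K) ⟶ X, QuasiIso α := by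
  obtain ⟨α, hα⟩ := exists_quasiIso_alt_doldKanInverse K
  exact ⟨⟨projective_doldKanInverse hK, hX.of_quasiIso hA (α ≫ f)⟩, α ≫ f, inferInstance⟩

lemma exists_isGood_shortExact (hA : IsWeakSerre A₀) {S : ShortComplex (ChainComplex A ℕ)}
    (hS : S.ShortExact) (h₁ : BddHomology A₀ S.X₁) (h₂ : BddHomology A₀ S.X₂)
    (h₃ : BddHomology A₀ S.X₃) : ∃ T : ShortComplex (SimplicialObject A), T.ShortExact ∧
      (IsGood A₀ T.X₁ ∧ ∃ α : (alt A).obj T.X₁ ⟶ S.X₁, QuasiIso α) ∧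
      (IsGood A₀ T.X₂ ∧ ∃ α : (alt A).obj T.X₂ ⟶ S.X₂, QuasiIso α) ∧
      (IsGood A₀ T.X₃ ∧ ∃ α : (alt A).obj T.X₃ ⟶ S.X₃, QuasiIso α) := by
  obtain ⟨T, φ, hT, hP₁, hP₂, hP₃, q₁, q₂, q₃⟩ := exists_projective_resolution_shortExact hS
  have hΓ : (T.map (doldKanInverse A)).ShortExact := hT.map_of_exact _
  exact ⟨T.map (doldKanInverse A), hΓ, exists_isGood_of_quasiIso hA hP₁ φ.τ₁ h₁,
    exists_isGood_of_quasiIso hA hP₂ φ.τ₂ h₂, exists_isGood_of_quasiIso hA hP₃ φ.τ₃ h₃⟩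

lemma derivedEuler_shortExact (hA : IsWeakSerre A₀) (hB : IsWeakSerre B₀) {F : A ⥤ B} {d : ℕ}
    (hF : FunctorDegreeLE F d) (hLF : ∀ X : KNonneg A, BoundedHomologyIn A₀ X →
      BoundedHomologyIn B₀ ((totalDerived F).obj X)) {S : ShortComplex (ChainComplex A ℕ)}
    (hS : S.ShortExact) (h₁ : BddHomology A₀ S.X₁) (h₂ : BddHomology A₀ S.X₂)
    (h₃ : BddHomology A₀ S.X₃) :
    derivedEuler F B₀ S.X₂ = derivedEuler F B₀ (S.X₁ ⊞ S.X₃) := by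
  obtain ⟨T, hT, ⟨g₁, α₁, hα₁⟩, ⟨g₂, α₂, hα₂⟩, g₃, α₃, hα₃⟩ :=
    exists_isGood_shortExact hA hS h₁ h₂ h₃
  obtain ⟨γ, hγ⟩ := exists_quasiIso_alt_biprod α₁ α₃
  rw [derivedEuler_eq hB F (fun n => g₂.projective _) α₂,
    derivedEuler_eq hB F (fun n => (g₁.biprod hA g₃).projective _) γ]
  exact val_map_shortExact hA hF _ (fun P hP => hP.prop_whiskering hA hB hLF) hT g₁ g₂ g₃

end DerivedEuler

/-! ### Second cross effects and the degree of the induced map. -/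

section DegreeOfMap

variable {C : Type*} [Category* C] [Abelian C] {D : Type*} [Category* D] [Abelian D]

/-- The map `Ψ(X ⊞ Y) ⟶ Ψ(X) ⊞ Ψ(Y)`. -/
abbrev biprodComparison (Ψ : C ⥤ D) (X Y : C) : Ψ.obj (X ⊞ Y) ⟶ Ψ.obj X ⊞ Ψ.obj Y :=
  biprod.lift (Ψ.map biprod.fst) (Ψ.map biprod.snd)

/-- The second cross effect of `Ψ`, as a functor of the first variable. -/
def secondCrossEffect (Ψ : C ⥤ D) (Y : C) : C ⥤ D where
  obj X := kernel (biprodComparison Ψ X Y)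
  map a := kernel.map _ _ (Ψ.map (biprod.map a (𝟙 Y))) (biprod.map (Ψ.map a) (𝟙 _)) (by
    apply biprod.hom_ext <;> simp [← Functor.map_comp])
  map_id X := by
    rw [← cancel_mono (kernel.ι _)]
    have : biprod.map (𝟙 X) (𝟙 Y) = 𝟙 _ := by apply biprod.hom_ext <;> simp
    simp [this]
  map_comp {X X' X''} a b := by
    rw [← cancel_mono (kernel.ι _)]
    have : biprod.map (a ≫ b) (𝟙 Y) = biprod.map a (𝟙 Y) ≫ biprod.map b (𝟙 Y) := by
      apply biprod.hom_ext <;> simp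
    simp [this]

/-- The inclusion of the second cross effect. -/
def secondCrossEffectι (Ψ : C ⥤ D) (Y X : C) : (secondCrossEffect Ψ Y).obj X ⟶ Ψ.obj (X ⊞ Y) :=
  kernel.ι _

instance (Ψ : C ⥤ D) (Y X : C) : Mono (secondCrossEffectι Ψ Y X) :=
  inferInstanceAs (Mono (kernel.ι _))

lemma secondCrossEffect_map_ι (Ψ : C ⥤ D) (Y : C) {X X' : C} (a : X ⟶ X') :
    (secondCrossEffect Ψ Y).map a ≫ secondCrossEffectι Ψ Y X' =
      secondCrossEffectι Ψ Y X ≫ Ψ.map (biprod.map a (𝟙 Y)) :=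
  kernel.lift_ι _ _ _

lemma secondCrossEffectι_comparison (Ψ : C ⥤ D) (Y X : C) :
    secondCrossEffectι Ψ Y X ≫ biprodComparison Ψ X Y = 0 :=
  kernel.condition _

lemma secondCrossEffectι_fst (Ψ : C ⥤ D) (Y X : C) :
    secondCrossEffectι Ψ Y X ≫ Ψ.map biprod.fst = 0 := by
  have := congrArg (· ≫ biprod.fst) (secondCrossEffectι_comparison Ψ Y X)
  simpa using this

lemma secondCrossEffectι_snd (Ψ : C ⥤ D) (Y X : C) :
    secondCrossEffectι Ψ Y X ≫ Ψ.map biprod.snd = 0 := by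
  have := congrArg (· ≫ biprod.snd) (secondCrossEffectι_comparison Ψ Y X)
  simpa using this

lemma secondCrossEffectι_map_zero (Ψ : C ⥤ D) (Y X X' : C) :
    secondCrossEffectι Ψ Y X ≫ Ψ.map (biprod.map (0 : X ⟶ X') (𝟙 Y)) = 0 := by
  have : biprod.map (0 : X ⟶ X') (𝟙 Y) = biprod.snd ≫ biprod.inr := by
    apply biprod.hom_ext <;> simp
  rw [this, Functor.map_comp, ← Category.assoc, secondCrossEffectι_snd, zero_comp]

lemma secondCrossEffectι_map_left (Ψ : C ⥤ D) (Y : C) {X X' : C} (a : X ⟶ X') :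
    secondCrossEffectι Ψ Y X ≫ Ψ.map (biprod.map a (0 : Y ⟶ Y)) = 0 := by
  have : biprod.map a (0 : Y ⟶ Y) = biprod.fst ≫ a ≫ biprod.inl := by
    apply biprod.hom_ext <;> simp
  rw [this, Functor.map_comp, ← Category.assoc, secondCrossEffectι_fst, zero_comp]

lemma secondCrossEffect_shortExact (Ψ : C ⥤ D) (h0 : ∀ X Y : C, Ψ.map (0 : X ⟶ Y) = 0) (Y X : C) :
    (ShortComplex.mk _ _ (secondCrossEffectι_comparison Ψ Y X)).ShortExact := by
  have : IsSplitEpi (biprodComparison Ψ X Y) := ⟨⟨⟨biprod.desc (Ψ.map biprod.inl)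
    (Ψ.map biprod.inr), by
      apply biprod.hom_ext <;> apply biprod.hom_ext' <;> simp [← Functor.map_comp, h0]⟩⟩⟩
  exact { exact := ShortComplex.exact_kernel _, epi_g := inferInstance }

lemma secondCrossEffect_map_zero (Ψ : C ⥤ D) (Y X X' : C) :
    (secondCrossEffect Ψ Y).map (0 : X ⟶ X') = 0 := by
  rw [← cancel_mono (secondCrossEffectι Ψ Y X'), secondCrossEffect_map_ι,
    secondCrossEffectι_map_zero, zero_comp]

/-- On the cross effect, Ψ(a ⊕ 0) and Ψ(0 ⊕ 1) vanish. Hence Ψ(a ⊕ 1) agrees there with Ψ(a ⊕ 1) -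
Ψ(a ⊕ 0) - Ψ(0 ⊕ 1), which has lower degree in `a` by the definition of degree. -/
lemma secondCrossEffect_degree (Ψ : C ⥤ D) {d : ℕ}
    (h : ∀ X X' : C, MapDegreeLE (d + 2) (Ψ.map : (X ⟶ X') → _)) (Y X X' : C) :
    MapDegreeLE (d + 1) ((secondCrossEffect Ψ Y).map : (X ⟶ X') → _) := by
  let i : ((secondCrossEffect Ψ Y).obj X ⟶ (secondCrossEffect Ψ Y).obj X') →+
      ((secondCrossEffect Ψ Y).obj X ⟶ Ψ.obj (X' ⊞ Y)) :=
    Preadditive.rightComp _ (secondCrossEffectι Ψ Y X')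
  let u : (X ⟶ X') →+ (X ⊞ Y ⟶ X' ⊞ Y) :=
    AddMonoidHom.mk' (fun a => biprod.map a 0) fun a b => by apply biprod.hom_ext <;> simp
  refine MapDegreeLE.of_injective i (fun a b hab => (cancel_mono _).1 hab) ?_
  have key := (((h (X ⊞ Y) (X' ⊞ Y)).1 (biprod.map 0 (𝟙 Y))).comp_addMonoidHom u).addMonoidHom_comp
    (Preadditive.leftComp _ (secondCrossEffectι Ψ Y X))
  refine Eq.mp (congrArg _ (funext fun a => ?_)) key
  have hu : u a + biprod.map 0 (𝟙 Y) = biprod.map a (𝟙 Y) := by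
    apply biprod.hom_ext <;> simp [u]
  change secondCrossEffectι Ψ Y X ≫ (Ψ.map (u a + _) - Ψ.map (biprod.map a 0) - Ψ.map _) =
    (secondCrossEffect Ψ Y).map a ≫ secondCrossEffectι Ψ Y X'
  rw [Preadditive.comp_sub, Preadditive.comp_sub, secondCrossEffectι_map_zero,
    secondCrossEffectι_map_left, sub_zero, sub_zero, hu, secondCrossEffect_map_ι]

/-- If `Ψ` is of degree `≤ d + 1` on morphisms, then the map induced by `Ψ` on the values of
additive invariants is of degree `≤ d + 1`. -/
lemma mapDegreeLE_of_functor {K G : Type*} [AddCommGroup K] [AddCommGroup G]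
    (c : AdditiveInvariant D K) (good : C → Prop) (χ : C → G)
    (hgood : ∀ X Y, good X → good Y → good (X ⊞ Y))
    (hχ : ∀ X Y, good X → good Y → χ (X ⊞ Y) = χ X + χ Y)
    (hsurj : ∀ x, ∃ X, good X ∧ χ X = x) (d : ℕ) (Ψ : C ⥤ D)
    (h0 : ∀ X Y : C, Ψ.map (0 : X ⟶ Y) = 0)
    (hΨ : ∀ X X' : C, MapDegreeLE (d + 1) (Ψ.map : (X ⟶ X') → _))
    (hprop : ∀ X, good X → c.prop (Ψ.obj X)) (f : G → K)
    (hf : ∀ X, good X → c.val (Ψ.obj X) = f (χ X)) : MapDegreeLE (d + 1) f := by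
  induction d generalizing Ψ f with
  | zero =>
    intro x y
    obtain ⟨X, hX, rfl⟩ := hsurj x
    obtain ⟨Y, hY, rfl⟩ := hsurj y
    have : Ψ.Additive := ⟨fun {X Y} a b => hΨ X Y a b⟩
    have : PreservesBinaryBiproduct X Y Ψ :=
      (preservesBinaryBiproducts_of_preservesBiproducts Ψ).preserves
    rw [← hχ X Y hX hY, ← hf _ (hgood X Y hX hY), ← hf X hX, ← hf Y hY,
      c.val_iso (Ψ.mapBiprod X Y), c.val_biprod (hprop X hX) (hprop Y hY)]
  | succ d ih =>
    -- For y = χ(Y), the decomposition of Ψ(X ⊕ Y) into Ψ(X), Ψ(Y) and the cross effect shows that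
    -- the latter induces f(x + y) - f(x) - f(y), so the induction hypothesis applies to it.
    have key (y : G) : MapDegreeLE (d + 1) fun x => f (x + y) - f x - f y := by
      obtain ⟨Y, hY, rfl⟩ := hsurj y
      have hS (X : C) := secondCrossEffect_shortExact Ψ h0 Y X
      have hp (X : C) (hX : good X) : c.prop ((secondCrossEffect Ψ Y).obj X) :=
        c.prop₁ (hS X) (hprop _ (hgood X Y hX hY)) (c.prop_biprod (hprop X hX) (hprop Y hY))
      refine ih (secondCrossEffect Ψ Y) (secondCrossEffect_map_zero Ψ Y)
        (secondCrossEffect_degree Ψ hΨ Y) hp _ fun X hX => ?_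
      have := c.val_add (hS X) (hp X hX) (hprop _ (hgood X Y hX hY))
        (c.prop_biprod (hprop X hX) (hprop Y hY))
      dsimp only at this
      rw [c.val_biprod (hprop X hX) (hprop Y hY), hf _ (hgood X Y hX hY), hf X hX, hf Y hY,
        hχ X Y hX hY] at this
      rw [this]
      abel
    refine ⟨key, fun x => Eq.mp (congrArg _ (funext fun y => ?_)) (key x)⟩
    rw [add_comm y x]
    abel

end DegreeOfMap

/-! ### Complexes concentrated in one degree, and truncations. -/

section Concentrated

variable {A : Type u} [Category.{v} A] [Abelian A]

/-- The complex with a single nonzero term `a`, in degree `n`. -/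
abbrev singleComplex (n : ℕ) (a : A) : ChainComplex A ℕ :=
  (HomologicalComplex.single A (ComplexShape.down ℕ) n).obj a

lemma isIso_homologyι_of_isZero (T : ChainComplex A ℕ) (n : ℕ) (h : ∀ i < n, IsZero (T.X i)) :
    IsIso (T.homologyι n) := by
  refine T.isIso_homologyι n _ rfl ?_
  cases n with
  | zero => exact T.shape _ _ (by simp)
  | succ n =>
    have : IsZero (T.X ((ComplexShape.down ℕ).next (n + 1))) := by
      rw [ChainComplex.next_nat_succ]
      exact h n (by omega)
    exact this.eq_of_tgt _ _

/-- As `T` has no terms below `n`, its homology in degree `n` is the whole cokernel of the incoming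
differential, and the projection to this cokernel is the quasi-isomorphism. -/
lemma exists_quasiIso_single (T : ChainComplex A ℕ) (n : ℕ) (h : ∀ i < n, IsZero (T.X i))
    (h' : ∀ i, i ≠ n → IsZero (T.homology i)) :
    ∃ f : T ⟶ singleComplex n (T.opcycles n), QuasiIso f := by
  let a := T.opcycles n
  let f : T ⟶ singleComplex n a :=
    HomologicalComplex.mkHomToSingle (T.pOpcycles n) fun i _ => T.d_pOpcycles i n
  refine ⟨f, ?_⟩
  rw [quasiIso_iff]
  intro i
  rw [quasiIsoAt_iff_isIso_homologyMap]
  by_cases hi : i = n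
  · subst hi
    have h1 := isIso_homologyι_of_isZero T i h
    have h2 := isIso_homologyι_of_isZero (singleComplex i a) i fun j hj =>
      HomologicalComplex.isZero_single_obj_X _ _ _ _ hj.ne
    have h3 : HomologicalComplex.opcyclesMap f i =
        (HomologicalComplex.singleObjOpcyclesSelfIso _ i a).hom := by
      rw [← cancel_epi (T.pOpcycles i), HomologicalComplex.p_opcyclesMap,
        HomologicalComplex.mkHomToSingle_f, HomologicalComplex.singleObjOpcyclesSelfIso_hom,
        Category.assoc]
    have h4 : IsIso (HomologicalComplex.homologyMap f i ≫ (singleComplex i a).homologyι i) := by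
      rw [HomologicalComplex.homologyι_naturality, h3]
      infer_instance
    exact IsIso.of_isIso_comp_right _ ((singleComplex i a).homologyι i)
  · exact ⟨0, (h' i hi).eq_of_src _ _,
      (HomologicalComplex.isZero_single_obj_homology _ _ _ _ hi).eq_of_src _ _⟩

/-- The embedding of the degrees `≥ n`. -/
def truncEmbedding (n : ℕ) : (ComplexShape.down ℕ).Embedding (ComplexShape.down ℕ) :=
  ComplexShape.embeddingDown'Add 1 n

instance (n : ℕ) : (truncEmbedding n).IsTruncLE :=
  inferInstanceAs (ComplexShape.embeddingDown'Add 1 n).IsTruncLE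

lemma truncEmbedding_f (n i : ℕ) : (truncEmbedding n).f i = i + n := rfl

/-- A complex whose homology vanishes in degrees `> n` is an extension of a complex whose
homology vanishes in degrees `≥ n` by one which is concentrated in degree `n`. -/
lemma exists_truncation (X : ChainComplex A ℕ) (n : ℕ)
    (hX : ∀ i, n + 1 ≤ i → IsZero (X.homology i)) :
    ∃ S : ShortComplex (ChainComplex A ℕ), S.ShortExact ∧ S.X₂ = X ∧
      (∃ (a : A) (f : S.X₁ ⟶ singleComplex n a), QuasiIso f) ∧
      (∀ i, n ≤ i → IsZero (S.X₃.homology i)) ∧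
      ∀ i, i < n → Nonempty (X.homology i ≅ S.X₃.homology i) := by
  -- In homological grading, `truncLE` along this embedding is the subcomplex that retains the
  -- homology in degrees ≥ n; the quotient retains the lower degrees.
  let e := truncEmbedding n
  have hf (i : ℕ) (hi : i < n) (j : ℕ) : e.f j ≠ i := by
    rw [truncEmbedding_f]; omega
  have hS := X.shortComplexTruncLE_shortExact e
  have hq (j : ℕ) (hj : n ≤ j) : QuasiIsoAt (X.ιTruncLE e) j :=
    X.quasiIsoAt_ιTruncLE e (j := j - n) (by rw [truncEmbedding_f]; omega)
  have hi (j : ℕ) (hj : n ≤ j) : X.homology j ≅ (X.truncLE e).homology j :=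
    have := hq j hj
    (asIso (HomologicalComplex.homologyMap (X.ιTruncLE e) j)).symm
  refine ⟨X.shortComplexTruncLE e, hS, rfl, ⟨_, exists_quasiIso_single (X.truncLE e) n
    (fun i hi => (X.truncLE e).isZero_X_of_isStrictlySupported e i (hf i hi)) fun i hin => ?_⟩,
    fun i hi => ?_, fun i hi => ?_⟩
  · obtain h | h := lt_or_gt_of_ne hin
    · exact ((X.truncLE e).exactAt_of_isSupported e i (hf i h)).isZero_homology
    · exact (hX i h).of_iso (hi i h.le).symm
  · have := (X.shortComplexTruncLE_X₃_isSupportedOutside e).exactAt (i - n)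
    rw [truncEmbedding_f, Nat.sub_add_cancel hi] at this
    exact this.isZero_homology
  · have := X.isIso_homologyMap_shortComplexTruncLE_g e i (hf i hi)
    exact ⟨@asIso _ _ _ _ _ this⟩

lemma shortExact_of_isIso_f {S : ShortComplex A} [IsIso S.f] (h : IsZero S.X₃) : S.ShortExact where
  exact := (S.exact_iff_epi (h.eq_of_tgt _ _)).2 inferInstance
  epi_g := ⟨fun _ _ _ => h.eq_of_src _ _⟩

lemma shortExact_of_isIso_g {S : ShortComplex A} [IsIso S.g] (h : IsZero S.X₁) : S.ShortExact where
  exact := (S.exact_iff_mono (h.eq_of_src _ _)).2 inferInstance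
  mono_f := ⟨fun _ _ _ => h.eq_of_tgt _ _⟩

/-- The complexes with a single term `a` in degrees `n` and `n + 1` are the ends of a short exact
sequence with acyclic middle term. -/
lemma exists_double_shortExact (n : ℕ) (a : A) : ∃ (E : ChainComplex A ℕ)
    (f : singleComplex n a ⟶ E) (g : E ⟶ singleComplex (n + 1) a) (w : f ≫ g = 0),
    (ShortComplex.mk f g w).ShortExact ∧ E.Acyclic := by
  have hr : (ComplexShape.down ℕ).Rel (n + 1) n := rfl
  have hn : n + 1 ≠ n := by omega
  let E := HomologicalComplex.double (𝟙 a) hr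
  let i₀ : E.X (n + 1) ≅ a := HomologicalComplex.doubleXIso₀ (𝟙 a) hr
  let i₁ : E.X n ≅ a := HomologicalComplex.doubleXIso₁ (𝟙 a) hr hn
  let f : singleComplex n a ⟶ E := HomologicalComplex.mkHomFromSingle i₁.inv fun k _ => by
    rw [HomologicalComplex.double_d_eq_zero₀ _ _ _ _ (by omega), comp_zero]
  let g : E ⟶ singleComplex (n + 1) a := HomologicalComplex.mkHomToSingle i₀.hom fun k _ => by
    rw [HomologicalComplex.double_d_eq_zero₁ _ _ _ _ (by omega), zero_comp]
  have hz₁ (k : ℕ) (hk : k ≠ n) : IsZero ((singleComplex n a).X k) :=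
    HomologicalComplex.isZero_single_obj_X _ _ _ _ hk
  have hz₃ (k : ℕ) (hk : k ≠ n + 1) : IsZero ((singleComplex (n + 1) a).X k) :=
    HomologicalComplex.isZero_single_obj_X _ _ _ _ hk
  have w : f ≫ g = 0 := by
    refine HomologicalComplex.hom_ext _ _ fun k => ?_
    by_cases hk : k = n
    · exact (hz₃ k (by omega)).eq_of_tgt _ _
    · exact (hz₁ k hk).eq_of_src _ _
  have hfn : IsIso (f.f n) := by
    rw [HomologicalComplex.mkHomFromSingle_f]
    infer_instance
  have hgn : IsIso (g.f (n + 1)) := by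
    rw [HomologicalComplex.mkHomToSingle_f]
    infer_instance
  refine ⟨E, f, g, w, HomologicalComplex.shortExact_of_degreewise_shortExact _ fun k => ?_,
    fun k => ?_⟩
  · by_cases hk : k = n
    · subst hk
      have : IsIso ((ShortComplex.mk f g w).map (HomologicalComplex.eval A _ k)).f := hfn
      exact shortExact_of_isIso_f (hz₃ k (by omega))
    · have : IsIso ((ShortComplex.mk f g w).map (HomologicalComplex.eval A _ k)).g := by
        by_cases hk' : k = n + 1
        · subst hk'
          exact hgn
        · exact ⟨0, (HomologicalComplex.isZero_double_X (𝟙 a) hr k hk' hk).eq_of_src _ _,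
            (hz₃ k hk').eq_of_src _ _⟩
      exact shortExact_of_isIso_g (hz₁ k hk)
  · have hd : IsIso (E.d (n + 1) n) := by
      rw [HomologicalComplex.double_d _ _ hn]
      infer_instance
    by_cases hk : k = n
    · subst hk
      rw [E.exactAt_iff' (k + 1) k _ (by simp) rfl]
      refine (ShortComplex.exact_iff_epi _ ?_).2 (inferInstanceAs (Epi (E.d (k + 1) k)))
      exact HomologicalComplex.double_d_eq_zero₀ (𝟙 a) hr _ _ (by omega)
    · by_cases hk' : k = n + 1
      · subst hk'
        rw [E.exactAt_iff' _ (n + 1) n rfl (by simp)]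
        refine (ShortComplex.exact_iff_mono _ ?_).2 (inferInstanceAs (Mono (E.d (n + 1) n)))
        exact HomologicalComplex.double_d_eq_zero₁ (𝟙 a) hr _ _ (by omega)
      · exact ShortComplex.exact_of_isZero_X₂ _
          (HomologicalComplex.isZero_double_X (𝟙 a) hr k hk' hk)

end Concentrated

/-! ### Stable classes of complexes, and their comparison with K₀. -/

section ExactInvariants

variable {A : Type u} [Category.{v} A] [Abelian A] {A₀ : ObjectProperty A}

/-- Functions on complexes with bounded homology in `A₀` which are invariant under
quasi-isomorphisms and take the same value on an extension and on the split extension. -/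
structure IsExactInvariant {K : Type*} (A₀ : ObjectProperty A) (Φ : ChainComplex A ℕ → K) :
    Prop where
  quasiIso {X Y : ChainComplex A ℕ} (f : X ⟶ Y) (hf : QuasiIso f) : Φ X = Φ Y
  shortExact {S : ShortComplex (ChainComplex A ℕ)} (hS : S.ShortExact)
    (h₁ : BddHomology A₀ S.X₁) (h₂ : BddHomology A₀ S.X₂) (h₃ : BddHomology A₀ S.X₃) :
    Φ S.X₂ = Φ (S.X₁ ⊞ S.X₃)

namespace IsExactInvariant

variable {K : Type*} {Φ : ChainComplex A ℕ → K} (hΦ : IsExactInvariant A₀ Φ)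

include hΦ in
lemma congr_iso {X Y : ChainComplex A ℕ} (e : X ≅ Y) : Φ X = Φ Y :=
  hΦ.quasiIso e.hom inferInstance

/-- Complexes with bounded homology in `A₀`. -/
abbrev BddComplex (A₀ : ObjectProperty A) := {X : ChainComplex A ℕ // BddHomology A₀ X}

/-- Complexes are identified if `Φ` does not distinguish them after adding any complex. -/
def stableSetoid (A₀ : ObjectProperty A) (Φ : ChainComplex A ℕ → K) : Setoid (BddComplex A₀) where
  r X Y := ∀ W : BddComplex A₀, Φ (X.1 ⊞ W.1) = Φ (Y.1 ⊞ W.1)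
  iseqv :=
    { refl := fun _ _ => rfl
      symm := fun h W => (h W).symm
      trans := fun h h' W => (h W).trans (h' W) }

/-- The monoid of stable classes of complexes. -/
def StableClass (_ : IsWeakSerre A₀) (_ : IsExactInvariant A₀ Φ) := Quotient (stableSetoid A₀ Φ)

variable (hA : IsWeakSerre A₀)

/-- The class of a complex. -/
def stableClass (X : ChainComplex A ℕ) (hX : BddHomology A₀ X) : StableClass hA hΦ :=
  Quotient.mk (stableSetoid A₀ Φ) ⟨X, hX⟩

lemma stableClass_eq_of_forall {X Y : ChainComplex A ℕ} (hX : BddHomology A₀ X)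
    (hY : BddHomology A₀ Y) (h : ∀ W, BddHomology A₀ W → Φ (X ⊞ W) = Φ (Y ⊞ W)) :
    hΦ.stableClass hA X hX = hΦ.stableClass hA Y hY :=
  Quotient.sound fun W => h W.1 W.2

lemma bddHomology_biprod (hA : IsWeakSerre A₀) {X Y : ChainComplex A ℕ} (hX : BddHomology A₀ X)
    (hY : BddHomology A₀ Y) : BddHomology A₀ (X ⊞ Y) :=
  (eulerInvariant hA).prop_biprod hX hY

lemma stableClass_congr {X Y : ChainComplex A ℕ} (f : X ⟶ Y) (hf : QuasiIso f)
    (hX : BddHomology A₀ X) (hY : BddHomology A₀ Y) :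
    hΦ.stableClass hA X hX = hΦ.stableClass hA Y hY :=
  hΦ.stableClass_eq_of_forall hA _ _ fun W _ =>
    hΦ.quasiIso (biprod.map f (𝟙 W)) (quasiIso_biprod_map _ _)

instance : Zero (StableClass hA hΦ) :=
  ⟨hΦ.stableClass hA 0 ((eulerInvariant hA).prop_of_isZero (isZero_zero _))⟩

/-- The summands are replaced one at a time, the other one being absorbed each time into the test
complex `W`. -/
instance : Add (StableClass hA hΦ) where
  add := Quotient.map₂ (sa := stableSetoid A₀ Φ) (sb := stableSetoid A₀ Φ)
    (sc := stableSetoid A₀ Φ) (fun X Y => ⟨X.1 ⊞ Y.1, bddHomology_biprod hA X.2 Y.2⟩)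
    fun X X' hX Y Y' hY W => by
      dsimp only
      rw [hΦ.congr_iso (biprod.associator _ _ _), hX ⟨_, bddHomology_biprod hA Y.2 W.2⟩,
        ← hΦ.congr_iso (biprod.associator X'.1 Y.1 W.1),
        hΦ.congr_iso (biprod.mapIso (biprod.braiding X'.1 Y.1) (Iso.refl W.1)),
        hΦ.congr_iso (biprod.associator _ _ _), hY ⟨_, bddHomology_biprod hA X'.2 W.2⟩,
        ← hΦ.congr_iso (biprod.associator Y'.1 X'.1 W.1),
        hΦ.congr_iso (biprod.mapIso (biprod.braiding Y'.1 X'.1) (Iso.refl W.1))]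

lemma stableClass_surjective (x : StableClass hA hΦ) : ∃ X hX, x = hΦ.stableClass hA X hX := by
  obtain ⟨⟨X, hX⟩, rfl⟩ := Quotient.exists_rep x
  exact ⟨X, hX, rfl⟩

lemma stableClass_of_acyclic {X : ChainComplex A ℕ} (hX : X.Acyclic) (hX' : BddHomology A₀ X) :
    hΦ.stableClass hA X hX' = 0 := by
  refine hΦ.stableClass_congr hA (0 : X ⟶ 0) ?_ _ _
  rw [quasiIso_iff]
  intro i
  rw [quasiIsoAt_iff_isIso_homologyMap]
  have h0 : IsZero (HomologicalComplex.homology (0 : ChainComplex A ℕ) i) :=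
    (HomologicalComplex.homologyFunctor A _ i).map_isZero (isZero_zero _)
  exact ⟨0, (hX i).isZero_homology.eq_of_src _ _, h0.eq_of_src _ _⟩

instance : AddCommMonoid (StableClass hA hΦ) where
  add_assoc x y z := by
    obtain ⟨X, hX, rfl⟩ := hΦ.stableClass_surjective hA x
    obtain ⟨Y, hY, rfl⟩ := hΦ.stableClass_surjective hA y
    obtain ⟨Z, hZ, rfl⟩ := hΦ.stableClass_surjective hA z
    exact hΦ.stableClass_congr hA (biprod.associator X Y Z).hom inferInstance _ _
  zero_add x := by
    obtain ⟨X, hX, rfl⟩ := hΦ.stableClass_surjective hA x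
    exact hΦ.stableClass_congr hA (isoZeroBiprod (isZero_zero _)).inv inferInstance _ _
  add_zero x := by
    obtain ⟨X, hX, rfl⟩ := hΦ.stableClass_surjective hA x
    exact hΦ.stableClass_congr hA (isoBiprodZero (isZero_zero _)).inv inferInstance _ _
  add_comm x y := by
    obtain ⟨X, hX, rfl⟩ := hΦ.stableClass_surjective hA x
    obtain ⟨Y, hY, rfl⟩ := hΦ.stableClass_surjective hA y
    exact hΦ.stableClass_congr hA (biprod.braiding X Y).hom inferInstance _ _
  nsmul := nsmulRec

/-- Adding a test complex `W` to the last two terms of the extension gives an extension again, to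
which the invariance of Φ applies. This is why the equivalence relation quantifies over all `W`: Φ
itself is not additive. -/
lemma stableClass_shortExact {S : ShortComplex (ChainComplex A ℕ)} (hS : S.ShortExact)
    (h₁ : BddHomology A₀ S.X₁) (h₂ : BddHomology A₀ S.X₂) (h₃ : BddHomology A₀ S.X₃) :
    hΦ.stableClass hA S.X₂ h₂ = hΦ.stableClass hA S.X₁ h₁ + hΦ.stableClass hA S.X₃ h₃ := by
  refine (hΦ.stableClass_eq_of_forall hA _ (bddHomology_biprod hA h₁ h₃) fun W hW => ?_)
  have := hΦ.shortExact (map_inr_shortExact hS W) h₁ (bddHomology_biprod hA hW h₂)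
    (bddHomology_biprod hA hW h₃)
  rw [hΦ.congr_iso (biprod.braiding S.X₂ W), hΦ.congr_iso (biprod.associator _ _ _)]
  exact this.trans (hΦ.congr_iso (biprod.mapIso (Iso.refl _) (biprod.braiding W S.X₃)))

/-- The value of `Φ` on stable classes. -/
def stableValue : StableClass hA hΦ → K :=
  Quotient.lift (s := stableSetoid A₀ Φ) (fun X => Φ X.1) fun X Y h => by
    have h0 := h ⟨0, (eulerInvariant hA).prop_of_isZero (isZero_zero _)⟩
    exact (hΦ.congr_iso (isoBiprodZero (isZero_zero _))).trans
      (h0.trans (hΦ.congr_iso (isoBiprodZero (isZero_zero _))).symm)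

lemma bddHomology_single (hA : IsWeakSerre A₀) (n : ℕ) {a : A} (ha : A₀ a) :
    BddHomology A₀ (singleComplex n a) := by
  refine ⟨⟨n + 1, fun i hi => HomologicalComplex.isZero_single_obj_homology _ _ _ _ (by omega)⟩,
    fun i => ?_⟩
  by_cases h : i = n
  · subst h
    exact hA.of_iso (HomologicalComplex.singleObjHomologySelfIso _ _ _).symm ha
  · exact hA.of_isZero (HomologicalComplex.isZero_single_obj_homology _ _ _ _ h)

/-- The two complexes are the ends of an extension with acyclic middle term. The shift thus provides
inverses, so that K₀ can be mapped into the units although stable classes are only known to form a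
monoid. -/
lemma stableClass_single_add_succ (n : ℕ) {a : A} (ha : A₀ a) :
    hΦ.stableClass hA (singleComplex n a) (bddHomology_single hA n ha) +
      hΦ.stableClass hA (singleComplex (n + 1) a) (bddHomology_single hA (n + 1) ha) = 0 := by
  obtain ⟨E, f, g, w, hS, h₂⟩ := exists_double_shortExact n a
  have hb₂ := BddHomology.of_acyclic hA fun i => (h₂ i).isZero_homology
  rw [← hΦ.stableClass_of_acyclic hA h₂ hb₂]
  exact (hΦ.stableClass_shortExact hA hS _ _ _).symm

/-- The class of `a`, placed in degree `0`. -/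
def unitOfObj (a : A₀.FullSubcategory) : AddUnits (StableClass hA hΦ) where
  val := hΦ.stableClass hA (singleComplex 0 a.1) (bddHomology_single hA 0 a.2)
  neg := hΦ.stableClass hA (singleComplex 1 a.1) (bddHomology_single hA 1 a.2)
  val_neg := hΦ.stableClass_single_add_succ hA 0 a.2
  neg_val := (add_comm _ _).trans (hΦ.stableClass_single_add_succ hA 0 a.2)

/-- The homomorphism from `K₀` to stable classes given by complexes concentrated in degree `0`. -/
def k0ToUnits : K0 A₀ →+ AddUnits (StableClass hA hΦ) :=
  QuotientAddGroup.lift _ (FreeAbelianGroup.lift (hΦ.unitOfObj hA)) <| by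
    rw [AddSubgroup.closure_le]
    rintro _ ⟨S, hS, h₁, h₂, h₃, rfl⟩
    have hS' : (S.map (HomologicalComplex.single A (ComplexShape.down ℕ) 0)).ShortExact :=
      hS.map_of_exact _
    have key : hΦ.unitOfObj hA ⟨S.X₂, h₂⟩ =
        hΦ.unitOfObj hA ⟨S.X₁, h₁⟩ + hΦ.unitOfObj hA ⟨S.X₃, h₃⟩ :=
      AddUnits.ext (hΦ.stableClass_shortExact hA hS' _ _ _)
    rw [SetLike.mem_coe, AddMonoidHom.mem_ker, map_sub, map_sub, FreeAbelianGroup.lift_apply_of,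
      FreeAbelianGroup.lift_apply_of, FreeAbelianGroup.lift_apply_of, key]
    abel

lemma k0ToUnits_cls {a : A} (ha : A₀ a) (n : ℕ) :
    (hΦ.k0ToUnits hA ((-1 : ℤ) ^ n • cls A₀ a)).val =
      hΦ.stableClass hA (singleComplex n a) (bddHomology_single hA n ha) := by
  induction n with
  | zero =>
    rw [pow_zero, one_smul, cls_eq ha]
    exact congrArg AddUnits.val (FreeAbelianGroup.lift_apply_of (hΦ.unitOfObj hA) _)
  | succ n ih =>
    have h := hΦ.stableClass_single_add_succ hA n ha
    rw [← ih] at h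
    have h' : (-1 : ℤ) ^ (n + 1) • cls A₀ a = -((-1 : ℤ) ^ n • cls A₀ a) := by
      rw [pow_succ, mul_neg_one, neg_smul]
    rw [h', map_neg]
    exact AddUnits.neg_eq_of_add_eq_zero_right h

lemma euler_single (hA : IsWeakSerre A₀) (n : ℕ) (a : A) :
    euler A₀ (singleComplex n a) = (-1 : ℤ) ^ n • cls A₀ a := by
  refine (finsum_eq_single _ n fun i hi => ?_).trans ?_
  · rw [cls_of_isZero (HomologicalComplex.isZero_single_obj_homology _ _ _ _ hi), smul_zero]
  · rw [cls_iso hA (HomologicalComplex.singleObjHomologySelfIso _ _ _)]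

/-- Truncation peels off the top homology object as a complex concentrated in one degree, for which
`k0ToUnits_cls` gives the claim. Both sides are additive along the truncation sequence. -/
lemma k0ToUnits_euler (n : ℕ) (X : ChainComplex A ℕ) (hX : BddHomology A₀ X)
    (hn : ∀ i, n ≤ i → IsZero (X.homology i)) :
    (hΦ.k0ToUnits hA (euler A₀ X)).val = hΦ.stableClass hA X hX := by
  induction n generalizing X with
  | zero =>
    rw [hΦ.stableClass_of_acyclic hA fun i => by
      rw [HomologicalComplex.exactAt_iff_isZero_homology]; exact hn i (Nat.zero_le _),
      euler_eq_sum X 0 hn, Finset.sum_range_zero, map_zero]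
    rfl
  | succ n ih =>
    obtain ⟨S, hS, rfl, ⟨a, f, hf⟩, h₃, h₃'⟩ := exists_truncation X n hn
    have b₃ : BddHomology A₀ S.X₃ := ⟨⟨n, h₃⟩, fun i => by
      obtain h | h := lt_or_ge i n
      · exact hA.of_iso (h₃' i h).some (hX.2 i)
      · exact hA.of_isZero (h₃ i h)⟩
    have b₁ := BddHomology.of_shortExact₁ hS hA hX b₃
    have ha : A₀ a := hA.of_iso (asIso (HomologicalComplex.homologyMap f n) ≪≫
      HomologicalComplex.singleObjHomologySelfIso _ _ _) (b₁.2 n)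
    rw [euler_shortExact hS hA b₁ hX b₃, map_add, AddUnits.val_add, ih _ b₃ h₃,
      hΦ.stableClass_shortExact hA hS b₁ hX b₃,
      hΦ.stableClass_congr hA f hf b₁ (bddHomology_single hA n ha), ← hΦ.k0ToUnits_cls hA ha,
      euler_congr hA fun i => asIso (HomologicalComplex.homologyMap f i), euler_single hA]

include hΦ hA in
/-- The value of an exact invariant is determined by the Euler characteristic. -/
lemma eq_of_euler_eq {X Y : ChainComplex A ℕ} (hX : BddHomology A₀ X) (hY : BddHomology A₀ Y)
    (h : euler A₀ X = euler A₀ Y) : Φ X = Φ Y := by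
  obtain ⟨n, hn⟩ := hX.1
  obtain ⟨m, hm⟩ := hY.1
  have h' : hΦ.stableClass hA X hX = hΦ.stableClass hA Y hY := by
    rw [← hΦ.k0ToUnits_euler hA n X hX hn, ← hΦ.k0ToUnits_euler hA m Y hY hm, h]
  exact congrArg (hΦ.stableValue hA) h'

end IsExactInvariant

end ExactInvariants

/-! ### Surjectivity of the Euler characteristic, and the main theorem. -/

section MainTheorem

variable {A : Type u} [Category.{v} A] [Abelian A] {A₀ : ObjectProperty A}

/-- Every element of `K₀` is the Euler characteristic of a complex. -/
lemma exists_euler_eq (hA : IsWeakSerre A₀) (x : K0 A₀) :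
    ∃ X : ChainComplex A ℕ, BddHomology A₀ X ∧ euler A₀ X = x := by
  obtain ⟨x, rfl⟩ := QuotientAddGroup.mk_surjective x
  induction x using FreeAbelianGroup.induction_on with
  | zero =>
    exact ⟨0, (eulerInvariant hA).prop_of_isZero (isZero_zero _),
      (eulerInvariant hA).val_of_isZero (isZero_zero _)⟩
  | of a =>
    refine ⟨singleComplex 0 a.1, IsExactInvariant.bddHomology_single hA 0 a.2, ?_⟩
    rw [IsExactInvariant.euler_single hA, pow_zero, one_smul, cls_eq a.2]
    rfl
  | neg a =>
    refine ⟨singleComplex 1 a.1, IsExactInvariant.bddHomology_single hA 1 a.2, ?_⟩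
    rw [IsExactInvariant.euler_single hA, pow_one, neg_one_smul, cls_eq a.2]
    rfl
  | add x y hx hy =>
    obtain ⟨X, hX, hX'⟩ := hx
    obtain ⟨Y, hY, hY'⟩ := hy
    refine ⟨X ⊞ Y, (eulerInvariant hA).prop_biprod hX hY, ?_⟩
    exact ((eulerInvariant hA).val_biprod hX hY).trans (congrArg₂ (· + ·) hX' hY')

variable [EnoughProjectives A]

lemma exists_isGood_val_eq (hA : IsWeakSerre A₀) (x : K0 A₀) :
    ∃ P, IsGood A₀ P ∧ (simplicialEuler hA).val P = x := by
  obtain ⟨X, hX, rfl⟩ := exists_euler_eq hA x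
  let R := simplicialResolution X
  have := R.quasiIso
  exact ⟨R.P, ⟨fun Δ => R.projective Δ.unop.len, hX.of_quasiIso hA R.α⟩,
    euler_congr hA fun i => asIso (HomologicalComplex.homologyMap R.α i)⟩

variable {B : Type u'} [Category.{v'} B] [Abelian B] {B₀ : ObjectProperty B}

/-- The functor to which `mapDegreeLE_of_functor` applies is F acting degreewise on simplicial
objects. Those with projective terms and bounded homology in `A₀` are closed under biproducts,
realize every class in K₀, and compute LF without further resolution. -/
lemma mapDegreeLE_of_derivedEuler (hA : IsWeakSerre A₀) (hB : IsWeakSerre B₀) {F : A ⥤ B}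
    (hF₀ : ∀ Z : A, IsZero Z → IsZero (F.obj Z)) {d : ℕ} (hF : FunctorDegreeLE F (d + 1))
    (hLF : ∀ X : KNonneg A, BoundedHomologyIn A₀ X →
      BoundedHomologyIn B₀ ((totalDerived F).obj X)) {f : K0 A₀ → K0 B₀}
    (hf : ∀ X, BddHomology A₀ X → derivedEuler F B₀ X = f (euler A₀ X)) :
    MapDegreeLE (d + 1) f := by
  have h0 (P Q : SimplicialObject A) :
      ((SimplicialObject.whiskering A B).obj F).map (0 : P ⟶ Q) = 0 := by
    ext Δ
    exact map_zero_of_isZero hF₀ _ _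
  refine mapDegreeLE_of_functor (simplicialEuler hB) (IsGood A₀) (simplicialEuler hA).val
    (fun P Q hP hQ => hP.biprod hA hQ)
    (fun P Q hP hQ => (simplicialEuler hA).val_biprod hP.bdd hQ.bdd) (exists_isGood_val_eq hA) d
    ((SimplicialObject.whiskering A B).obj F) h0
    (fun P Q => mapDegreeLE_of_deviation (h0 P Q) (deviation_whiskering hF))
    (fun P hP => hP.prop_whiskering hA hB hLF) f fun P hP => ?_
  exact (derivedEuler_eq hB F (fun n => hP.projective _) (𝟙 ((alt A).obj P))).symm.trans
    (hf _ hP.bdd)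

end MainTheorem

end DoldPuppe

end

theorem theorem1 {A : Type u} [Category.{v} A] [Abelian A] [EnoughProjectives A]
    {B : Type u'} [Category.{v'} B] [Abelian B]
    (F : A ⥤ B) (hF₀ : ∀ Z : A, IsZero Z → IsZero (F.obj Z))
    (d : ℕ) (hd : 0 < d) (hF : DoldPuppe.FunctorDegreeLE F d)
    (A₀ : ObjectProperty A) (hA₀ : DoldPuppe.IsWeakSerre A₀)
    (B₀ : ObjectProperty B) (hB₀ : DoldPuppe.IsWeakSerre B₀)
    (hLF : ∀ X : DoldPuppe.KNonneg A, DoldPuppe.BoundedHomologyIn A₀ X →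
      DoldPuppe.BoundedHomologyIn B₀ ((DoldPuppe.totalDerived F).obj X)) :
    (∃! f : DoldPuppe.K0 A₀ → DoldPuppe.K0 B₀,
      ∀ (X : DoldPuppe.KNonneg A) (hX : DoldPuppe.BoundedHomologyIn A₀ X),
        DoldPuppe.eulerChar B₀ ((DoldPuppe.totalDerived F).obj X) (hLF X hX) =
          f (DoldPuppe.eulerChar A₀ X hX)) ∧
    ∀ f : DoldPuppe.K0 A₀ → DoldPuppe.K0 B₀,
      (∀ (X : DoldPuppe.KNonneg A) (hX : DoldPuppe.BoundedHomologyIn A₀ X),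
        DoldPuppe.eulerChar B₀ ((DoldPuppe.totalDerived F).obj X) (hLF X hX) =
          f (DoldPuppe.eulerChar A₀ X hX)) →
      DoldPuppe.MapDegreeLE d f := by
  have hΦ : DoldPuppe.IsExactInvariant A₀ (DoldPuppe.derivedEuler F B₀) :=
    { quasiIso := fun f _ => DoldPuppe.derivedEuler_of_quasiIso hB₀ F f
      shortExact := DoldPuppe.derivedEuler_shortExact hA₀ hB₀ hF hLF }
  -- Every object of the homotopy category is the image of a complex, so the defining property of
  -- `f` can be tested on complexes.
  have key (f : DoldPuppe.K0 A₀ → DoldPuppe.K0 B₀) :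
      (∀ (X : DoldPuppe.KNonneg A) (hX : DoldPuppe.BoundedHomologyIn A₀ X),
        DoldPuppe.eulerChar B₀ ((DoldPuppe.totalDerived F).obj X) (hLF X hX) =
          f (DoldPuppe.eulerChar A₀ X hX)) ↔
      ∀ X, DoldPuppe.BddHomology A₀ X →
        DoldPuppe.derivedEuler F B₀ X = f (DoldPuppe.euler A₀ X) := by
    constructor
    · intro h X hX
      have hX' := (DoldPuppe.boundedHomologyIn_iff hA₀
        ((HomotopyCategory.quotient A (ComplexShape.down ℕ)).obj X)).2 hX
      have := h _ hX'
      rwa [DoldPuppe.eulerChar_eq hB₀, DoldPuppe.eulerChar_eq hA₀] at this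
    · intro h X hX
      rw [DoldPuppe.eulerChar_eq hB₀, DoldPuppe.eulerChar_eq hA₀]
      exact h X.as ((DoldPuppe.boundedHomologyIn_iff hA₀ X).1 hX)
  -- A complex with prescribed Euler characteristic defines the value of `f`. Independence of this
  -- choice is `eq_of_euler_eq`, and the same surjectivity gives uniqueness.
  choose X hX hχ using DoldPuppe.exists_euler_eq hA₀
  refine ⟨⟨fun x => DoldPuppe.derivedEuler F B₀ (X x),
    (key fun x => DoldPuppe.derivedEuler F B₀ (X x)).2 fun Y hY =>
      hΦ.eq_of_euler_eq hA₀ hY (hX _) (hχ _).symm, fun f hf => ?_⟩, fun f hf => ?_⟩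
  · funext x
    rw [(key f).1 hf (X x) (hX x), hχ]
  · obtain ⟨d, rfl⟩ : ∃ e, d = e + 1 := ⟨d - 1, by omega⟩
    exact DoldPuppe.mapDegreeLE_of_derivedEuler hA₀ hB₀ hF₀ hF hLF ((key f).1 hf)
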